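/- Work over a field $\mathbb{k}$ of characteristic $0$, with homological grading, differentials of degree $-1$ and the Koszul sign rule. Let $\mathcal{C}=\mathcal{I}\oplus\overline{\mathcal{C}}$ be a conilpotent dg coproperad: $\overline{\mathcal{C}}$ is a dg $\mathbb{S}$-bimodule, left reduced ($\overline{\mathcal C}(0,n)=0$ for all $n$) or right reduced ($\overline{\mathcal C}(m,0)=0$ for all $m$), with a dg coalgebra structure $\widetilde\Delta:\overline{\mathcal C}\to\mathcal{G}^c(\overline{\mathcal C})=\bigoplus_{\mathrm g}\mathrm{g}(\overline{\mathcal C})$ over the comonad of reduced connected directed graphs. Let $A,B$ be dg vector spaces, and write $\mathrm{End}^A_B(m,n)=\mathrm{Hom}(A^{\otimes n},B^{\otimes m})$, $\mathrm{End}_A=\mathrm{End}^A_A$. **Gebras and $\infty$-morphisms.** An $\Omega\mathcal C$-gebra structure on $A$ is a morphism of dg properads from the cobar construction $\Omega\mathcal C=(\mathcal G(s^{-1}\overline{\mathcal C}),d)$ to $\mathrm{End}_A$; it is identified with its restriction to generators, an equivariant map $\alpha:\overline{\mathcal C}\to \mathrm{End}_A$ of degree $-1$. An $\infty$-morphism $f:(A,\alpha)\rightsquigarrow(B,\beta)$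 is a degree $0$ map of $\mathbb{S}$-bimodules $f:\mathcal C\to\mathrm{End}^A_B$ with $$\partial f=f\rhd\alpha-\beta\lhd f .$$ Here $\beta\lhd f$ vanishes on $\mathcal I$ and is given on $\overline{\mathcal C}$ by decomposing along two-level connected graphs with one element of $\overline{\mathcal C}$ on the bottom level and $n\geqslant 1$ elements of $\mathcal C$ saturating the top level, applying $\beta$ to the former and $f$ to the latter, and composing; $f\rhd\alpha$ is defined symmetrically, with one element of $\overline{\mathcal C}$ at the top, to which $\alpha$ is applied, and $n\geqslant1$ elements of $\mathcal C$ saturating the bottom level. **The convolution algebra.** Let $f\star g$ be the product on $\mathrm{Hom}_{\mathbb S}(\overline{\mathcal C},\mathrm{End}_A)$ obtained by decomposing along graphs with two vertices, applying $f$ at the bottom and $g$ at the top, and composing. Set $$[sf,sg]=(-1)^{|f|}s(f\star g)-(-1)^{|f|(|g|+1)}s(g\star f).$$ For $n\geqslant1$, let $\mathrm U_{n+1}(s\beta,f_1,\dots,f_n)$ be defined like $\beta\lhd f$, with $\beta$ applied to the bottom element and the symmetrisation $f_1\odot\cdots\odot f_n=\sum_{\sigma\in\mathbb S_n}\varepsilon_\sigma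 f_{\sigma(1)}\otimes\cdots\otimes f_{\sigma(n)}$ to the $n$ top elements; let $\mathrm D_{n+1}(f_1,\dots,f_n,s\alpha)$ be defined likewise from $f\rhd\alpha$. Both are extended to all positions of $s\beta$, resp. $s\alpha$, by graded symmetry. The convolution shifted $\mathrm L_\infty$-algebra $\mathfrak k_{\mathcal C,A,B}$ is $$s\mathrm{Hom}_{\mathbb S}(\overline{\mathcal C},\mathrm{End}_A)\oplus\mathrm{Hom}_{\mathbb S}(\mathcal C,\mathrm{End}^A_B)\oplus s\mathrm{Hom}_{\mathbb S}(\overline{\mathcal C},\mathrm{End}_B)$$ with differential $(s\alpha,f,s\beta)\mapsto(-s\partial\alpha,-\partial f,-s\partial\beta)$ and operations $\mathcal k_2=[\,,]_A+[\,,]_B+\mathrm D_2-\mathrm U_2$ and $\mathcal k_n=\mathrm D_n-\mathrm U_n$ for $n\geqslant3$. For $\Omega\mathcal C$-gebra structures $\alpha,\beta$, the shifted $\mathrm L_\infty$-algebra $\mathfrak h_{\alpha,\beta}$ is $\mathrm{Hom}_{\mathbb S}(\mathcal C,\mathrm{End}^A_B)$ with $\mathcal l_1=\mathrm D_2(-,s\alpha)-\mathrm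 U_2(s\beta,-)-\partial$ and $\mathcal l_n=\mathrm D_{n+1}(-,\dots,-,s\alpha)-\mathrm U_{n+1}(s\beta,-,\dots,-)$ for $n\geqslant2$. **Filtration and Maurer–Cartan elements.** The weight of a graph is its number of vertices, and its size is the maximal number of edges (legs included) crossing a horizontal level. Both algebras carry the canonical filtration: $s\alpha$ (or $s\beta$) is in $\mathscr F_k$ if $\alpha$ (or $\beta$) vanishes on the elements $c\in\overline{\mathcal C}$ for which $\widetilde\Delta(c)$ is supported by graphs of weight $\leqslant k-1$; and $f\in\mathscr F_k$ if $f$ vanishes on the elements $c\in\overline{\mathcal C}$ for which $\widetilde\Delta(c)$ is supported by graphs with weight plus size $\leqslant k-1$ and, when $k\geqslant2$, also on $\mathrm{id}\in\mathcal I$. A Maurer–Cartan element is an element $x$ of degree $0$ such that, in the topology of the filtration, $\sum_{n\geqslant1}\frac1{n!}\mathcal l_n(x,\dots,x)=0$, where $\mathcal l_n$ are the structure operations and $\mathcal l_1$ is the differential. **Theorem.** 1. A triple $(s\alpha,f,s\beta)$ is a Maurer–Cartan element of $\mathfrak k_{\mathcal C,A,B}$ if and only if $\alpha$ and $\beta$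 are $\Omega\mathcal C$-gebra structures on $A$ and $B$, and $f$ is an $\infty$-morphism $(A,\alpha)\rightsquigarrow(B,\beta)$. 2. For all $\Omega\mathcal C$-gebra structures $\alpha$ on $A$ and $\beta$ on $B$, the set $\mathrm{MC}(\mathfrak h_{\alpha,\beta})$ is equal to the set of $\infty$-morphisms $(A,\alpha)\rightsquigarrow(B,\beta)$. -/

import Mathlib

open scoped TensorProduct DirectSum

namespace Gebra

universe uk uc ua ub

/-! ## Differential graded vector spaces and the Koszul sign rule -/

/-- The sign `(-1) ^ a`. -/
def sgn (k : Type uk) [Field k] (a : ℤ) : k := if Even a then 1 else -1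

/-- A dg vector space: a `ℤ`-graded vector space with a square-zero differential of degree `-1`. -/
structure DGModule (k : Type uk) [Field k] where
  carrier : Type ua
  [addCommGroup : AddCommGroup carrier]
  [module : Module k carrier]
  gr : ℤ → Submodule k carrier
  internal : DirectSum.IsInternal gr
  d : carrier →ₗ[k] carrier
  d_mem : ∀ p, ∀ x ∈ gr p, d x ∈ gr (p - 1)
  d_d : ∀ x, d (d x) = 0

attribute [instance] DGModule.addCommGroup DGModule.module

noncomputable section

section Signs

variable {k : Type uk} [Field k]

/-- The parity involution `x ↦ (-1)^|x| x`. -/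
def DGModule.inv (V : DGModule.{uk, ua} k) : V.carrier →ₗ[k] V.carrier :=
  DirectSum.toModule k ℤ V.carrier (fun p => sgn k p • (V.gr p).subtype) ∘ₗ
    (LinearEquiv.ofBijective (DirectSum.coeLinearMap V.gr) V.internal).symm.toLinearMap

/-- The iterate `x ↦ (-1)^(e|x|) x` of a parity involution `s`. -/
def spow {X : Type ua} [AddCommGroup X] [Module k X] (s : X →ₗ[k] X) (e : ℤ) : X →ₗ[k] X :=
  if Even e then LinearMap.id else s

/-- The projection on the odd part (`true`) or on the even part (`false`) for a parity
involution `s`. -/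
def parityProj {X : Type ua} [AddCommGroup X] [Module k X] (s : X →ₗ[k] X) (b : Bool) :
    X →ₗ[k] X :=
  (2 : k)⁻¹ • (LinearMap.id + (if b then (-1 : k) else 1) • s)

/-- The Koszul sign of the bijection `e` between finite sets ordered by the (injective) rank
functions `r` and `r'`, for elements of degrees `deg`: one factor `(-1)^(|x_i| |x_j|)` for every
pair whose order is reversed. -/
def koszulSign (k : Type uk) [Field k] {ι κ : Type*} [Fintype ι] (r : ι → ℕ) (r' : κ → ℕ)
    (e : ι ≃ κ) (deg : ι → ℤ) : k :=
  ∏ i, ∏ j, if r i < r j ∧ r' (e j) < r' (e i) then sgn k (deg i * deg j) else 1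

/-- The degree `0` or `1` of a parity. -/
def parityDeg (b : Bool) : ℤ := if b then 1 else 0

/-- The Koszul-signed permutation of tensor factors along `e`, where `X` has parity
involution `s`. -/
def koszulPerm {X : Type ua} [AddCommGroup X] [Module k X] (s : X →ₗ[k] X)
    {ι κ : Type} [Fintype ι] (r : ι → ℕ) (r' : κ → ℕ) (e : ι ≃ κ) :
    (⨂[k] _ : ι, X) →ₗ[k] (⨂[k] _ : κ, X) := by
  classical
  exact
    ∑ δ : ι → Bool, koszulSign k r r' e (fun i => parityDeg (δ i)) •
      ((PiTensorProduct.reindex k (fun _ => X) e).toLinearMap ∘ₗ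
        PiTensorProduct.map (fun i => parityProj s (δ i)))

/-- The action on tensor powers of a bijection `Fin n ≃ Fin n'` (so that `n = n'`). -/
def finPerm {X : Type ua} [AddCommGroup X] [Module k X] (s : X →ₗ[k] X) {n n' : ℕ}
    (e : Fin n ≃ Fin n') : (⨂[k] _ : Fin n, X) →ₗ[k] (⨂[k] _ : Fin n', X) :=
  koszulPerm s (fun i => (i : ℕ)) (fun i => (i : ℕ)) e

/-- The degree `q` part of a tensor product of dg vector spaces. -/
def tensorGr {ι : Type} [Fintype ι] (V : ι → DGModule.{uk, ua} k) (q : ℤ) :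
    Submodule k (⨂[k] i, (V i).carrier) :=
  Submodule.span k {t | ∃ (δ : ι → ℤ) (x : ∀ i, (V i).carrier),
    (∀ i, x i ∈ (V i).gr (δ i)) ∧ ∑ i, δ i = q ∧ t = PiTensorProduct.tprod k x}

/-- The differential of an ordered tensor product of dg vector spaces. -/
def tensorD {K : ℕ} (V : Fin K → DGModule.{uk, ua} k) :
    (⨂[k] i, (V i).carrier) →ₗ[k] (⨂[k] i, (V i).carrier) :=
  ∑ i : Fin K, PiTensorProduct.map
    (fun j => if j < i then (V j).inv else if j = i then (V j).d else LinearMap.id)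

/-- The parity involution of a tensor product of dg vector spaces. -/
def tensorInv {K : ℕ} (V : Fin K → DGModule.{uk, ua} k) :
    (⨂[k] i, (V i).carrier) →ₗ[k] (⨂[k] i, (V i).carrier) :=
  PiTensorProduct.map (fun j => (V j).inv)

end Signs

/-- The tensor power `A^{⊗ n}`. -/
abbrev TPow {k : Type uk} [Field k] (A : DGModule.{uk, ua} k) (n : ℕ) : Type _ :=
  ⨂[k] _ : Fin n, A.carrier

/-- `End^A_B(m, n) = Hom(A^{⊗ n}, B^{⊗ m})`; in particular `End_A = End^A_A`. -/
abbrev EndHom {k : Type uk} [Field k] (A : DGModule.{uk, ua} k) (B : DGModule.{uk, ub} k)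
    (m n : ℕ) : Type _ :=
  TPow A n →ₗ[k] TPow B m

/-- The differential `∂φ = d φ - (-1)^|φ| φ d` of `End^A_B(m, n)`; here `(-1)^|φ| φ` is the
conjugate of `φ` by the parity involutions. -/
def endD {k : Type uk} [Field k] (A : DGModule.{uk, ua} k) (B : DGModule.{uk, ub} k) {m n : ℕ}
    (φ : EndHom A B m n) : EndHom A B m n :=
  tensorD (fun _ : Fin m => B) ∘ₗ φ -
    (tensorInv (fun _ : Fin m => B) ∘ₗ φ ∘ₗ tensorInv (fun _ : Fin n => A)) ∘ₗ
      tensorD (fun _ : Fin n => A)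

/-! ## Directed connected graphs -/

/-- A reduced directed connected graph with `K ≥ 1` vertices, with `m` numbered output legs and `n`
numbered input legs. The flags at every vertex are numbered. The wiring sends every source of an
edge (an input leg of the graph or an output flag of a vertex) to its target (an output leg of the
graph or an input flag of a vertex). There are no directed cycles: the numbering of the vertices
goes from bottom to top, that is the edges go from larger to smaller vertices. -/
@[ext]
structure Graph (K m n : ℕ) where
  out : Fin K → ℕ
  inn : Fin K → ℕ
  wire : (Fin n ⊕ Σ v, Fin (out v)) ≃ (Fin m ⊕ Σ v, Fin (inn v))
  progressive : ∀ v w i j, wire (.inr ⟨v, i⟩) = .inr ⟨w, j⟩ → w < v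
  nonempty : 0 < K
  no_strand : ∀ i j, wire (.inl i) ≠ .inl j
  connected : ∀ v w, Relation.EqvGen
    (fun a b => ∃ i j, wire (.inr ⟨a, i⟩) = .inr ⟨b, j⟩) v w

namespace Graph

variable {K m n : ℕ} (g : Graph K m n)

/-- The edges (including the legs), seen as sources. -/
abbrev Edge : Type := Fin n ⊕ Σ v, Fin (g.out v)

/-- The edge `e` starts at an input leg or at a vertex `v ≥ j`. -/
def StartsAbove (j : ℕ) (e : g.Edge) : Prop := ∀ v i, e = .inr ⟨v, i⟩ → j ≤ (v : ℕ)

/-- The edge `e` ends at an output leg or at a vertex `w < j`. -/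
def EndsBelow (j : ℕ) (e : g.Edge) : Prop := ∀ w i, g.wire e = .inr ⟨w, i⟩ → (w : ℕ) < j

/-- The edges that cross the level between the vertices `≥ j` and the vertices `< j`. -/
def Cut (j : ℕ) : Type := {e : g.Edge // g.StartsAbove j e ∧ g.EndsBelow j e}

/-- The edges that pass by the vertex `v`, at its level. -/
def Through (v : Fin K) : Type := {e : g.Edge // g.StartsAbove (v + 1) e ∧ g.EndsBelow v e}

instance (j : ℕ) : Fintype (g.Cut j) := by
  classical exact inferInstanceAs (Fintype {e : g.Edge // g.StartsAbove j e ∧ g.EndsBelow j e})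

instance (v : Fin K) : Fintype (g.Through v) := by
  classical exact
    inferInstanceAs (Fintype {e : g.Edge // g.StartsAbove (v + 1) e ∧ g.EndsBelow v e})

/-- A numbering of the edges. -/
def edgeRank (e : g.Edge) : ℕ :=
  Sum.elim (fun i : Fin n => (i : ℕ)) (fun x => n + (finSigmaFinEquiv x : ℕ)) e

/-- Just above `v`, one sees the edges entering `v` and the edges passing by. -/
def inMap (v : Fin K) : Fin (g.inn v) ⊕ g.Through v → g.Cut (v + 1)
  | .inl i => ⟨g.wire.symm (.inr ⟨v, i⟩), by
      refine ⟨fun u j h => ?_, fun w j h => ?_⟩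
      · have : g.wire (.inr ⟨u, j⟩) = .inr ⟨v, i⟩ := by rw [← h, Equiv.apply_symm_apply]
        exact g.progressive _ _ _ _ this
      · rw [Equiv.apply_symm_apply] at h
        cases h
        exact Nat.lt_succ_self _⟩
  | .inr x => ⟨x.1, x.2.1, fun w i h => Nat.lt_succ_of_lt (x.2.2 w i h)⟩

/-- Just below `v`, one sees the edges leaving `v` and the edges passing by. -/
def outMap (v : Fin K) : Fin (g.out v) ⊕ g.Through v → g.Cut v
  | .inl i => ⟨.inr ⟨v, i⟩, by
      refine ⟨fun u j h => ?_, fun w j h => g.progressive _ _ _ _ h⟩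
      cases h
      exact le_rfl⟩
  | .inr x => ⟨x.1, fun w i h => (Nat.le_succ _).trans (x.2.1 w i h), x.2.2⟩

theorem inMap_bijective (v : Fin K) : Function.Bijective (g.inMap v) := by
  constructor
  · rintro (i | x) (j | y) h
    · have := congrArg Subtype.val h
      simpa [inMap] using this
    · exfalso
      have := congrArg Subtype.val h
      simp only [inMap] at this
      exact lt_irrefl _ (y.2.2 v i (by rw [← this, Equiv.apply_symm_apply]))
    · exfalso
      have := congrArg Subtype.val h
      simp only [inMap] at this
      exact lt_irrefl _ (x.2.2 v j (by rw [this, Equiv.apply_symm_apply]))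
    · have := congrArg Subtype.val h
      simp only [inMap] at this
      exact congrArg Sum.inr (Subtype.ext this)
  · rintro ⟨e, he⟩
    by_cases hv : ∃ i, g.wire e = .inr ⟨v, i⟩
    · obtain ⟨i, hi⟩ := hv
      refine ⟨.inl i, Subtype.ext ?_⟩
      simp [inMap, ← hi]
    · refine ⟨.inr ⟨e, he.1, fun w i h => ?_⟩, Subtype.ext rfl⟩
      refine lt_of_le_of_ne (Nat.lt_succ_iff.mp (he.2 w i h)) (fun hw => hv ?_)
      obtain rfl : w = v := Fin.ext hw
      exact ⟨i, h⟩

theorem outMap_bijective (v : Fin K) : Function.Bijective (g.outMap v) := by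
  constructor
  · rintro (i | x) (j | y) h
    · have := congrArg Subtype.val h
      simpa [outMap] using this
    · exfalso
      have := congrArg Subtype.val h
      simp only [outMap] at this
      exact absurd (y.2.1 v i this.symm) (by omega)
    · exfalso
      have := congrArg Subtype.val h
      simp only [outMap] at this
      exact absurd (x.2.1 v j this) (by omega)
    · have := congrArg Subtype.val h
      simp only [outMap] at this
      exact congrArg Sum.inr (Subtype.ext this)
  · rintro ⟨e, he⟩
    by_cases hv : ∃ i, e = .inr ⟨v, i⟩
    · obtain ⟨i, rfl⟩ := hv
      exact ⟨.inl i, Subtype.ext rfl⟩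
    · refine ⟨.inr ⟨e, fun w i h => ?_, he.2⟩, Subtype.ext rfl⟩
      refine lt_of_le_of_ne (he.1 w i h) (fun hw => hv ?_)
      obtain rfl : v = w := Fin.ext hw
      exact ⟨i, h⟩

/-- At the top, one sees the input legs. -/
def topMap (i : Fin n) : g.Cut K :=
  ⟨.inl i, ⟨fun _ _ h => (by cases h), fun w _ _ => w.2⟩⟩

theorem topMap_bijective : Function.Bijective g.topMap := by
  constructor
  · intro i j h
    exact Sum.inl_injective (congrArg Subtype.val h)
  · rintro ⟨i | ⟨v, i⟩, he⟩
    · exact ⟨i, Subtype.ext rfl⟩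
    · exact absurd (he.1 v i rfl) (by omega)

/-- At the bottom, one sees the output legs. -/
def botMap (i : Fin m) : g.Cut 0 :=
  ⟨g.wire.symm (.inl i), fun _ _ _ => Nat.zero_le _, fun w j h => by
    rw [Equiv.apply_symm_apply] at h
    cases h⟩

theorem botMap_bijective : Function.Bijective g.botMap := by
  constructor
  · intro i j h
    exact Sum.inl_injective (g.wire.symm.injective (congrArg Subtype.val h))
  · rintro ⟨e, he⟩
    rcases h : g.wire e with i | ⟨w, i⟩
    · exact ⟨i, Subtype.ext (by simp [botMap, ← h])⟩
    · exact absurd (he.2 w i h) (by omega)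

/-- The size of a graph: the maximal number of edges crossing a horizontal level. The vertices
above a level form a set `S` closed under going up, and the edges crossing it are those which start
at an input leg or in `S` and which end at an output leg or outside `S`. -/
def size : ℕ := by
  classical
  exact
    Finset.sup (Finset.univ.filter (fun S : Finset (Fin K) =>
        ∀ v w i j, g.wire (.inr ⟨v, i⟩) = .inr ⟨w, j⟩ → w ∈ S → v ∈ S))
      (fun S => (Finset.univ.filter (fun e : g.Edge =>
        (∀ v i, e = .inr ⟨v, i⟩ → v ∈ S) ∧ (∀ w i, g.wire e = .inr ⟨w, i⟩ → w ∉ S))).card)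

/-- The inverse of the number of renumberings of the flags of a graph. Summing a function of
isomorphism classes with these weights over all the graphs with ordered vertices amounts to
summing `1 / |Aut|` times this function over isomorphism classes. -/
def weight (k : Type uk) [Field k] : k :=
  (∏ v, (((g.out v).factorial * (g.inn v).factorial : ℕ) : k))⁻¹

/-- The graph with one vertex. -/
def corolla (m n : ℕ) : Graph 1 m n where
  out := fun _ => m
  inn := fun _ => n
  wire :=
    { toFun := Sum.elim (fun j => .inr ⟨0, j⟩) (fun x => .inl x.2)
      invFun := Sum.elim (fun i => .inr ⟨0, i⟩) (fun x => .inl x.2)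
      left_inv := by
        rintro (j | ⟨v, i⟩)
        · rfl
        · obtain rfl : v = 0 := Subsingleton.elim _ _
          rfl
      right_inv := by
        rintro (j | ⟨v, i⟩)
        · rfl
        · obtain rfl : v = 0 := Subsingleton.elim _ _
          rfl }
  progressive := by
    intro v w i j h
    simp at h
  nonempty := Nat.one_pos
  no_strand := by
    intro i j h
    simp at h
  connected := by
    intro v w
    obtain rfl : v = w := Subsingleton.elim _ _
    exact Relation.EqvGen.refl _

/-- An isomorphism between graphs, not necessarily preserving the numbering of the vertices, of the
flags and of the legs. -/
structure Iso {m' n' : ℕ} (g : Graph K m n) (g' : Graph K m' n') where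
  vert : Fin K ≃ Fin K
  outE : ∀ w, Fin (g.out (vert w)) ≃ Fin (g'.out w)
  innE : ∀ w, Fin (g.inn (vert w)) ≃ Fin (g'.inn w)
  legOut : Fin m ≃ Fin m'
  legInn : Fin n ≃ Fin n'
  wire_comm : ∀ e : g'.Edge,
    g.wire (Sum.map legInn.symm (fun x => ⟨vert x.1, (outE x.1).symm x.2⟩) e) =
      Sum.map legOut.symm (fun x => ⟨vert x.1, (innE x.1).symm x.2⟩) (g'.wire e)

/-- A flag which does not belong to the vertex `v`, or a leg. -/
def outerFlag {a : ℕ} (ar : Fin K → ℕ) (v : Fin K)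
    (x : Fin a ⊕ Σ u : ({v}ᶜ : Set (Fin K)), Fin (ar u)) : Fin a ⊕ Σ u, Fin (ar u) :=
  Sum.map id (fun y => ⟨y.1, y.2⟩) x

/-- `G` is the graph obtained by inserting the graph `h` in place of the vertex `v` of `g`. The
vertices of `h` take the place of `v` in the order of the vertices. -/
structure Insertion (g : Graph K m n) (v : Fin K) {L : ℕ} (h : Graph L (g.out v) (g.inn v)) where
  N : ℕ
  G : Graph N m n
  vert : ({v}ᶜ : Set (Fin K)) ⊕ Fin L ≃ Fin N
  vert_lt : ∀ y y', Sum.elim Subtype.val (fun _ => v) y < Sum.elim Subtype.val (fun _ => v) y' →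
    vert y < vert y'
  vert_lt_inner : ∀ w w', w < w' → vert (.inr w) < vert (.inr w')
  out_eq : ∀ y, Sum.elim (fun u : ({v}ᶜ : Set (Fin K)) => g.out u) h.out y = G.out (vert y)
  inn_eq : ∀ y, Sum.elim (fun u : ({v}ᶜ : Set (Fin K)) => g.inn u) h.inn y = G.inn (vert y)
  wire_outer : ∀ e t, g.wire (outerFlag g.out v e) = outerFlag g.inn v t →
    G.wire (Sum.map id (fun y => ⟨vert (.inl y.1), Fin.cast (out_eq (.inl y.1)) y.2⟩) e) =
      Sum.map id (fun y => ⟨vert (.inl y.1), Fin.cast (inn_eq (.inl y.1)) y.2⟩) t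
  wire_enter : ∀ e j w j', g.wire (outerFlag g.out v e) = .inr ⟨v, j⟩ →
    h.wire (.inl j) = .inr ⟨w, j'⟩ →
    G.wire (Sum.map id (fun y => ⟨vert (.inl y.1), Fin.cast (out_eq (.inl y.1)) y.2⟩) e) =
      .inr ⟨vert (.inr w), Fin.cast (inn_eq (.inr w)) j'⟩
  wire_inner : ∀ w i w' j, h.wire (.inr ⟨w, i⟩) = .inr ⟨w', j⟩ →
    G.wire (.inr ⟨vert (.inr w), Fin.cast (out_eq (.inr w)) i⟩) =
      .inr ⟨vert (.inr w'), Fin.cast (inn_eq (.inr w')) j⟩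
  wire_exit : ∀ w i i' t, h.wire (.inr ⟨w, i⟩) = .inl i' →
    g.wire (.inr ⟨v, i'⟩) = outerFlag g.inn v t →
    G.wire (.inr ⟨vert (.inr w), Fin.cast (out_eq (.inr w)) i⟩) =
      Sum.map id (fun y => ⟨vert (.inl y.1), Fin.cast (inn_eq (.inl y.1)) y.2⟩) t

/-! ### Composition of multilinear operations along a graph -/

section Composition

variable {k : Type uk} [Field k] {X : Type ua} [AddCommGroup X] [Module k X] (s : X →ₗ[k] X)

/-- Apply the operation `φ` to the edges entering the vertex `v`. -/
def step (v : Fin K)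
    (φ : (⨂[k] _ : Fin (g.inn v), X) →ₗ[k] (⨂[k] _ : Fin (g.out v), X)) :
    (⨂[k] _ : g.Cut (v + 1), X) →ₗ[k] (⨂[k] _ : g.Cut v, X) :=
  koszulPerm s
      (Sum.elim (fun i : Fin (g.out v) => (i : ℕ)) (fun x => g.out v + g.edgeRank x.1))
      (fun x : g.Cut v => g.edgeRank x.1) (Equiv.ofBijective _ (g.outMap_bijective v)) ∘ₗ
    (PiTensorProduct.tmulEquiv k X).toLinearMap ∘ₗ
    TensorProduct.map φ LinearMap.id ∘ₗ
    (PiTensorProduct.tmulEquiv k X).symm.toLinearMap ∘ₗ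
    koszulPerm s (fun x : g.Cut (v + 1) => g.edgeRank x.1)
      (Sum.elim (fun i : Fin (g.inn v) => (i : ℕ)) (fun x => g.inn v + g.edgeRank x.1))
      (Equiv.ofBijective _ (g.inMap_bijective v)).symm

/-- The composite of the operations `φ v` at the vertices `v < j`. -/
def compBelow (φ : ∀ v, (⨂[k] _ : Fin (g.inn v), X) →ₗ[k] (⨂[k] _ : Fin (g.out v), X)) :
    (j : ℕ) → j ≤ K → ((⨂[k] _ : g.Cut j, X) →ₗ[k] (⨂[k] _ : g.Cut 0, X))
  | 0, _ => LinearMap.id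
  | j + 1, h => compBelow φ j (Nat.le_of_succ_le h) ∘ₗ g.step s ⟨j, h⟩ (φ ⟨j, h⟩)

/-- The composite along the graph `g` of the operations `φ v : X^{⊗ inn v} → X^{⊗ out v}`, placed
at the vertices in their order (from bottom to top). -/
def compFun (φ : ∀ v, (⨂[k] _ : Fin (g.inn v), X) →ₗ[k] (⨂[k] _ : Fin (g.out v), X)) :
    (⨂[k] _ : Fin n, X) →ₗ[k] (⨂[k] _ : Fin m, X) :=
  koszulPerm s (fun x : g.Cut 0 => g.edgeRank x.1) (fun i : Fin m => (i : ℕ))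
      (Equiv.ofBijective _ g.botMap_bijective).symm ∘ₗ
    g.compBelow s φ K le_rfl ∘ₗ
    koszulPerm s (fun i : Fin n => (i : ℕ)) (fun x : g.Cut K => g.edgeRank x.1)
      (Equiv.ofBijective _ g.topMap_bijective)

theorem step_add (v : Fin K)
    (φ ψ : (⨂[k] _ : Fin (g.inn v), X) →ₗ[k] (⨂[k] _ : Fin (g.out v), X)) :
    g.step s v (φ + ψ) = g.step s v φ + g.step s v ψ := by
  simp only [step, TensorProduct.map_add_left, LinearMap.comp_add, LinearMap.add_comp]

theorem step_smul (v : Fin K) (c : k)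
    (φ : (⨂[k] _ : Fin (g.inn v), X) →ₗ[k] (⨂[k] _ : Fin (g.out v), X)) :
    g.step s v (c • φ) = c • g.step s v φ := by
  simp only [step, TensorProduct.map_smul_left, LinearMap.comp_smul, LinearMap.smul_comp]

theorem compBelow_congr
    (φ ψ : ∀ v, (⨂[k] _ : Fin (g.inn v), X) →ₗ[k] (⨂[k] _ : Fin (g.out v), X)) (j : ℕ)
    (hj : j ≤ K) (h : ∀ v : Fin K, (v : ℕ) < j → φ v = ψ v) :
    g.compBelow s φ j hj = g.compBelow s ψ j hj := by
  induction j with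
  | zero => rfl
  | succ j ih =>
    rw [compBelow, compBelow, ih _ (fun v hv => h v (Nat.lt_succ_of_lt hv)),
      h ⟨j, hj⟩ (Nat.lt_succ_self _)]

theorem compBelow_update_add [DecidableEq (Fin K)]
    (φ : ∀ v, (⨂[k] _ : Fin (g.inn v), X) →ₗ[k] (⨂[k] _ : Fin (g.out v), X)) (v : Fin K)
    (x y : (⨂[k] _ : Fin (g.inn v), X) →ₗ[k] (⨂[k] _ : Fin (g.out v), X)) (j : ℕ) (hj : j ≤ K)
    (hv : (v : ℕ) < j) :
    g.compBelow s (Function.update φ v (x + y)) j hj =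
      g.compBelow s (Function.update φ v x) j hj + g.compBelow s (Function.update φ v y) j hj := by
  induction j with
  | zero => omega
  | succ j ih =>
    simp only [compBelow]
    by_cases h : (v : ℕ) < j
    · have hne : (⟨j, hj⟩ : Fin K) ≠ v := fun e => by
        rw [← e] at h
        exact lt_irrefl _ h
      simp only [Function.update_of_ne hne, ih _ h, LinearMap.add_comp]
    · obtain rfl : v = ⟨j, hj⟩ := Fin.ext (by simp only; omega)
      have hc : ∀ z, g.compBelow s (Function.update φ ⟨j, hj⟩ z) j (Nat.le_of_succ_le hj) =
          g.compBelow s φ j (Nat.le_of_succ_le hj) := fun z =>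
        g.compBelow_congr s _ _ _ _ (fun w hw => Function.update_of_ne
          (fun e => by rw [e] at hw; exact lt_irrefl _ hw) _ _)
      simp only [Function.update_self, hc, step_add, LinearMap.comp_add]

theorem compBelow_update_smul [DecidableEq (Fin K)]
    (φ : ∀ v, (⨂[k] _ : Fin (g.inn v), X) →ₗ[k] (⨂[k] _ : Fin (g.out v), X)) (v : Fin K) (c : k)
    (x : (⨂[k] _ : Fin (g.inn v), X) →ₗ[k] (⨂[k] _ : Fin (g.out v), X)) (j : ℕ) (hj : j ≤ K)
    (hv : (v : ℕ) < j) :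
    g.compBelow s (Function.update φ v (c • x)) j hj =
      c • g.compBelow s (Function.update φ v x) j hj := by
  induction j with
  | zero => omega
  | succ j ih =>
    simp only [compBelow]
    by_cases h : (v : ℕ) < j
    · have hne : (⟨j, hj⟩ : Fin K) ≠ v := fun e => by
        rw [← e] at h
        exact lt_irrefl _ h
      simp only [Function.update_of_ne hne, ih _ h, LinearMap.smul_comp]
    · obtain rfl : v = ⟨j, hj⟩ := Fin.ext (by simp only; omega)
      have hc : ∀ z, g.compBelow s (Function.update φ ⟨j, hj⟩ z) j (Nat.le_of_succ_le hj) =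
          g.compBelow s φ j (Nat.le_of_succ_le hj) := fun z =>
        g.compBelow_congr s _ _ _ _ (fun w hw => Function.update_of_ne
          (fun e => by rw [e] at hw; exact lt_irrefl _ hw) _ _)
      simp only [Function.update_self, hc, step_smul, LinearMap.comp_smul]

/-- The composition along the graph `g`, as a map defined on the tensor product of the spaces of
operations. -/
def comp : (⨂[k] v, ((⨂[k] _ : Fin (g.inn v), X) →ₗ[k] (⨂[k] _ : Fin (g.out v), X))) →ₗ[k]
    ((⨂[k] _ : Fin n, X) →ₗ[k] (⨂[k] _ : Fin m, X)) :=
  PiTensorProduct.lift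
    { toFun := g.compFun s
      map_update_add' := fun φ v x y => by
        simp only [compFun, g.compBelow_update_add s φ v x y K le_rfl v.2, LinearMap.add_comp,
          LinearMap.comp_add]
      map_update_smul' := fun φ v c x => by
        simp only [compFun, g.compBelow_update_smul s φ v c x K le_rfl v.2, LinearMap.smul_comp,
          LinearMap.comp_smul] }

end Composition

end Graph

/-! ## Conilpotent dg coproperads -/

/-- A dg `𝕊`-bimodule. The component `obj m n` has `m` outputs and `n` inputs. The left action of
`𝕊_m` and the right action of `𝕊_n` are written `act σ τ c = σ · c · τ⁻¹`; bijections
`Fin m ≃ Fin m'` are allowed (then `m = m'`). -/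
structure DGSBimodule (k : Type uk) [Field k] where
  obj : ℕ → ℕ → DGModule.{uk, uc} k
  act : ∀ {m m' n n' : ℕ}, (Fin m ≃ Fin m') → (Fin n ≃ Fin n') →
    (obj m n).carrier →ₗ[k] (obj m' n').carrier
  act_refl : ∀ {m n : ℕ} (c : (obj m n).carrier), act (Equiv.refl _) (Equiv.refl _) c = c
  act_trans : ∀ {m m' m'' n n' n'' : ℕ} (σ : Fin m ≃ Fin m') (σ' : Fin m' ≃ Fin m'')
    (τ : Fin n ≃ Fin n') (τ' : Fin n' ≃ Fin n'') (c : (obj m n).carrier),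
    act (σ.trans σ') (τ.trans τ') c = act σ' τ' (act σ τ c)
  act_mem : ∀ {m m' n n' : ℕ} (σ : Fin m ≃ Fin m') (τ : Fin n ≃ Fin n') (p : ℤ),
    ∀ c ∈ (obj m n).gr p, act σ τ c ∈ (obj m' n').gr p
  act_d : ∀ {m m' n n' : ℕ} (σ : Fin m ≃ Fin m') (τ : Fin n ≃ Fin n') (c : (obj m n).carrier),
    act σ τ ((obj m n).d c) = (obj m' n').d (act σ τ c)

namespace DGSBimodule

variable {k : Type uk} [Field k] (M : DGSBimodule.{uk, uc} k) {K m n : ℕ}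

/-- The space of labels of the vertex `v`. -/
abbrev lab (g : Graph K m n) (v : Fin K) : DGModule.{uk, uc} k := M.obj (g.out v) (g.inn v)

/-- The space `g(M)` of labellings of the ordered vertices of the graph `g` by `M`. -/
abbrev Dec (g : Graph K m n) : Type _ := ⨂[k] v, (M.lab g v).carrier

/-- The Koszul-signed action of an isomorphism of graphs on labellings. -/
def relabel {m' n' : ℕ} {g : Graph K m n} {g' : Graph K m' n'} (i : g.Iso g') :
    M.Dec g →ₗ[k] M.Dec g' :=
  ∑ δ : Fin K → Bool,
    koszulSign k (fun v : Fin K => (v : ℕ)) (fun v : Fin K => (v : ℕ)) i.vert.symm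
      (fun v => parityDeg (δ v)) •
    (PiTensorProduct.map (fun w => M.act (i.outE w) (i.innE w)) ∘ₗ
      (PiTensorProduct.reindex k (fun v => (M.lab g v).carrier) i.vert.symm).toLinearMap ∘ₗ
      PiTensorProduct.map (fun v => parityProj (M.lab g v).inv (δ v)))

/-- Given an insertion of `h` at the vertex `v` of `g`, apply `δ : M(v) → h(M)` to the label of
`v`. -/
def insertAt {g : Graph K m n} {v : Fin K} {L : ℕ} {h : Graph L (g.out v) (g.inn v)}
    (σ : g.Insertion v h) (δ : (M.lab g v).carrier →ₗ[k] M.Dec h) : M.Dec g →ₗ[k] M.Dec σ.G :=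
  PiTensorProduct.map (fun x => M.act
      (finCongr ((σ.out_eq (σ.vert.symm x)).trans (by rw [Equiv.apply_symm_apply])))
      (finCongr ((σ.inn_eq (σ.vert.symm x)).trans (by rw [Equiv.apply_symm_apply])))) ∘ₗ
    (PiTensorProduct.reindex k (fun y => (M.obj
      (Sum.elim (fun u : ({v}ᶜ : Set (Fin K)) => g.out u) h.out y)
      (Sum.elim (fun u : ({v}ᶜ : Set (Fin K)) => g.inn u) h.inn y)).carrier)
      σ.vert).toLinearMap ∘ₗ
    (PiTensorProduct.tmulEquivDep k (fun y => (M.obj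
      (Sum.elim (fun u : ({v}ᶜ : Set (Fin K)) => g.out u) h.out y)
      (Sum.elim (fun u : ({v}ᶜ : Set (Fin K)) => g.inn u) h.inn y)).carrier)).toLinearMap ∘ₗ
    TensorProduct.map LinearMap.id δ ∘ₗ
    (PiTensorProduct.equivPiTensorComplSingletonTensor k
      (fun u => (M.lab g u).carrier) v).toLinearMap

end DGSBimodule

/-- A conilpotent dg coproperad `C = I ⊕ C̄`, given by its coaugmentation coideal `C̄` and its
comonadic decomposition map `C̄ → 𝒢ᶜ(C̄) = ⨁ g(C̄)`, where `g` runs over the isomorphism classes of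
reduced directed connected graphs: it is a dg coalgebra over the comonad `𝒢ᶜ`.
The component `dec g` takes its values in the invariants of the labellings of `g`: it is the sum of
the terms of the decomposition map transported along all the isomorphisms from their supporting
graph to `g` (in characteristic `0`, this identifies coinvariants with invariants). -/
structure ConilpotentDGCoproperad (k : Type uk) [Field k] extends DGSBimodule.{uk, uc} k where
  dec : ∀ {K m n : ℕ} (g : Graph K m n), (obj m n).carrier →ₗ[k] toDGSBimodule.Dec g
  /-- The decomposition map has degree `0`. -/
  dec_gr : ∀ {K m n : ℕ} (g : Graph K m n) (p : ℤ), ∀ c ∈ (obj m n).gr p,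
    dec g c ∈ tensorGr (toDGSBimodule.lab g) p
  /-- The differential is a coderivation. -/
  dec_d : ∀ {K m n : ℕ} (g : Graph K m n) (c : (obj m n).carrier),
    dec g ((obj m n).d c) = tensorD (toDGSBimodule.lab g) (dec g c)
  /-- Compatibility with the symmetric group actions and invariance. -/
  dec_iso : ∀ {K m n m' n' : ℕ} (g : Graph K m n) (g' : Graph K m' n') (i : g.Iso g')
    (c : (obj m n).carrier),
    dec g' (act i.legOut i.legInn c) = toDGSBimodule.relabel i (dec g c)
  /-- Counit of the comonad. -/
  dec_corolla : ∀ {m n : ℕ} (c : (obj m n).carrier),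
    dec (Graph.corolla m n) c = PiTensorProduct.tprod k (fun _ => c)
  /-- Coassociativity. -/
  dec_insertion : ∀ {K L m n : ℕ} (g : Graph K m n) (v : Fin K)
    (h : Graph L (g.out v) (g.inn v)) (σ : g.Insertion v h) (c : (obj m n).carrier),
    dec σ.G c = toDGSBimodule.insertAt σ (dec h) (dec g c)
  /-- The decomposition of every element is supported by finitely many isomorphism classes of
  graphs, that is by graphs with a bounded number of vertices and of edges. -/
  dec_finite : ∀ {m n : ℕ} (c : (obj m n).carrier), ∃ N : ℕ, ∀ (K : ℕ) (g : Graph K m n),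
    (N < K ∨ N < ∑ v, g.out v) → dec g c = 0
  /-- `C̄` is left reduced or right reduced. -/
  reduced : (∀ n, Subsingleton (obj 0 n).carrier) ∨ (∀ m, Subsingleton (obj m 0).carrier)

/-- The coradical filtration of `C̄`: the elements whose decomposition is supported by graphs with
at most `r` vertices. -/
def ConilpotentDGCoproperad.coradical {k : Type uk} [Field k]
    (C : ConilpotentDGCoproperad.{uk, uc} k) (r m n : ℕ) : Submodule k (C.obj m n).carrier :=
  ⨅ (K : ℕ) (g : Graph K m n) (_ : r < K), LinearMap.ker (C.dec g)

/-- The density filtration on `C̄`: the elements whose decomposition is supported by graphs whose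
sum of weight (number of vertices) and size is at most `r`. -/
def ConilpotentDGCoproperad.density {k : Type uk} [Field k]
    (C : ConilpotentDGCoproperad.{uk, uc} k) (r m n : ℕ) : Submodule k (C.obj m n).carrier :=
  ⨅ (K : ℕ) (g : Graph K m n) (_ : r < K + g.size), LinearMap.ker (C.dec g)

/-! ## Convolution spaces and operations -/

section Convolution

variable {k : Type uk} [Field k]

/-- The sum of a family of linear maps which is finite on every element. -/
def locSum {ι : Type*} {V : Type*} {W : Type*} [AddCommGroup V] [Module k V] [AddCommGroup W]
    [Module k W] (F : ι → V →ₗ[k] W) : V →ₗ[k] W := by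
  classical
  exact
    if h : ∀ x, (Function.support (fun i => F i x)).Finite then
      { toFun := fun x => ∑ᶠ i, F i x
        map_add' := fun x y => by
          simp only [map_add]
          exact finsum_add_distrib (h x) (h y)
        map_smul' := fun c x => by
          simp only [map_smul, RingHom.id_apply]
          exact (smul_finsum' c (h x)).symm }
    else 0

/-- The linear map `φ ↦ post ∘ φ ∘ pre`. -/
def sandwich {V V' W W' : Type*} [AddCommGroup V] [Module k V] [AddCommGroup V'] [Module k V']
    [AddCommGroup W] [Module k W] [AddCommGroup W'] [Module k W']
    (post : W →ₗ[k] W') (pre : V' →ₗ[k] V) : (V →ₗ[k] W) →ₗ[k] (V' →ₗ[k] W') where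
  toFun φ := post ∘ₗ φ ∘ₗ pre
  map_add' φ ψ := by simp only [LinearMap.add_comp, LinearMap.comp_add]
  map_smul' c φ := by simp only [LinearMap.smul_comp, LinearMap.comp_smul, RingHom.id_apply]

/-- The operation `φ` has degree `p`. -/
def HasDegree {A : DGModule.{uk, ua} k} {B : DGModule.{uk, ub} k} {m n : ℕ} (p : ℤ)
    (φ : EndHom A B m n) : Prop :=
  ∀ q, ∀ x ∈ tensorGr (fun _ : Fin n => A) q, φ x ∈ tensorGr (fun _ : Fin m => B) (q + p)

/-- Families of linear maps `M(m, n) → End^A_B(m, n)`. -/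
abbrev Conv (M : DGSBimodule.{uk, uc} k) (A : DGModule.{uk, ua} k) (B : DGModule.{uk, ub} k) :
    Type _ :=
  ∀ m n, (M.obj m n).carrier →ₗ[k] EndHom A B m n

/-- The degree `p` part of `Hom_𝕊(M, End^A_B)`: the equivariant families of degree `p`. -/
def homS (M : DGSBimodule.{uk, uc} k) (A : DGModule.{uk, ua} k) (B : DGModule.{uk, ub} k)
    (p : ℤ) : Submodule k (Conv M A B) where
  carrier := {φ |
    (∀ m n q, ∀ c ∈ (M.obj m n).gr q, HasDegree (q + p) (φ m n c)) ∧
    ∀ {m m' n n' : ℕ} (σ : Fin m ≃ Fin m') (τ : Fin n ≃ Fin n') (c : (M.obj m n).carrier),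
      φ m' n' (M.act σ τ c) ∘ₗ finPerm A.inv τ = finPerm B.inv σ ∘ₗ φ m n c}
  zero_mem' := by
    refine ⟨fun m n q c _ r x _ => ?_, fun σ τ c => ?_⟩ <;> simp
  add_mem' := by
    rintro φ ψ ⟨h1, h2⟩ ⟨h3, h4⟩
    refine ⟨fun m n q c hc r x hx => ?_, fun σ τ c => ?_⟩
    · exact Submodule.add_mem _ (h1 m n q c hc r x hx) (h3 m n q c hc r x hx)
    · simp only [Pi.add_apply, LinearMap.add_apply, LinearMap.add_comp, LinearMap.comp_add, h2, h4]
  smul_mem' := by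
    rintro a φ ⟨h1, h2⟩
    refine ⟨fun m n q c hc r x hx => ?_, fun σ τ c => ?_⟩
    · exact Submodule.smul_mem _ _ (h1 m n q c hc r x hx)
    · simp only [Pi.smul_apply, LinearMap.smul_apply, LinearMap.smul_comp, LinearMap.comp_smul, h2]

/-- The differential `∂φ = ∂ ∘ φ - (-1)^p φ ∘ d` of a family of degree `p`. The formula is linear
in `φ`, and `∂` is the differential of `End^A_B`. -/
def convD (M : DGSBimodule.{uk, uc} k) (A : DGModule.{uk, ua} k) (B : DGModule.{uk, ub} k)
    (p : ℤ) (φ : Conv M A B) : Conv M A B := fun m n =>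
  { toFun := fun c => endD A B (φ m n c)
    map_add' := fun x y => by
      simp only [endD, map_add, LinearMap.comp_add, LinearMap.add_comp]
      abel
    map_smul' := fun a x => by
      simp only [endD, map_smul, LinearMap.comp_smul, LinearMap.smul_comp, smul_sub,
        RingHom.id_apply] } -
  sgn k p • (φ m n ∘ₗ (M.obj m n).d)

/-- Apply maps `l v` of degrees `deg v` to the labels of the vertices of a graph and compose the
resulting operations along the graph; `extra` is the total degree of further maps applied after
all of these to elements of degree `0`. The signs come from the Koszul rule
`(l_0 ⊗ ⋯ ⊗ l_r)(c_0 ⊗ ⋯ ⊗ c_r) = ± l_0(c_0) ⊗ ⋯ ⊗ l_r(c_r)`. -/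
def evalGraph (M : DGSBimodule.{uk, uc} k) {X : Type ua} [AddCommGroup X] [Module k X]
    (s : X →ₗ[k] X) {K m n : ℕ} (g : Graph K m n)
    (l : ∀ v, (M.lab g v).carrier →ₗ[k]
      ((⨂[k] _ : Fin (g.inn v), X) →ₗ[k] (⨂[k] _ : Fin (g.out v), X)))
    (deg : Fin K → ℤ) (extra : ℤ) :
    M.Dec g →ₗ[k] ((⨂[k] _ : Fin n, X) →ₗ[k] (⨂[k] _ : Fin m, X)) :=
  g.comp s ∘ₗ PiTensorProduct.map (fun v =>
    l v ∘ₗ spow (M.lab g v).inv ((∑ w, if v < w then deg w else 0) + extra))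

/-- The Lie-admissible product `f ⋆ h` of the convolution algebra, for `f` and `h` of degrees `p`
and `q`: decompose along the graphs with two vertices, apply `f` at the bottom and `h` at the top,
and compose. -/
def star (C : ConilpotentDGCoproperad.{uk, uc} k) (A : DGModule.{uk, ua} k) (p q : ℤ)
    (f h : Conv C.toDGSBimodule A A) : Conv C.toDGSBimodule A A := fun m n =>
  locSum (fun g : Graph 2 m n => g.weight k •
    (evalGraph C.toDGSBimodule A.inv g
      (fun v => if v = 0 then f (g.out v) (g.inn v) else h (g.out v) (g.inn v))
      (fun v => if v = 0 then p else q) 0 ∘ₗ C.dec g))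

/-! ### Gebras over the cobar construction -/

/-- Labelled graphs with ordered vertices. The free properad `𝒢(s⁻¹C̄)`, in positive weight, is the
quotient of this space by the relabellings of graphs; the label `c` of a vertex stands for
`s⁻¹c`. -/
abbrev CobarPre (C : ConilpotentDGCoproperad.{uk, uc} k) (m n : ℕ) : Type _ :=
  ⨁ g : (Σ K, Graph K m n), C.Dec g.2

/-- The inclusion of the labellings of a graph. -/
def cobarIncl (C : ConilpotentDGCoproperad.{uk, uc} k) {K m n : ℕ} (g : Graph K m n) :
    C.Dec g →ₗ[k] CobarPre C m n := by
  classical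
  exact DirectSum.lof k (Σ K, Graph K m n) (fun g => C.Dec g.2) ⟨K, g⟩

/-- Apply `(c ↦ -(-1)^|c| c) = (-1)^|s⁻¹c| c` to the labels of the vertices before `v`. -/
def prefixSign (C : ConilpotentDGCoproperad.{uk, uc} k) {K m n : ℕ} (g : Graph K m n)
    (v : Fin K) : C.Dec g →ₗ[k] C.Dec g :=
  PiTensorProduct.map (fun u => if u < v then -(C.lab g u).inv else LinearMap.id)

/-- The differential of the cobar construction `ΩC = 𝒢(s⁻¹C̄)`, on representatives. It is the
derivation given on generators by
`d(s⁻¹c) = -s⁻¹(dc) - ∑ (-1)^|c'| s⁻¹c' ⊗ s⁻¹c''`, where the sum is the infinitesimal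
decomposition of `c` along the graphs with two vertices (`c'` at the bottom and `c''` at the
top). -/
def cobarD (C : ConilpotentDGCoproperad.{uk, uc} k) {K m n : ℕ} (g : Graph K m n) :
    C.Dec g →ₗ[k] CobarPre C m n :=
  ∑ v : Fin K,
    (-(cobarIncl C g ∘ₗ PiTensorProduct.map
        (fun u => if u = v then (C.lab g u).d else LinearMap.id) ∘ₗ prefixSign C g v) -
      locSum (fun x : (Σ h : Graph 2 (g.out v) (g.inn v), g.Insertion v h) =>
        x.1.weight k • (cobarIncl C x.2.G ∘ₗ
          C.insertAt x.2 (PiTensorProduct.map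
            (fun w => if w = 0 then (C.lab x.1 w).inv else LinearMap.id) ∘ₗ C.dec x.1) ∘ₗ
          prefixSign C g v)))

/-- The extension of `α : s⁻¹C̄ → End_A` to a morphism of properads `𝒢(s⁻¹C̄) → End_A`, on
representatives: it sends a labelled graph to the composite in `End_A`, along this graph, of the
images of the labels. -/
def cobarEval (C : ConilpotentDGCoproperad.{uk, uc} k) (A : DGModule.{uk, ua} k)
    (α : Conv C.toDGSBimodule A A) (m n : ℕ) : CobarPre C m n →ₗ[k] EndHom A A m n := by
  classical
  exact DirectSum.toModule k (Σ K, Graph K m n) (EndHom A A m n) (fun g =>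
    evalGraph C.toDGSBimodule A.inv g.2 (fun v => α (g.2.out v) (g.2.inn v)) (fun _ => 0) 0)

/-- `ΩC`-gebra structures on `A`, that is morphisms of dg properads `ΩC → End_A`. Such a morphism
is determined by its restriction to generators, which is an equivariant degree `0` map
`s⁻¹C̄ → End_A`, i.e. an equivariant map `α : C̄ → End_A` of degree `-1`; conversely, such an `α`
extends to a unique morphism of graded properads, which has to commute with the differentials. -/
def IsGebra (C : ConilpotentDGCoproperad.{uk, uc} k) (A : DGModule.{uk, ua} k)
    (α : Conv C.toDGSBimodule A A) : Prop :=
  α ∈ homS C.toDGSBimodule A A (-1) ∧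
  ∀ (K m n : ℕ) (g : Graph K m n) (x : C.Dec g),
    endD A A (cobarEval C A α m n (cobarIncl C g x)) = cobarEval C A α m n (cobarD C g x)

/-! ### Two-level graphs and `∞`-morphisms -/

/-- Two-level graphs with one vertex `0` on the bottom level and `p` vertices on the top level. The
top level is saturated by inserting identities on the input legs attached to the bottom vertex; it
has to be nonempty. -/
structure UpGraph (m n : ℕ) where
  p : ℕ
  g : Graph (p + 1) m n
  two_level : ∀ v w i j, g.wire (.inr ⟨v, i⟩) = .inr ⟨w, j⟩ → w = 0
  inn_pos : 0 < g.inn 0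

/-- The input legs attached to the bottom vertex. -/
def UpGraph.Direct {m n : ℕ} (G : UpGraph m n) : Type :=
  {x : Fin n // ∃ j, G.g.wire (.inl x) = .inr ⟨0, j⟩}

instance {m n : ℕ} (G : UpGraph m n) : Fintype G.Direct := by
  classical exact inferInstanceAs (Fintype {x : Fin n // ∃ j, G.g.wire (.inl x) = .inr ⟨0, j⟩})

/-- Two-level graphs with one vertex `Fin.last p` on the top level and `p` vertices on the bottom
level. The bottom level is saturated by inserting identities on the output legs attached to the top
vertex; it has to be nonempty. -/
structure DownGraph (m n : ℕ) where
  p : ℕ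
  g : Graph (p + 1) m n
  two_level : ∀ v w i j, g.wire (.inr ⟨v, i⟩) = .inr ⟨w, j⟩ → v = Fin.last p
  out_pos : 0 < g.out (Fin.last p)

/-- The output legs attached to the top vertex. -/
def DownGraph.Direct {m n : ℕ} (G : DownGraph m n) : Type :=
  {y : Fin m // ∃ i, G.g.wire (.inr ⟨Fin.last G.p, i⟩) = .inl y}

instance {m n : ℕ} (G : DownGraph m n) : Fintype G.Direct := by
  classical exact
    inferInstanceAs (Fintype {y : Fin m // ∃ i, G.g.wire (.inr ⟨Fin.last G.p, i⟩) = .inl y})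

/-- The parity involution of `A ⊕ B`. -/
def mixInv (A : DGModule.{uk, ua} k) (B : DGModule.{uk, ub} k) :
    (A.carrier × B.carrier) →ₗ[k] (A.carrier × B.carrier) :=
  LinearMap.prodMap A.inv B.inv

section Embeddings

variable (A : DGModule.{uk, ua} k) (B : DGModule.{uk, ub} k) (m n : ℕ)

/-- `End_A ⊂ End_{A ⊕ B}`. -/
def embAA : EndHom A A m n →ₗ[k]
    ((⨂[k] _ : Fin n, A.carrier × B.carrier) →ₗ[k] (⨂[k] _ : Fin m, A.carrier × B.carrier)) :=
  sandwich (PiTensorProduct.map (fun _ => LinearMap.inl k A.carrier B.carrier))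
    (PiTensorProduct.map (fun _ => LinearMap.fst k A.carrier B.carrier))

/-- `End^A_B ⊂ End_{A ⊕ B}`. -/
def embAB : EndHom A B m n →ₗ[k]
    ((⨂[k] _ : Fin n, A.carrier × B.carrier) →ₗ[k] (⨂[k] _ : Fin m, A.carrier × B.carrier)) :=
  sandwich (PiTensorProduct.map (fun _ => LinearMap.inr k A.carrier B.carrier))
    (PiTensorProduct.map (fun _ => LinearMap.fst k A.carrier B.carrier))

/-- `End_B ⊂ End_{A ⊕ B}`. -/
def embBB : EndHom B B m n →ₗ[k]
    ((⨂[k] _ : Fin n, A.carrier × B.carrier) →ₗ[k] (⨂[k] _ : Fin m, A.carrier × B.carrier)) :=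
  sandwich (PiTensorProduct.map (fun _ => LinearMap.inr k A.carrier B.carrier))
    (PiTensorProduct.map (fun _ => LinearMap.snd k A.carrier B.carrier))

/-- The projection `End_{A ⊕ B} → End^A_B`. -/
def projAB : ((⨂[k] _ : Fin n, A.carrier × B.carrier) →ₗ[k]
    (⨂[k] _ : Fin m, A.carrier × B.carrier)) →ₗ[k] EndHom A B m n :=
  sandwich (PiTensorProduct.map (fun _ => LinearMap.snd k A.carrier B.carrier))
    (PiTensorProduct.map (fun _ => LinearMap.inl k A.carrier B.carrier))

end Embeddings

/-- The Koszul-signed tensor product on `(A ⊕ B)^{⊗ n}` of maps `A → B` of degrees `q i` at the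
places where `t i` is `some (φ, q i)` and of identities at the other places. -/
def row (A : DGModule.{uk, ua} k) (B : DGModule.{uk, ub} k) {n : ℕ}
    (t : Fin n → Option ((A.carrier →ₗ[k] B.carrier) × ℤ)) :
    (⨂[k] _ : Fin n, A.carrier × B.carrier) →ₗ[k] (⨂[k] _ : Fin n, A.carrier × B.carrier) :=
  PiTensorProduct.map (fun i =>
    (match t i with
      | some x => LinearMap.inr k A.carrier B.carrier ∘ₗ x.1 ∘ₗ LinearMap.fst k A.carrier B.carrier
      | none => LinearMap.id) ∘ₗ
    spow (mixInv A B) (∑ j, if i < j then (match t j with | some x => x.2 | none => 0) else 0))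

/-- Families of linear maps `C → End^A_B`, with `C = I ⊕ C̄`: the image `A → B` of `id ∈ I` and the
restriction to `C̄`. -/
abbrev ConvU (M : DGSBimodule.{uk, uc} k) (A : DGModule.{uk, ua} k) (B : DGModule.{uk, ub} k) :
    Type _ :=
  (A.carrier →ₗ[k] B.carrier) × Conv M A B

/-- The degree `p` part of `Hom_𝕊(C, End^A_B)`, with `C = I ⊕ C̄`. -/
def homSU (M : DGSBimodule.{uk, uc} k) (A : DGModule.{uk, ua} k) (B : DGModule.{uk, ub} k)
    (p : ℤ) : Submodule k (ConvU M A B) where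
  carrier := {f | (∀ q, ∀ x ∈ A.gr q, f.1 x ∈ B.gr (q + p)) ∧ f.2 ∈ homS M A B p}
  zero_mem' := ⟨fun _ _ _ => Submodule.zero_mem _, Submodule.zero_mem _⟩
  add_mem' := fun h h' =>
    ⟨fun q x hx => Submodule.add_mem _ (h.1 q x hx) (h'.1 q x hx), Submodule.add_mem _ h.2 h'.2⟩
  smul_mem' := fun a _ h =>
    ⟨fun q x hx => Submodule.smul_mem _ a (h.1 q x hx), Submodule.smul_mem _ a h.2⟩

/-- The differential of `Hom_𝕊(C, End^A_B)` in degree `p`, with `C = I ⊕ C̄` and `d(id) = 0`. -/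
def convUD (M : DGSBimodule.{uk, uc} k) (A : DGModule.{uk, ua} k) (B : DGModule.{uk, ub} k)
    (p : ℤ) (f : ConvU M A B) : ConvU M A B :=
  (B.d ∘ₗ f.1 - sgn k p • (f.1 ∘ₗ A.d), convD M A B p f.2)

variable (C : ConilpotentDGCoproperad.{uk, uc} k) (A : DGModule.{uk, ua} k)
  (B : DGModule.{uk, ub} k)

/-- The left action `β ◁ f` for `f` of degree `0`: decompose along the two-level graphs with one
bottom vertex, apply `β` at the bottom and `f` at the vertices and identities of the top level, and
compose. It vanishes on `I`. -/
def lhd (β : Conv C.toDGSBimodule B B) (f : ConvU C.toDGSBimodule A B) :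
    ConvU C.toDGSBimodule A B := by
  classical
  exact (0, fun m n => locSum (fun G : UpGraph m n =>
    (G.g.weight k * (G.p.factorial : k)⁻¹) •
      (projAB A B m n ∘ₗ
        sandwich LinearMap.id (row A B (fun x =>
          if ∃ j, G.g.wire (.inl x) = .inr ⟨0, j⟩ then some (f.1, 0) else none)) ∘ₗ
        evalGraph C.toDGSBimodule (mixInv A B) G.g
          (fun v => if v = 0 then embBB A B _ _ ∘ₗ β _ _ else embAB A B _ _ ∘ₗ f.2 _ _)
          (fun _ => 0) 0 ∘ₗ
        C.dec G.g)))

/-- The right action `f ▷ α` for `f` of degree `0` and `α` of degree `e`: decompose along the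
two-level graphs with one top vertex, apply `f` at the vertices and identities of the bottom level
and `α` at the top, and compose. It vanishes on `I`. -/
def rhd (e : ℤ) (f : ConvU C.toDGSBimodule A B) (α : Conv C.toDGSBimodule A A) :
    ConvU C.toDGSBimodule A B := by
  classical
  exact (0, fun m n => locSum (fun G : DownGraph m n =>
    (G.g.weight k * (G.p.factorial : k)⁻¹) •
      (projAB A B m n ∘ₗ
        sandwich (row A B (fun y =>
          if ∃ i, G.g.wire (.inr ⟨Fin.last G.p, i⟩) = .inl y then some (f.1, 0) else none))
          LinearMap.id ∘ₗ
        evalGraph C.toDGSBimodule (mixInv A B) G.g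
          (fun v => if v = Fin.last G.p then embAA A B _ _ ∘ₗ α _ _
            else embAB A B _ _ ∘ₗ f.2 _ _)
          (fun v => if v = Fin.last G.p then e else 0) 0 ∘ₗ
        C.dec G.g)))

/-- `∞`-morphisms `(A, α) ⇝ (B, β)`: equivariant maps `f : C → End^A_B` of degree `0` such that
`∂f = f ▷ α - β ◁ f`. -/
def IsInftyMorphism (α : Conv C.toDGSBimodule A A) (β : Conv C.toDGSBimodule B B)
    (f : ConvU C.toDGSBimodule A B) : Prop :=
  f ∈ homSU C.toDGSBimodule A B 0 ∧
  convUD C.toDGSBimodule A B 0 f = rhd C A B (-1) f α - lhd C A B β f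

/-! ## Convolution shifted homotopy Lie algebras -/

/-- The operation `U_{r+1}(sβ, f_1, …, f_r)` for `β` of degree `e` and `f_i` of degree `q i`. The
maps `f_1, …, f_r` are distributed in all the ways, with Koszul signs, among the `p` top vertices
and the identities of the top level. -/
def opU (e : ℤ) (β : Conv C.toDGSBimodule B B) {r : ℕ} (q : Fin r → ℤ)
    (f : Fin r → ConvU C.toDGSBimodule A B) : Conv C.toDGSBimodule A B := by
  classical
  exact fun m n => locSum (fun G : UpGraph m n =>
    (G.g.weight k * (G.p.factorial : k)⁻¹) •
      ∑ θ : Fin r ≃ (Fin G.p ⊕ G.Direct),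
        koszulSign k (fun i : Fin r => (i : ℕ))
          (Sum.elim (fun t : Fin G.p => (t : ℕ)) (fun x : G.Direct => G.p + (x.1 : ℕ))) θ q •
        (projAB A B m n ∘ₗ
          sandwich LinearMap.id (row A B (fun x =>
            if h : ∃ j, G.g.wire (.inl x) = .inr ⟨0, j⟩ then
              some ((f (θ.symm (.inr ⟨x, h⟩))).1, q (θ.symm (.inr ⟨x, h⟩))) else none)) ∘ₗ
          evalGraph C.toDGSBimodule (mixInv A B) G.g
            (Fin.cases (embBB A B _ _ ∘ₗ β _ _)
              (fun t => embAB A B _ _ ∘ₗ (f (θ.symm (.inl t))).2 _ _))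
            (Fin.cases e (fun t => q (θ.symm (.inl t))))
            (∑ x : G.Direct, q (θ.symm (.inr x))) ∘ₗ
          C.dec G.g))

/-- The operation `D_{r+1}(f_1, …, f_r, sα)` for `α` of degree `e` and `f_i` of degree `q i`. The
maps `f_1, …, f_r` are distributed in all the ways, with Koszul signs, among the identities of the
bottom level and the `p` bottom vertices. -/
def opD {r : ℕ} (q : Fin r → ℤ) (f : Fin r → ConvU C.toDGSBimodule A B) (e : ℤ)
    (α : Conv C.toDGSBimodule A A) : Conv C.toDGSBimodule A B := by
  classical
  exact fun m n => locSum (fun G : DownGraph m n =>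
    (G.g.weight k * (G.p.factorial : k)⁻¹) •
      ∑ θ : Fin r ≃ (G.Direct ⊕ Fin G.p),
        koszulSign k (fun i : Fin r => (i : ℕ))
          (Sum.elim (fun y : G.Direct => (y.1 : ℕ)) (fun t : Fin G.p => m + (t : ℕ))) θ q •
        (projAB A B m n ∘ₗ
          sandwich (row A B (fun y =>
            if h : ∃ i, G.g.wire (.inr ⟨Fin.last G.p, i⟩) = .inl y then
              some ((f (θ.symm (.inl ⟨y, h⟩))).1, q (θ.symm (.inl ⟨y, h⟩))) else none))
            LinearMap.id ∘ₗ
          evalGraph C.toDGSBimodule (mixInv A B) G.g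
            (Fin.lastCases (embAA A B _ _ ∘ₗ α _ _)
              (fun t => embAB A B _ _ ∘ₗ (f (θ.symm (.inr t))).2 _ _))
            (Fin.lastCases e (fun t => q (θ.symm (.inr t)))) 0 ∘ₗ
          C.dec G.g))

/-- The shifted Lie bracket `[sf, sh]` on `s Hom_𝕊(C̄, End_A)`, for `sf` and `sh` of degrees `p` and
`q`: with `|f| = p - 1` and `|h| = q - 1`, it is
`(-1)^|f| s(f ⋆ h) - (-1)^(|f| (|h| + 1)) s(h ⋆ f)`. -/
def bracket (p q : ℤ) (f h : Conv C.toDGSBimodule A A) : Conv C.toDGSBimodule A A :=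
  sgn k (p - 1) • star C A (p - 1) (q - 1) f h -
    sgn k ((p - 1) * q) • star C A (q - 1) (p - 1) h f

end Convolution

/-- The data of a filtered graded vector space with graded operations of all arities: the first
operation is the differential. The operation `op n q x` is meant for elements `x i` of
degree `q i`. -/
structure LInftyData (k : Type uk) [Field k] where
  carrier : Type ua
  [addCommGroup : AddCommGroup carrier]
  [module : Module k carrier]
  gr : ℤ → Submodule k carrier
  fil : ℕ → Submodule k carrier
  op : ∀ n : ℕ, (Fin n → ℤ) → (Fin n → carrier) → carrier

attribute [instance] LInftyData.addCommGroup LInftyData.module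

/-- Maurer-Cartan elements: the elements `x` of degree `0` such that the series
`∑_{n ≥ 1} (1 / n!) op_n(x, …, x)` converges to `0` for the topology of the filtration. -/
def LInftyData.MC {k : Type uk} [Field k] (L : LInftyData.{uk, ua} k) : Set L.carrier :=
  {x | x ∈ L.gr 0 ∧ ∀ r : ℕ, ∃ N₀ : ℕ, ∀ N ≥ N₀,
    ∑ n ∈ Finset.Icc 1 N, (n.factorial : k)⁻¹ • L.op n (fun _ => 0) (fun _ => x) ∈ L.fil r}

section LInfty

variable {k : Type uk} [Field k] (C : ConilpotentDGCoproperad.{uk, uc} k)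
  (A : DGModule.{uk, ua} k) (B : DGModule.{uk, ub} k)

/-- The canonical filtration of `Hom_𝕊(C̄, End_A)`: the families which vanish on the step `r - 1` of
the coradical filtration. -/
def filConv (r : ℕ) : Submodule k (Conv C.toDGSBimodule A A) where
  carrier := {α | ∀ m n, ∀ c ∈ C.coradical (r - 1) m n, α m n c = 0}
  zero_mem' := fun _ _ _ _ => rfl
  add_mem' := fun h h' m n c hc => by
    simp only [Pi.add_apply, LinearMap.add_apply, h m n c hc, h' m n c hc, add_zero]
  smul_mem' := fun a _ h m n c hc => by
    simp only [Pi.smul_apply, LinearMap.smul_apply, h m n c hc, smul_zero]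

/-- The canonical filtration of `Hom_𝕊(C, End^A_B)`: the families which vanish on the step `r - 1`
of the density filtration of `C = I ⊕ C̄`; the steps of positive index contain `id ∈ I`. -/
def filConvU (r : ℕ) : Submodule k (ConvU C.toDGSBimodule A B) where
  carrier := {f | (1 ≤ r - 1 → f.1 = 0) ∧ ∀ m n, ∀ c ∈ C.density (r - 1) m n, f.2 m n c = 0}
  zero_mem' := ⟨fun _ => rfl, fun _ _ _ _ => rfl⟩
  add_mem' := fun h h' => ⟨fun hr => by simp only [Prod.fst_add, h.1 hr, h'.1 hr, add_zero],
    fun m n c hc => by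
      simp only [Prod.snd_add, Pi.add_apply, LinearMap.add_apply, h.2 m n c hc, h'.2 m n c hc,
        add_zero]⟩
  smul_mem' := fun a _ h => ⟨fun hr => by simp only [Prod.smul_fst, h.1 hr, smul_zero],
    fun m n c hc => by
      simp only [Prod.smul_snd, Pi.smul_apply, LinearMap.smul_apply, h.2 m n c hc, smul_zero]⟩

/-- The convolution shifted `L∞`-algebra
`𝔨 = s Hom_𝕊(C̄, End_A) ⊕ Hom_𝕊(C, End^A_B) ⊕ s Hom_𝕊(C̄, End_B)`, whose elements are written
`(α, f, β)` for `(sα, f, sβ)`. The differential is `-∂` and the higher operations are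
`[ , ]_A + [ , ]_B + D_2 - U_2` in arity `2` and `D_n - U_n` in arities `n ≥ 3`, where `D_n` and
`U_n` are extended by (graded) symmetry to all the positions of `sα` and `sβ`. -/
def convLInfty : LInftyData k where
  carrier := Conv C.toDGSBimodule A A × ConvU C.toDGSBimodule A B × Conv C.toDGSBimodule B B
  gr := fun p => (homS C.toDGSBimodule A A (p - 1)).prod
    ((homSU C.toDGSBimodule A B p).prod (homS C.toDGSBimodule B B (p - 1)))
  fil := fun r => (filConv C A r).prod ((filConvU C A B r).prod (filConv C B r))
  op := fun n => match n with
    | 0 => fun _ _ => 0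
    | 1 => fun q x =>
        (-convD C.toDGSBimodule A A (q 0 - 1) (x 0).1,
          -convUD C.toDGSBimodule A B (q 0) (x 0).2.1,
          -convD C.toDGSBimodule B B (q 0 - 1) (x 0).2.2)
    | r + 2 => fun q x =>
        (if r = 0 then bracket C A (q 0) (q 1) (x 0).1 (x 1).1 else 0,
          (0, ∑ j : Fin (r + 2),
            (sgn k (q j * ∑ i, if j < i then q i else 0) •
              opD C A B (fun i => q (j.succAbove i)) (fun i => (x (j.succAbove i)).2.1)
                (q j - 1) (x j).1 -
            sgn k (q j * ∑ i, if i < j then q i else 0) •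
              opU C A B (q j - 1) (x j).2.2
                (fun i => q (j.succAbove i)) (fun i => (x (j.succAbove i)).2.1))),
          if r = 0 then bracket C B (q 0) (q 1) (x 0).2.2 (x 1).2.2 else 0)

/-- The shifted `L∞`-algebra `𝔥_{α,β}` on `Hom_𝕊(C, End^A_B)`, for `ΩC`-gebra structures `α` and `β`
(of degree `-1`): its operations are `D_2(-, sα) - U_2(sβ, -) - ∂` in arity `1` and
`D_{n+1}(-, …, -, sα) - U_{n+1}(sβ, -, …, -)` in arities `n ≥ 2`. -/
def morLInfty (α : Conv C.toDGSBimodule A A) (β : Conv C.toDGSBimodule B B) : LInftyData k where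
  carrier := ConvU C.toDGSBimodule A B
  gr := homSU C.toDGSBimodule A B
  fil := filConvU C A B
  op := fun n => match n with
    | 0 => fun _ _ => 0
    | 1 => fun q f => (0, opD C A B q f (-1) α - opU C A B (-1) β q f) -
        convUD C.toDGSBimodule A B (q 0) (f 0)
    | _ + 2 => fun q f => (0, opD C A B q f (-1) α - opU C A B (-1) β q f)

end LInfty

end

end Gebra

/-!
Each of the two Maurer–Cartan series is computed on an arbitrary element `c` of the coproperad,
where it becomes a finite sum, and its limit is compared with the defining equations of gebras and
of `∞`-morphisms.

*Gebras.* In the components `sα` and `sβ` the series has only two terms, and its sum is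
`-(∂α + α ⋆ α)`. So one has to know that `α` defines a morphism of dg properads
`ΩC → End_A` if and only if `∂α + α ⋆ α = 0` (`isGebra_iff`). On a generator, that is on a corolla,
compatibility with the differentials is this equation. On a general labelled graph both sides are
sums over the vertices, because both differentials are derivations:

* the differential of `End_A` is a derivation for the composition along a graph
  (`Graph.opBoundary_compFun`); this is proved one vertex at a time, each step of the composition
  being conjugate, by Koszul-signed permutations, to an operation acting on the first tensor factors;
* the differential of the cobar construction replaces a vertex by a graph with two vertices.
  Composition along graphs is associative (`Graph.Insertion.compFun_G`), so its image in `End_A` is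
  the composite along the original graph where the value of `α ⋆ α` is placed at this vertex
  (`cobarEval_cobarD_tprod`). An insertion exists and is unique (`Graph.nonempty_insertion` and the
  instance `Unique (g.Insertion v h)`): the flags and legs of the two graphs are glued along the
  flags of the vertex, which is formalized by `Gluing`. The vertices of the inner graph form a
  block of consecutive vertices, so that below and above this block the levels of the two graphs
  correspond to each other.

*`∞`-morphisms.* All the arguments of the operations are equal and have degree `0`, so no sign
occurs. There are `r!` ways to distribute `r` copies of `f` among the places of a saturated level
if it has `r` places, and none otherwise. Therefore `U_{r+1}(sβ, f, …, f) / r!` is the part of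
`β ◁ f` supported by the two-level graphs with `r` places (`opU_const`), and the sum over all
`r ≥ 1` is `β ◁ f`; similarly for `f ▷ α`. The number of places is less than the weight plus the
size of the graph, and this gives the convergence for the density filtration (`sum_opU`,
`sum_opD`). The filtrations are separated since every element of the coproperad is decomposed along
finitely many graphs, hence a series converges to `0` if and only if its limit vanishes.
-/

namespace Gebra

universe uk uc ua ub

/-! ### Multilinear extensionality and parity -/

section Extensionality

variable {k : Type uk} [Field k]

/-- Linear maps on a finite tensor product agree as soon as they agree on the pure tensors whose
factors are taken from spanning sets. -/
theorem piTensor_ext_of_span {ι : Type*} [Finite ι] {M : ι → Type*} [∀ i, AddCommGroup (M i)]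
    [∀ i, Module k (M i)] {W : Type*} [AddCommGroup W] [Module k W] (H : ∀ i, Set (M i))
    (hH : ∀ i, Submodule.span k (H i) = ⊤) {f g : (⨂[k] i, M i) →ₗ[k] W}
    (h : ∀ x : ∀ i, M i, (∀ i, x i ∈ H i) →
      f (PiTensorProduct.tprod k x) = g (PiTensorProduct.tprod k x)) : f = g := by
  classical
  have := Fintype.ofFinite ι
  have key : ∀ s : Finset ι, ∀ x : ∀ i, M i, (∀ i, i ∉ s → x i ∈ H i) →
      f (PiTensorProduct.tprod k x) = g (PiTensorProduct.tprod k x) := by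
    intro s
    induction s using Finset.induction_on with
    | empty => exact fun x hx => h x fun i => hx i (by simp)
    | insert a s ha ih =>
      intro x hx
      have hspan : ∀ y ∈ Submodule.span k (H a),
          f (PiTensorProduct.tprod k (Function.update x a y)) =
            g (PiTensorProduct.tprod k (Function.update x a y)) := by
        intro y hy
        induction hy using Submodule.span_induction with
        | mem y hy =>
          refine ih _ fun i hi => ?_
          by_cases hia : i = a
          · subst hia; simpa using hy
          · rw [Function.update_of_ne hia]
            exact hx i (by simp [hia, hi])
        | zero => simp [MultilinearMap.map_update_zero]
        | add y z _ _ hy hz => simp only [MultilinearMap.map_update_add, map_add, hy, hz]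
        | smul c y _ hy => simp only [MultilinearMap.map_update_smul, map_smul, hy]
      have := hspan (x a) (by rw [hH]; trivial)
      rwa [Function.update_eq_self] at this
  exact PiTensorProduct.ext (MultilinearMap.ext fun x => key Finset.univ x (by simp))

/-- The sign of a parity. -/
def pm (k : Type uk) [Field k] (b : Bool) : k := if b then -1 else 1

theorem pm_mul_self (b : Bool) : pm k b * pm k b = 1 := by cases b <;> simp [pm]

theorem pm_not (b : Bool) : pm k (!b) = -pm k b := by cases b <;> simp [pm]

theorem sgn_parityDeg (a b : Bool) :
    sgn k (parityDeg a * parityDeg b) = pm k (a && b) := by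
  cases a <;> cases b <;> simp [sgn, parityDeg, pm]

variable {X : Type ua} [AddCommGroup X] [Module k X]

/-- The vector `x` is homogeneous of parity `b` for the parity involution `s`. -/
def HasParity (s : X →ₗ[k] X) (b : Bool) (x : X) : Prop := s x = pm k b • x

variable [CharZero k]

theorem parityProj_apply {s : X →ₗ[k] X} {b : Bool} {x : X} (h : HasParity s b x) (c : Bool) :
    parityProj s c x = if c = b then x else 0 := by
  have h2 : (2 : k) ≠ 0 := two_ne_zero
  have key : (2 : k)⁻¹ • (x + x) = x := by
    rw [← two_smul k x, smul_smul, inv_mul_cancel₀ h2, one_smul]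
  unfold HasParity at h
  cases b <;> cases c <;> simp_all [parityProj, pm]

theorem span_hasParity {s : X →ₗ[k] X} (hs : ∀ x, s (s x) = x) :
    Submodule.span k {x | ∃ b, HasParity s b x} = ⊤ := by
  refine eq_top_iff.2 fun x _ => ?_
  have h2 : (2 : k) ≠ 0 := two_ne_zero
  have hx : x = (2 : k)⁻¹ • ((x + s x) + (x - s x)) := by
    rw [add_add_sub_cancel, ← two_smul k x, smul_smul, inv_mul_cancel₀ h2, one_smul]
  rw [hx]
  refine Submodule.smul_mem _ _ (Submodule.add_mem _ (Submodule.subset_span ⟨false, ?_⟩)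
    (Submodule.subset_span ⟨true, ?_⟩))
  · simp [HasParity, pm, hs, add_comm]
  · simp [HasParity, pm, hs]

/-- Linear maps on a tensor power agree as soon as they agree on the pure tensors of
parity-homogeneous vectors. -/
theorem piTensor_ext_of_parity {ι : Type*} [Finite ι] {s : X →ₗ[k] X} (hs : ∀ x, s (s x) = x)
    {W : Type*} [AddCommGroup W] [Module k W] {f g : (⨂[k] _ : ι, X) →ₗ[k] W}
    (h : ∀ (δ : ι → Bool) (x : ι → X), (∀ i, HasParity s (δ i) (x i)) →
      f (PiTensorProduct.tprod k x) = g (PiTensorProduct.tprod k x)) : f = g :=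
  piTensor_ext_of_span (fun _ => {x | ∃ b, HasParity s b x}) (fun _ => span_hasParity hs)
    fun x hx => by
      choose δ hδ using hx
      exact h δ x hδ

end Extensionality

/-! ### Koszul signs -/

section Signs

variable {k : Type uk} [Field k]

/-- The product over unordered pairs of a symmetric function does not depend on the injective
rank function used to enumerate the pairs. -/
theorem prod_pairs_rank {ι : Type*} [Fintype ι] {r t : ι → ℕ} (hr : Function.Injective r)
    (ht : Function.Injective t) (H : ι → ι → k) (hH : ∀ i j, H i j = H j i) :
    ∏ i, ∏ j, (if r i < r j then H i j else 1) = ∏ i, ∏ j, (if t i < t j then H i j else 1) := by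
  have h1 : ∀ i j, (if r i < r j then H i j else 1) =
      (if r i < r j ∧ t i < t j then H i j else 1) *
        (if r i < r j ∧ t j < t i then H j i else 1) := by
    intro i j
    by_cases h : r i < r j
    · have hne : t i ≠ t j := fun e => by rw [ht e] at h; exact lt_irrefl _ h
      rcases lt_or_gt_of_ne hne with h' | h'
      · simp [h, h', h'.not_gt]
      · simp [h, h', h'.not_gt, hH j i]
    · simp [h]
  have h2 : ∀ i j, (if t i < t j then H i j else 1) =
      (if r i < r j ∧ t i < t j then H i j else 1) *
        (if r j < r i ∧ t i < t j then H i j else 1) := by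
    intro i j
    by_cases h : t i < t j
    · have hne : r i ≠ r j := fun e => by rw [hr e] at h; exact lt_irrefl _ h
      rcases lt_or_gt_of_ne hne with h' | h'
      · simp [h, h', h'.not_gt]
      · simp [h, h', h'.not_gt]
    · simp [h]
  simp only [h1, h2, Finset.prod_mul_distrib]
  congr 1
  exact Finset.prod_comm

variable {ι κ μ : Type*} [Fintype ι]

/-- The Koszul sign as a product over the pairs taken in an arbitrary order. -/
theorem koszulSign_eq {r t : ι → ℕ} {r' : κ → ℕ} (hr : Function.Injective r)
    (ht : Function.Injective t) (hr' : Function.Injective r') (e : ι ≃ κ) (deg : ι → ℤ) :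
    koszulSign k r r' e deg = ∏ i, ∏ j, (if t i < t j then
      (if (r i < r j ↔ r' (e i) < r' (e j)) then 1 else sgn k (deg i * deg j)) else 1) := by
  rw [← prod_pairs_rank hr ht]
  · unfold koszulSign
    refine Finset.prod_congr rfl fun i _ => Finset.prod_congr rfl fun j _ => ?_
    by_cases h : r i < r j
    · have hne : r' (e i) ≠ r' (e j) := fun e' => by
        rw [e.injective (hr' e')] at h; exact lt_irrefl _ h
      rcases lt_or_gt_of_ne hne with h' | h' <;> simp [h, h', h'.not_gt]
    · simp [h]
  · intro i j
    by_cases hij : i = j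
    · subst hij; rfl
    · have h1 : r i ≠ r j := fun h => hij (hr h)
      have h2 : r' (e i) ≠ r' (e j) := fun h => hij (e.injective (hr' h))
      have : (r i < r j ↔ r' (e i) < r' (e j)) ↔ (r j < r i ↔ r' (e j) < r' (e i)) := by
        constructor <;> intro h <;> constructor <;> intro h' <;> by_contra h'' <;> omega
      simp only [this, mul_comm (deg i)]

theorem koszulSign_trans [Fintype κ] {r : ι → ℕ} {r' : κ → ℕ} {r'' : μ → ℕ}
    (hr : Function.Injective r)
    (hr' : Function.Injective r') (hr'' : Function.Injective r'') (e : ι ≃ κ) (e' : κ ≃ μ)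
    (deg : ι → ℤ) :
    koszulSign k r r' e deg * koszulSign k r' r'' e' (deg ∘ e.symm) =
      koszulSign k r r'' (e.trans e') deg := by
  have h2 : koszulSign k r' r'' e' (deg ∘ e.symm) = ∏ i, ∏ j, (if r i < r j then
      (if (r' (e i) < r' (e j) ↔ r'' (e' (e i)) < r'' (e' (e j))) then 1
        else sgn k (deg i * deg j)) else 1) := by
    rw [koszulSign_eq (t := r ∘ e.symm) hr' (hr.comp e.symm.injective) hr'',
      ← Equiv.prod_comp e]
    refine Finset.prod_congr rfl fun i _ => ?_
    rw [← Equiv.prod_comp e]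
    refine Finset.prod_congr rfl fun j _ => ?_
    simp
  rw [h2, koszulSign_eq hr hr hr', koszulSign_eq hr hr hr'', ← Finset.prod_mul_distrib]
  refine Finset.prod_congr rfl fun i _ => ?_
  rw [← Finset.prod_mul_distrib]
  refine Finset.prod_congr rfl fun j _ => ?_
  have hsq : sgn k (deg i * deg j) * sgn k (deg i * deg j) = 1 := by
    unfold sgn; split_ifs <;> simp
  by_cases a : r i < r j <;> by_cases b : r' (e i) < r' (e j) <;>
    by_cases c : r'' (e' (e i)) < r'' (e' (e j)) <;> simp [a, b, c, hsq]

theorem koszulSign_congr {r t : ι → ℕ} {r' t' : κ → ℕ} (e : ι ≃ κ) (deg : ι → ℤ)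
    (h : ∀ i j, r i < r j ↔ t i < t j) (h' : ∀ i j, r' i < r' j ↔ t' i < t' j) :
    koszulSign k r r' e deg = koszulSign k t t' e deg := by
  simp only [koszulSign, h, h']

theorem koszulSign_eq_one {r : ι → ℕ} {r' : κ → ℕ} (e : ι ≃ κ) (deg : ι → ℤ)
    (h : ∀ i j, r i < r j → r' (e i) < r' (e j)) : koszulSign k r r' e deg = 1 := by
  unfold koszulSign
  refine Finset.prod_eq_one fun i _ => Finset.prod_eq_one fun j _ => if_neg ?_
  rintro ⟨h1, h2⟩
  exact lt_asymm h2 (h i j h1)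

theorem koszulSign_sum {ι' κ' : Type*} [Fintype ι'] {R : ι ⊕ ι' → ℕ}
    {R' : κ ⊕ κ' → ℕ} (e : ι ≃ κ) (e' : ι' ≃ κ') (deg : ι ⊕ ι' → ℤ)
    (hR : ∀ i j, R (.inl i) < R (.inr j)) (hR' : ∀ i j, R' (.inl i) < R' (.inr j)) :
    koszulSign k R R' (Equiv.sumCongr e e') deg =
      koszulSign k (R ∘ Sum.inl) (R' ∘ Sum.inl) e (deg ∘ Sum.inl) *
        koszulSign k (R ∘ Sum.inr) (R' ∘ Sum.inr) e' (deg ∘ Sum.inr) := by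
  simp [koszulSign, Fintype.prod_sum_type, (hR _ _).not_gt, (hR' _ _).not_gt]
  rfl

end Signs

/-! ### Signed permutations of tensor factors -/

section KoszulPerm

variable {k : Type uk} [Field k] {X : Type ua} [AddCommGroup X] [Module k X] {s : X →ₗ[k] X}

theorem koszulPerm_congr {ι κ : Type} [Fintype ι] {r t : ι → ℕ} {r' t' : κ → ℕ}
    (e : ι ≃ κ)
    (h : ∀ i j, r i < r j ↔ t i < t j) (h' : ∀ i j, r' i < r' j ↔ t' i < t' j) :
    koszulPerm s r r' e = koszulPerm s t t' e := by
  unfold koszulPerm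
  simp only [koszulSign_congr e _ h h']

variable [CharZero k]

theorem koszulPerm_tprod {ι κ : Type} [Fintype ι] (r : ι → ℕ) (r' : κ → ℕ) (e : ι ≃ κ)
    {δ : ι → Bool} {x : ι → X} (hx : ∀ i, HasParity s (δ i) (x i)) :
    koszulPerm s r r' e (PiTensorProduct.tprod k x) =
      koszulSign k r r' e (fun i => parityDeg (δ i)) •
        PiTensorProduct.tprod k (fun j => x (e.symm j)) := by
  classical
  unfold koszulPerm
  rw [LinearMap.sum_apply, Finset.sum_eq_single δ]
  · have h : (fun i => parityProj s (δ i) (x i)) = x :=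
      funext fun i => by rw [parityProj_apply (hx i), if_pos rfl]
    simp only [LinearMap.smul_apply, LinearMap.comp_apply, PiTensorProduct.map_tprod, h,
      LinearEquiv.coe_coe, PiTensorProduct.reindex_tprod]
  · intro δ' _ hne
    obtain ⟨i, hi⟩ := Function.ne_iff.1 hne
    have h : PiTensorProduct.tprod k (fun i => parityProj s (δ' i) (x i)) = 0 :=
      (PiTensorProduct.tprod k).map_coord_zero i (by rw [parityProj_apply (hx i), if_neg hi])
    simp only [LinearMap.smul_apply, LinearMap.comp_apply, PiTensorProduct.map_tprod, h,
      map_zero, smul_zero]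
  · simp

theorem koszulPerm_refl (hs : ∀ x, s (s x) = x) {ι : Type} [Fintype ι] {r r' : ι → ℕ}
    (h : ∀ i j, r i < r j → r' i < r' j) :
    koszulPerm s r r' (Equiv.refl ι) = LinearMap.id :=
  piTensor_ext_of_parity hs fun δ x hx => by
    rw [koszulPerm_tprod _ _ _ hx, koszulSign_eq_one _ _ h]
    simp

theorem koszulPerm_comp (hs : ∀ x, s (s x) = x) {ι κ μ : Type} [Fintype ι] [Fintype κ]
    {r : ι → ℕ} {r' : κ → ℕ} {r'' : μ → ℕ}
    (hr : Function.Injective r)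
    (hr' : Function.Injective r') (hr'' : Function.Injective r'') (e : ι ≃ κ) (e' : κ ≃ μ) :
    koszulPerm s r' r'' e' ∘ₗ koszulPerm s r r' e = koszulPerm s r r'' (e.trans e') :=
  piTensor_ext_of_parity hs fun δ x hx => by
    rw [LinearMap.comp_apply, koszulPerm_tprod _ _ _ hx, map_smul,
      koszulPerm_tprod (δ := fun j => δ (e.symm j)) _ _ _ (fun j => hx (e.symm j)), smul_smul,
      koszulPerm_tprod _ _ _ hx, ← koszulSign_trans hr hr' hr'']
    rfl

/-- Two signed permutations which follow each other block by block. -/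
theorem koszulPerm_sumCongr (hs : ∀ x, s (s x) = x) {ι κ ι' κ' : Type} [Fintype ι]
    [Fintype ι'] {R : ι ⊕ ι' → ℕ} {R' : κ ⊕ κ' → ℕ} (e : ι ≃ κ) (e' : ι' ≃ κ')
    (hR : ∀ i j, R (.inl i) < R (.inr j)) (hR' : ∀ i j, R' (.inl i) < R' (.inr j)) :
    koszulPerm s R R' (Equiv.sumCongr e e') =
      (PiTensorProduct.tmulEquiv k X).toLinearMap ∘ₗ
        TensorProduct.map (koszulPerm s (R ∘ Sum.inl) (R' ∘ Sum.inl) e)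
          (koszulPerm s (R ∘ Sum.inr) (R' ∘ Sum.inr) e') ∘ₗ
        (PiTensorProduct.tmulEquiv k X).symm.toLinearMap :=
  piTensor_ext_of_parity hs fun δ x hx => by
    rw [koszulPerm_tprod _ _ _ hx, koszulSign_sum _ _ _ hR hR']
    simp only [LinearMap.comp_apply, LinearEquiv.coe_coe, PiTensorProduct.tmulEquiv_symm_apply,
      TensorProduct.map_tmul]
    rw [koszulPerm_tprod (δ := fun i => δ (.inl i)) _ _ _ (fun i => hx (.inl i)),
      koszulPerm_tprod (δ := fun i => δ (.inr i)) _ _ _ (fun i => hx (.inr i)),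
      TensorProduct.smul_tmul_smul, map_smul, PiTensorProduct.tmulEquiv_apply]
    congr 1
    congr 1
    ext (i | i) <;> rfl

end KoszulPerm

/-! ### Operations acting on a block of tensor factors -/

section OpStep

variable {k : Type uk} [Field k] {X : Type ua} [AddCommGroup X] [Module k X] (s : X →ₗ[k] X)

/-- The ordering of a first block of `a` factors followed by the factors `T`. -/
def blockRank (a : ℕ) {T : Type} (rT : T → ℕ) : Fin a ⊕ T → ℕ :=
  Sum.elim (fun i => (i : ℕ)) (fun x => a + rT x)

theorem blockRank_injective (a : ℕ) {T : Type} {rT : T → ℕ} (h : Function.Injective rT) :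
    Function.Injective (blockRank a rT) := by
  rintro (i | i) (j | j) hij <;> simp only [blockRank, Sum.elim_inl, Sum.elim_inr] at hij
  · rw [Fin.ext hij]
  · omega
  · omega
  · rw [h (by omega : rT i = rT j)]

theorem blockRank_lt (a : ℕ) {T : Type} (rT : T → ℕ) (i : Fin a) (j : T) :
    blockRank a rT (.inl i) < blockRank a rT (.inr j) := by
  simp only [blockRank, Sum.elim_inl, Sum.elim_inr]
  omega

/-- Apply `φ` to the first block of factors. -/
noncomputable def blockMap {I J : Type} (T : Type) (φ : (⨂[k] _ : I, X) →ₗ[k] (⨂[k] _ : J, X)) :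
    (⨂[k] _ : I ⊕ T, X) →ₗ[k] (⨂[k] _ : J ⊕ T, X) :=
  (PiTensorProduct.tmulEquiv k X).toLinearMap ∘ₗ TensorProduct.map φ LinearMap.id ∘ₗ
    (PiTensorProduct.tmulEquiv k X).symm.toLinearMap

/-- Apply `φ` to the factors of `P` which come from `Fin a`, and leave the factors which come
from `T` unchanged, with the Koszul signs for the orderings `rP` and `rQ` of the source and of the
target. -/
noncomputable def opStep {a b : ℕ} {P Q T : Type} [Fintype P] [Fintype T]
    (rP : P → ℕ) (rT : T → ℕ) (rQ : Q → ℕ) (eP : Fin a ⊕ T ≃ P) (eQ : Fin b ⊕ T ≃ Q)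
    (φ : (⨂[k] _ : Fin a, X) →ₗ[k] (⨂[k] _ : Fin b, X)) :
    (⨂[k] _ : P, X) →ₗ[k] (⨂[k] _ : Q, X) :=
  koszulPerm s (blockRank b rT) rQ eQ ∘ₗ blockMap T φ ∘ₗ koszulPerm s rP (blockRank a rT) eP.symm

theorem Graph.edgeRank_injective {K m n : ℕ} (g : Graph K m n) :
    Function.Injective g.edgeRank := by
  rintro (i | i) (j | j) hij <;> simp only [edgeRank, Sum.elim_inl, Sum.elim_inr] at hij
  · rw [Fin.ext hij]
  · omega
  · omega
  · rw [finSigmaFinEquiv.injective (Fin.ext (Nat.add_left_cancel hij))]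

theorem blockMap_comp {I J L : Type} (T : Type) (φ : (⨂[k] _ : I, X) →ₗ[k] (⨂[k] _ : J, X))
    (ψ : (⨂[k] _ : J, X) →ₗ[k] (⨂[k] _ : L, X)) :
    blockMap T (ψ ∘ₗ φ) = blockMap T ψ ∘ₗ blockMap T φ := by
  refine LinearMap.ext fun x => ?_
  simp only [blockMap, LinearMap.comp_apply, LinearEquiv.coe_coe, LinearEquiv.symm_apply_apply]
  rw [← LinearMap.comp_apply (TensorProduct.map ψ _), ← TensorProduct.map_comp, LinearMap.id_comp]

/-- Applying `φ` to a block of a block. -/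
theorem blockMap_blockMap {I J : Type} (T T' : Type)
    (φ : (⨂[k] _ : I, X) →ₗ[k] (⨂[k] _ : J, X)) :
    (PiTensorProduct.reindex k (fun _ => X) (Equiv.sumAssoc J T T')).toLinearMap ∘ₗ
        blockMap T' (blockMap T φ) =
      blockMap (T ⊕ T') φ ∘ₗ
        (PiTensorProduct.reindex k (fun _ => X) (Equiv.sumAssoc I T T')).toLinearMap := by
  refine PiTensorProduct.ext (MultilinearMap.ext fun x => ?_)
  simp only [LinearMap.compMultilinearMap_apply, LinearMap.comp_apply, LinearEquiv.coe_coe,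
    PiTensorProduct.reindex_tprod, blockMap, PiTensorProduct.tmulEquiv_symm_apply,
    TensorProduct.map_tmul, LinearMap.id_apply]
  have h : ∀ w : ⨂[k] _ : J, X, PiTensorProduct.reindex k (fun _ => X) (Equiv.sumAssoc J T T')
      (PiTensorProduct.tmulEquiv k X
        (PiTensorProduct.tmulEquiv k X (w ⊗ₜ PiTensorProduct.tprod k fun t => x (.inl (.inr t))) ⊗ₜ
          PiTensorProduct.tprod k fun t => x (.inr t))) =
      PiTensorProduct.tmulEquiv k X (w ⊗ₜ PiTensorProduct.tprod k
        fun t => x ((Equiv.sumAssoc I T T').symm (.inr t))) := by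
    intro w
    induction w using PiTensorProduct.induction_on with
    | smul_tprod c y =>
      simp only [← TensorProduct.smul_tmul', map_smul, PiTensorProduct.tmulEquiv_apply,
        PiTensorProduct.reindex_tprod]
      congr 2
      ext (i | i | i) <;> rfl
    | add y z hy hz => simp only [TensorProduct.add_tmul, map_add, hy, hz]
  exact h _

/-- Transport of an operation along equalities of arities. -/
def castOp {a a' b b' : ℕ} (ha : a = a') (hb : b = b')
    (φ : (⨂[k] _ : Fin a, X) →ₗ[k] (⨂[k] _ : Fin b, X)) :
    (⨂[k] _ : Fin a', X) →ₗ[k] (⨂[k] _ : Fin b', X) := by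
  subst ha hb
  exact φ

variable [CharZero k] {s}

theorem koszulPerm_order (hs : ∀ x, s (s x) = x) {ι κ : Type} [Fintype ι] {r : ι → ℕ}
    {r' : κ → ℕ} (e : ι ≃ κ) (h : ∀ i j, r i < r j → r' (e i) < r' (e j)) :
    koszulPerm s r r' e = (PiTensorProduct.reindex k (fun _ => X) e).toLinearMap :=
  piTensor_ext_of_parity hs fun δ x hx => by
    rw [koszulPerm_tprod _ _ _ hx, koszulSign_eq_one _ _ h]
    simp

/-- Permuting the passive factors commutes with applying `φ` to the first block. -/
theorem koszulPerm_blockMap (hs : ∀ x, s (s x) = x) {a b : ℕ} {T T' : Type} [Fintype T]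
    (rT : T → ℕ) (rT' : T' → ℕ)
    (τ : T ≃ T') (φ : (⨂[k] _ : Fin a, X) →ₗ[k] (⨂[k] _ : Fin b, X)) :
    koszulPerm s (blockRank b rT) (blockRank b rT') (Equiv.sumCongr (Equiv.refl _) τ) ∘ₗ
        blockMap T φ =
      blockMap T' φ ∘ₗ
        koszulPerm s (blockRank a rT) (blockRank a rT') (Equiv.sumCongr (Equiv.refl _) τ) := by
  have h : ∀ c : ℕ, koszulPerm s (blockRank c rT) (blockRank c rT')
      (Equiv.sumCongr (Equiv.refl _) τ) =
      (PiTensorProduct.tmulEquiv k X).toLinearMap ∘ₗ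
        TensorProduct.map LinearMap.id (koszulPerm s rT rT' τ) ∘ₗ
        (PiTensorProduct.tmulEquiv k X).symm.toLinearMap := by
    intro c
    rw [koszulPerm_sumCongr hs _ _ (blockRank_lt c rT) (blockRank_lt c rT'),
      koszulPerm_refl hs (r := blockRank c rT ∘ Sum.inl) (r' := blockRank c rT' ∘ Sum.inl)
        (fun i j h => h),
      koszulPerm_congr (t := rT) (t' := rT') τ (by simp [blockRank]) (by simp [blockRank])]
  rw [h, h]
  refine LinearMap.ext fun x => ?_
  simp only [blockMap, LinearMap.comp_apply, LinearEquiv.coe_coe, LinearEquiv.symm_apply_apply]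
  rw [← LinearMap.comp_apply (TensorProduct.map _ _), ← TensorProduct.map_comp,
    ← LinearMap.comp_apply (TensorProduct.map _ _), ← TensorProduct.map_comp]
  simp only [LinearMap.id_comp, LinearMap.comp_id]

/-- Naturality of `opStep` under renamings of the factors. -/
theorem koszulPerm_opStep (hs : ∀ x, s (s x) = x) {a a' b b' : ℕ} (ha : a = a') (hb : b = b')
    {P Q T P' Q' T' : Type}
    [Fintype P] [Fintype Q] [Fintype T] [Fintype P'] [Fintype Q'] [Fintype T']
    {rP : P → ℕ} {rT : T → ℕ} {rQ : Q → ℕ} {rP' : P' → ℕ} {rT' : T' → ℕ} {rQ' : Q' → ℕ}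
    (hrP : Function.Injective rP) (hrT : Function.Injective rT) (hrQ : Function.Injective rQ)
    (hrP' : Function.Injective rP') (hrT' : Function.Injective rT')
    (hrQ' : Function.Injective rQ')
    {eP : Fin a ⊕ T ≃ P} {eQ : Fin b ⊕ T ≃ Q} {eP' : Fin a' ⊕ T' ≃ P'} {eQ' : Fin b' ⊕ T' ≃ Q'}
    (ξ : P ≃ P') (η : Q ≃ Q') (τ : T ≃ T')
    (hPl : ∀ i, ξ (eP (.inl i)) = eP' (.inl (Fin.cast ha i)))
    (hPr : ∀ t, ξ (eP (.inr t)) = eP' (.inr (τ t)))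
    (hQl : ∀ i, η (eQ (.inl i)) = eQ' (.inl (Fin.cast hb i)))
    (hQr : ∀ t, η (eQ (.inr t)) = eQ' (.inr (τ t)))
    (φ : (⨂[k] _ : Fin a, X) →ₗ[k] (⨂[k] _ : Fin b, X)) :
    koszulPerm s rQ rQ' η ∘ₗ opStep s rP rT rQ eP eQ φ =
      opStep s rP' rT' rQ' eP' eQ' (castOp ha hb φ) ∘ₗ koszulPerm s rP rP' ξ := by
  subst ha hb
  have hQ : eQ.trans η = (Equiv.sumCongr (Equiv.refl _) τ).trans eQ' := by
    ext (i | t)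
    · exact hQl i
    · exact hQr t
  have hP : eP.symm.trans (Equiv.sumCongr (Equiv.refl _) τ) = ξ.trans eP'.symm := by
    ext x
    obtain ⟨z, rfl⟩ := eP.surjective x
    rcases z with i | t
    · simpa [Equiv.eq_symm_apply] using (hPl i).symm
    · simpa [Equiv.eq_symm_apply] using (hPr t).symm
  have b1 := fun c : ℕ => blockRank_injective c hrT
  have b2 := fun c : ℕ => blockRank_injective c hrT'
  simp only [opStep, castOp]
  rw [← LinearMap.comp_assoc, koszulPerm_comp hs (b1 _) hrQ hrQ', hQ,
    ← koszulPerm_comp hs (b1 _) (b2 _) hrQ', LinearMap.comp_assoc, LinearMap.comp_assoc,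
    LinearMap.comp_assoc,
    koszulPerm_comp hs hrP hrP' (b2 _), ← hP, ← koszulPerm_comp hs hrP (b1 _) (b2 _),
    ← LinearMap.comp_assoc _ _ (koszulPerm s (blockRank b rT) _ _),
    koszulPerm_blockMap hs rT rT' τ φ]
  rfl

/-- An operation which acts on a block only. -/
theorem opStep_blockMap (hs : ∀ x, s (s x) = x) {a b : ℕ} {P Q T T' : Type}
    [Fintype P] [Fintype Q] [Fintype T] [Fintype T']
    {RP : P ⊕ T' → ℕ} {RQ : Q ⊕ T' → ℕ} {RT : T ⊕ T' → ℕ}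
    (hP : Function.Injective RP) (hQ : Function.Injective RQ) (hT : Function.Injective RT)
    (bP : ∀ i j, RP (.inl i) < RP (.inr j)) (bQ : ∀ i j, RQ (.inl i) < RQ (.inr j))
    (bT : ∀ i j, RT (.inl i) < RT (.inr j))
    (oP : ∀ i j, RP (.inr i) < RP (.inr j) ↔ RT (.inr i) < RT (.inr j))
    (oQ : ∀ i j, RQ (.inr i) < RQ (.inr j) ↔ RT (.inr i) < RT (.inr j))
    (eP : Fin a ⊕ T ≃ P) (eQ : Fin b ⊕ T ≃ Q)
    (φ : (⨂[k] _ : Fin a, X) →ₗ[k] (⨂[k] _ : Fin b, X)) :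
    opStep s RP RT RQ
        ((Equiv.sumAssoc _ _ _).symm.trans (Equiv.sumCongr eP (Equiv.refl T')))
        ((Equiv.sumAssoc _ _ _).symm.trans (Equiv.sumCongr eQ (Equiv.refl T'))) φ =
      blockMap T' (opStep s (RP ∘ Sum.inl) (RT ∘ Sum.inl) (RQ ∘ Sum.inl) eP eQ φ) := by
  -- the common ordering of `(Fin c ⊕ T) ⊕ T'`
  let R3 : ∀ c : ℕ, (Fin c ⊕ T) ⊕ T' → ℕ := fun c => blockRank c RT ∘ Equiv.sumAssoc _ _ _
  have i3 : ∀ c, Function.Injective (R3 c) := fun c =>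
    (blockRank_injective c hT).comp (Equiv.injective _)
  have b3 : ∀ c i j, R3 c (.inl i) < R3 c (.inr j) := by
    rintro c (i | i) j
    · simp only [R3, Function.comp, Equiv.sumAssoc_apply_inl_inl, Equiv.sumAssoc_apply_inr,
        blockRank, Sum.elim_inl, Sum.elim_inr]
      omega
    · simp only [R3, Function.comp, Equiv.sumAssoc_apply_inl_inr, Equiv.sumAssoc_apply_inr,
        blockRank, Sum.elim_inr]
      have := bT i j
      omega
  have iT := fun c => blockRank_injective c hT
  have e3 : ∀ c, R3 c ∘ Sum.inl = blockRank c (RT ∘ Sum.inl) := by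
    intro c
    ext (i | i) <;> rfl
  have hout : koszulPerm s (blockRank b RT) RQ
      ((Equiv.sumAssoc _ _ _).symm.trans (Equiv.sumCongr eQ (Equiv.refl T'))) =
      blockMap T' (koszulPerm s (blockRank b (RT ∘ Sum.inl)) (RQ ∘ Sum.inl) eQ) ∘ₗ
        (PiTensorProduct.reindex k (fun _ => X) (Equiv.sumAssoc (Fin b) T T').symm).toLinearMap :=
      by
    rw [← koszulPerm_comp hs (iT b) (i3 b) hQ,
      koszulPerm_order hs (Equiv.sumAssoc _ _ _).symm (by simp [R3]),
      koszulPerm_sumCongr hs _ _ (b3 b) bQ, koszulPerm_refl hs (by simp [oQ, R3, blockRank]),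
      e3]
    rfl
  have hin : koszulPerm s RP (blockRank a RT)
      ((Equiv.sumAssoc _ _ _).symm.trans (Equiv.sumCongr eP (Equiv.refl T'))).symm =
      (PiTensorProduct.reindex k (fun _ => X) (Equiv.sumAssoc (Fin a) T T')).toLinearMap ∘ₗ
        blockMap T' (koszulPerm s (RP ∘ Sum.inl) (blockRank a (RT ∘ Sum.inl)) eP.symm) := by
    have : ((Equiv.sumAssoc _ _ _).symm.trans (Equiv.sumCongr eP (Equiv.refl T'))).symm =
      (Equiv.sumCongr eP.symm (Equiv.refl T')).trans (Equiv.sumAssoc _ _ _) := rfl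
    rw [this, ← koszulPerm_comp hs hP (i3 a) (iT a),
      koszulPerm_order hs (Equiv.sumAssoc _ _ _) (by simp [R3]),
      koszulPerm_sumCongr hs _ _ bP (b3 a), koszulPerm_refl hs (by simp [oP, R3, blockRank]),
      e3]
    rfl
  have hmid := blockMap_blockMap T T' φ
  simp only [opStep]
  rw [hout, hin, blockMap_comp, blockMap_comp, LinearMap.comp_assoc, ← LinearMap.comp_assoc _ _
    (blockMap (T ⊕ T') φ), ← hmid, LinearMap.comp_assoc]
  congr 1
  refine LinearMap.ext fun x => ?_
  simp only [LinearMap.comp_apply, LinearEquiv.coe_coe]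
  rw [← PiTensorProduct.reindex_symm, LinearEquiv.symm_apply_apply]

end OpStep

/-! ### The derivation rule for composition along a graph -/

section Derivation

variable {k : Type uk} [Field k] {X : Type ua} [AddCommGroup X] [Module k X] (s d : X →ₗ[k] X)

theorem sum_comp_linearMap {ι U V W : Type*} [AddCommGroup U] [Module k U] [AddCommGroup V]
    [Module k V] [AddCommGroup W] [Module k W] (t : Finset ι) (f : ι → V →ₗ[k] W)
    (h : U →ₗ[k] V) : (∑ i ∈ t, f i) ∘ₗ h = ∑ i ∈ t, f i ∘ₗ h :=
  LinearMap.ext fun x => by simp only [LinearMap.comp_apply, LinearMap.sum_apply]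

open Classical in
/-- The differential of a tensor power whose factors are ordered by `r`: the sum over the factors
`i` of `d` applied to `i`, with `s` applied to the factors before `i`. -/
noncomputable def orderedD {ι : Type} [Fintype ι] (r : ι → ℕ) :
    (⨂[k] _ : ι, X) →ₗ[k] (⨂[k] _ : ι, X) :=
  ∑ i, PiTensorProduct.map (fun j => if r j < r i then s else if j = i then d else LinearMap.id)

/-- The diagonal action of `s` on a tensor power. -/
noncomputable abbrev diagMap (ι : Type) : (⨂[k] _ : ι, X) →ₗ[k] (⨂[k] _ : ι, X) :=
  PiTensorProduct.map (fun _ => s)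

/-- The conjugate of an operation by the parity involutions. -/
noncomputable def conjOp {I J : Type} (φ : (⨂[k] _ : I, X) →ₗ[k] (⨂[k] _ : J, X)) :
    (⨂[k] _ : I, X) →ₗ[k] (⨂[k] _ : J, X) :=
  diagMap s J ∘ₗ φ ∘ₗ diagMap s I

/-- The differential of an operation. -/
noncomputable def opBoundary {a b : ℕ} (φ : (⨂[k] _ : Fin a, X) →ₗ[k] (⨂[k] _ : Fin b, X)) :
    (⨂[k] _ : Fin a, X) →ₗ[k] (⨂[k] _ : Fin b, X) :=
  orderedD s d (fun i : Fin b => (i : ℕ)) ∘ₗ φ -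
    conjOp s φ ∘ₗ orderedD s d (fun i : Fin a => (i : ℕ))

variable {s d}

theorem diagMap_diagMap (hs : ∀ x, s (s x) = x) (ι : Type) [Finite ι] :
    diagMap s ι ∘ₗ diagMap s ι = LinearMap.id := by
  rw [← PiTensorProduct.map_comp, ← PiTensorProduct.map_id]
  congr 1
  funext i
  exact LinearMap.ext hs

theorem orderedD_congr {ι : Type} [Fintype ι] {r t : ι → ℕ} (h : ∀ i j, r i < r j ↔ t i < t j) :
    orderedD s d r = orderedD s d t := by
  simp only [orderedD, h]

open Classical in
theorem orderedD_tprod {ι : Type} [Fintype ι] {r : ι → ℕ} {δ : ι → Bool} {x : ι → X}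
    (hx : ∀ i, HasParity s (δ i) (x i)) :
    orderedD s d r (PiTensorProduct.tprod k x) =
      ∑ i, (∏ j, if r j < r i then pm k (δ j) else 1) •
        PiTensorProduct.tprod k (Function.update x i (d (x i))) := by
  rw [orderedD, LinearMap.sum_apply]
  refine Finset.sum_congr rfl fun i _ => ?_
  rw [PiTensorProduct.map_tprod, ← MultilinearMap.map_smul_univ]
  congr 1
  funext j
  by_cases h : r j < r i
  · have hne : j ≠ i := by rintro rfl; exact lt_irrefl _ h
    simp only [h, if_true, Function.update_of_ne hne]
    exact hx j
  · by_cases hij : j = i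
    · subst hij; simp
    · simp [h, hij]

open Classical in
/-- The effect on a Koszul sign of changing the parity of one factor. -/
theorem koszulSign_update {ι κ : Type} [Fintype ι] {r : ι → ℕ} {r' : κ → ℕ}
    (hr : Function.Injective r) (hr' : Function.Injective r') (e : ι ≃ κ) (δ : ι → Bool) (i : ι) :
    koszulSign k r r' e (fun j => parityDeg (Function.update δ i (!δ i) j)) =
      koszulSign k r r' e (fun j => parityDeg (δ j)) *
        ∏ j, (if (r i < r j ↔ r' (e i) < r' (e j)) then 1 else pm k (δ j)) := by
  let t : ι → ℕ := fun j => if j = i then 0 else r j + 1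
  have ht : Function.Injective t := by
    intro a b hab
    by_cases ha : a = i <;> by_cases hb : b = i <;> simp [t, ha, hb] at hab ⊢
    exact hr hab
  have hti : ∀ j, ¬ t j < t i := fun j => by simp [t]
  have hti' : ∀ j, j ≠ i → t i < t j := fun j hj => by simp [t, hj]
  rw [koszulSign_eq hr ht hr', koszulSign_eq hr ht hr',
    ← Finset.mul_prod_erase _ _ (Finset.mem_univ i),
    ← Finset.mul_prod_erase (f := fun a => ∏ b, if t a < t b then
      (if (r a < r b ↔ r' (e a) < r' (e b)) then 1
        else sgn k (parityDeg (δ a) * parityDeg (δ b))) else 1) _ (Finset.mem_univ i),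
    mul_right_comm, ← Finset.prod_mul_distrib]
  congr 1
  · refine Finset.prod_congr rfl fun j _ => ?_
    by_cases hj : j = i
    · subst hj; simp
    · simp only [hti' j hj, if_true, Function.update_self, Function.update_of_ne hj, sgn_parityDeg]
      split_ifs
      · simp
      · cases δ i <;> cases δ j <;> simp [pm]
  · refine Finset.prod_congr rfl fun a ha => Finset.prod_congr rfl fun b _ => ?_
    have ha' : a ≠ i := Finset.ne_of_mem_erase ha
    by_cases hb : b = i
    · subst hb; simp [hti]
    · simp only [Function.update_of_ne ha', Function.update_of_ne hb]

variable [CharZero k]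

theorem koszulPerm_diagMap (hs : ∀ x, s (s x) = x) {ι κ : Type} [Fintype ι] (r : ι → ℕ)
    (r' : κ → ℕ) (e : ι ≃ κ) :
    koszulPerm s r r' e ∘ₗ diagMap s ι = diagMap s κ ∘ₗ koszulPerm s r r' e :=
  piTensor_ext_of_parity hs fun δ x hx => by
    rw [LinearMap.comp_apply, LinearMap.comp_apply, koszulPerm_tprod _ _ _ hx, map_smul,
      PiTensorProduct.map_tprod, PiTensorProduct.map_tprod,
      koszulPerm_tprod (δ := δ) _ _ _ fun i => ?_]
    unfold HasParity at hx ⊢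
    rw [hx i, map_smul, hx i]

/-- The differential of a tensor power is compatible with signed permutations. -/
theorem koszulPerm_orderedD (hs : ∀ x, s (s x) = x) (hd : ∀ x, s (d x) = -d (s x)) {ι κ : Type}
    [Fintype ι] [Fintype κ] {r : ι → ℕ} {r' : κ → ℕ} (hr : Function.Injective r)
    (hr' : Function.Injective r') (e : ι ≃ κ) :
    koszulPerm s r r' e ∘ₗ orderedD s d r = orderedD s d r' ∘ₗ koszulPerm s r r' e := by
  classical
  refine piTensor_ext_of_parity hs fun δ x hx => ?_
  rw [LinearMap.comp_apply, LinearMap.comp_apply, koszulPerm_tprod _ _ _ hx, map_smul,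
    orderedD_tprod hx, orderedD_tprod (δ := fun j => δ (e.symm j)) fun j => hx (e.symm j),
    map_sum, Finset.smul_sum, ← Equiv.sum_comp e]
  refine Finset.sum_congr rfl fun i _ => ?_
  have hx' : ∀ j, HasParity s (Function.update δ i (!δ i) j)
      (Function.update x i (d (x i)) j) := by
    intro j
    by_cases hj : j = i
    · subst hj
      have := hx j
      unfold HasParity at this ⊢
      rw [Function.update_self, Function.update_self, hd, this, map_smul, pm_not, neg_smul]
    · rw [Function.update_of_ne hj, Function.update_of_ne hj]
      exact hx j
  rw [map_smul, koszulPerm_tprod _ _ _ hx', smul_smul, smul_smul, koszulSign_update hr hr',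
    mul_left_comm, ← Finset.prod_mul_distrib]
  congr 1
  · congr 1
    rw [← Equiv.prod_comp e (fun j => if r' j < r' (e i) then pm k (δ (e.symm j)) else 1)]
    refine Finset.prod_congr rfl fun j _ => ?_
    rw [Equiv.symm_apply_apply]
    by_cases hij : j = i
    · subst hij; simp
    · have h1 : r i ≠ r j := fun h => hij (hr h).symm
      have h2 : r' (e i) ≠ r' (e j) := fun h => hij (e.injective (hr' h)).symm
      have hp := pm_mul_self (k := k) (δ j)
      rcases lt_or_gt_of_ne h1 with a | a <;> rcases lt_or_gt_of_ne h2 with b | b <;>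
        simp [a, b, a.not_gt, b.not_gt, hp]
  · congr 1
    funext j
    obtain ⟨j, rfl⟩ := e.surjective j
    by_cases hij : j = i
    · subst hij; simp
    · have : e j ≠ e i := fun h => hij (e.injective h)
      simp [Function.update_of_ne hij, Function.update_of_ne this]

omit [CharZero k] in
/-- The differential on a tensor power made of two successive blocks. -/
theorem orderedD_sum {ι κ : Type} [Fintype ι] [Fintype κ] {R : ι ⊕ κ → ℕ}
    (hR : ∀ i j, R (.inl i) < R (.inr j)) :
    orderedD s d R = (PiTensorProduct.tmulEquiv k X).toLinearMap ∘ₗ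
      (TensorProduct.map (orderedD s d (R ∘ Sum.inl)) LinearMap.id +
        TensorProduct.map (diagMap s ι) (orderedD s d (R ∘ Sum.inr))) ∘ₗ
      (PiTensorProduct.tmulEquiv k X).symm.toLinearMap := by
  classical
  refine PiTensorProduct.ext (MultilinearMap.ext fun x => ?_)
  simp only [LinearMap.compMultilinearMap_apply, LinearMap.comp_apply, LinearEquiv.coe_coe,
    PiTensorProduct.tmulEquiv_symm_apply, LinearMap.add_apply, TensorProduct.map_tmul,
    LinearMap.id_apply, orderedD, LinearMap.sum_apply, PiTensorProduct.map_tprod,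
    Fintype.sum_sum_type, map_add, TensorProduct.sum_tmul, TensorProduct.tmul_sum, map_sum,
    PiTensorProduct.tmulEquiv_apply]
  congr 1
  · refine Finset.sum_congr rfl fun i _ => ?_
    congr 1
    funext j
    rcases j with j | j
    · simp
    · simp [(hR i j).not_gt]
  · refine Finset.sum_congr rfl fun i _ => ?_
    congr 1
    funext j
    rcases j with j | j
    · simp [hR j i]
    · simp

omit [CharZero k] in
theorem conjOp_blockMap (hs : ∀ x, s (s x) = x) {I J T : Type} [Finite T]
    (φ : (⨂[k] _ : I, X) →ₗ[k] (⨂[k] _ : J, X)) :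
    conjOp s (blockMap T φ) = blockMap T (conjOp s φ) := by
  have h : ∀ I : Type, diagMap s (I ⊕ T) = (PiTensorProduct.tmulEquiv k X).toLinearMap ∘ₗ
      TensorProduct.map (diagMap s I) (diagMap s T) ∘ₗ
      (PiTensorProduct.tmulEquiv k X).symm.toLinearMap := by
    intro I
    refine PiTensorProduct.ext (MultilinearMap.ext fun x => ?_)
    simp only [LinearMap.compMultilinearMap_apply, LinearMap.comp_apply, LinearEquiv.coe_coe,
      PiTensorProduct.tmulEquiv_symm_apply, TensorProduct.map_tmul,
      PiTensorProduct.map_tprod, PiTensorProduct.tmulEquiv_apply]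
    congr 1
    ext (i | i) <;> rfl
  rw [conjOp, h, h]
  refine LinearMap.ext fun x => ?_
  simp only [blockMap, LinearMap.comp_apply, LinearEquiv.coe_coe, LinearEquiv.symm_apply_apply]
  rw [← LinearMap.comp_apply (TensorProduct.map _ _), ← TensorProduct.map_comp,
    ← LinearMap.comp_apply (TensorProduct.map _ _), ← TensorProduct.map_comp,
    LinearMap.comp_id, diagMap_diagMap hs, conjOp, LinearMap.comp_assoc]

omit [CharZero k] in
theorem orderedD_blockMap {a b : ℕ} {T : Type} [Fintype T] (rT : T → ℕ) (hs : ∀ x, s (s x) = x)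
    (φ : (⨂[k] _ : Fin a, X) →ₗ[k] (⨂[k] _ : Fin b, X)) :
    orderedD s d (blockRank b rT) ∘ₗ blockMap T φ =
      blockMap T (conjOp s φ) ∘ₗ orderedD s d (blockRank a rT) + blockMap T (opBoundary s d φ) := by
  rw [orderedD_sum (blockRank_lt b rT), orderedD_sum (blockRank_lt a rT),
    orderedD_congr (r := blockRank b rT ∘ Sum.inr) (t := rT) (by simp [blockRank]),
    orderedD_congr (r := blockRank a rT ∘ Sum.inr) (t := rT) (by simp [blockRank])]
  refine LinearMap.ext fun x => ?_
  simp only [blockMap, LinearMap.comp_apply, LinearMap.add_apply, LinearEquiv.coe_coe,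
    LinearEquiv.symm_apply_apply]
  rw [← map_add]
  congr 1
  have hc : conjOp s φ ∘ₗ diagMap s (Fin a) = diagMap s (Fin b) ∘ₗ φ := by
    rw [conjOp, LinearMap.comp_assoc, LinearMap.comp_assoc, diagMap_diagMap hs,
      LinearMap.comp_id]
  simp only [← LinearMap.comp_apply, ← TensorProduct.map_comp, ← LinearMap.add_apply,
    LinearMap.comp_add, LinearMap.id_comp, LinearMap.comp_id]
  rw [hc]
  congr 1
  rw [add_right_comm, ← TensorProduct.map_add_left]
  congr 2
  rw [opBoundary, add_comm]
  exact (sub_add_cancel (orderedD s d (fun i : Fin b => (i : ℕ)) ∘ₗ φ)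
    (conjOp s φ ∘ₗ orderedD s d (fun i : Fin a => (i : ℕ)))).symm

variable (hs : ∀ x, s (s x) = x)
include hs

theorem conjOp_opStep {a b : ℕ} {P Q T : Type} [Fintype P] [Fintype T]
    (rP : P → ℕ) (rT : T → ℕ) (rQ : Q → ℕ) (eP : Fin a ⊕ T ≃ P) (eQ : Fin b ⊕ T ≃ Q)
    (φ : (⨂[k] _ : Fin a, X) →ₗ[k] (⨂[k] _ : Fin b, X)) :
    conjOp s (opStep s rP rT rQ eP eQ φ) = opStep s rP rT rQ eP eQ (conjOp s φ) := by
  have h1 := koszulPerm_diagMap hs (blockRank b rT) rQ eQ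
  have h2 := koszulPerm_diagMap hs rP (blockRank a rT) eP.symm
  rw [opStep, opStep, ← conjOp_blockMap hs, conjOp, conjOp, LinearMap.comp_assoc,
    LinearMap.comp_assoc, h2, ← LinearMap.comp_assoc, ← h1]
  simp only [LinearMap.comp_assoc]

theorem orderedD_opStep (hd : ∀ x, s (d x) = -d (s x)) {a b : ℕ} {P Q T : Type} [Fintype P]
    [Fintype Q] [Fintype T] {rP : P → ℕ} {rT : T → ℕ} {rQ : Q → ℕ} (hP : Function.Injective rP)
    (hT : Function.Injective rT) (hQ : Function.Injective rQ)
    (eP : Fin a ⊕ T ≃ P) (eQ : Fin b ⊕ T ≃ Q)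
    (φ : (⨂[k] _ : Fin a, X) →ₗ[k] (⨂[k] _ : Fin b, X)) :
    orderedD s d rQ ∘ₗ opStep s rP rT rQ eP eQ φ =
      opStep s rP rT rQ eP eQ (conjOp s φ) ∘ₗ orderedD s d rP +
        opStep s rP rT rQ eP eQ (opBoundary s d φ) := by
  have h1 := koszulPerm_orderedD hs hd (blockRank_injective b hT) hQ eQ
  have h2 := koszulPerm_orderedD hs hd hP (blockRank_injective a hT) eP.symm
  simp only [opStep]
  rw [← LinearMap.comp_assoc, ← h1, LinearMap.comp_assoc, ← LinearMap.comp_assoc _ _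
    (orderedD s d (blockRank b rT)), orderedD_blockMap rT hs, LinearMap.add_comp,
    LinearMap.comp_add, LinearMap.comp_assoc _ (orderedD s d _), ← h2]
  simp only [LinearMap.comp_assoc]

end Derivation

namespace Graph

variable {k : Type uk} [Field k] [CharZero k] {X : Type ua} [AddCommGroup X] [Module k X]
  {s d : X →ₗ[k] X} {K m n : ℕ} (g : Graph K m n)

/-- The numbering of the edges crossing a level. -/
def cutRank (j : ℕ) (x : g.Cut j) : ℕ := g.edgeRank x.1

/-- The numbering of the edges passing by a vertex. -/
def throughRank (v : Fin K) (x : g.Through v) : ℕ := g.edgeRank x.1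

theorem cutRank_injective (j : ℕ) : Function.Injective (g.cutRank j) :=
  fun _ _ h => Subtype.ext (g.edgeRank_injective h)

theorem throughRank_injective (v : Fin K) : Function.Injective (g.throughRank v) :=
  fun _ _ h => Subtype.ext (g.edgeRank_injective h)

/-- The edges just above a vertex, as the edges entering it and the edges passing by. -/
noncomputable def inEquiv (v : Fin K) : Fin (g.inn v) ⊕ g.Through v ≃ g.Cut (v + 1) :=
  Equiv.ofBijective _ (g.inMap_bijective v)

/-- The edges just below a vertex, as the edges leaving it and the edges passing by. -/
noncomputable def outEquiv (v : Fin K) : Fin (g.out v) ⊕ g.Through v ≃ g.Cut v :=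
  Equiv.ofBijective _ (g.outMap_bijective v)

/-- The input legs are the edges at the top. -/
noncomputable def topEquiv : Fin n ≃ g.Cut K := Equiv.ofBijective _ g.topMap_bijective

/-- The output legs are the edges at the bottom. -/
noncomputable def botEquiv : Fin m ≃ g.Cut 0 := Equiv.ofBijective _ g.botMap_bijective

section

omit [CharZero k]

theorem step_eq_opStep (v : Fin K)
    (φ : (⨂[k] _ : Fin (g.inn v), X) →ₗ[k] (⨂[k] _ : Fin (g.out v), X)) :
    g.step s v φ = opStep s (g.cutRank (v + 1)) (g.throughRank v) (g.cutRank v)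
      (g.inEquiv v) (g.outEquiv v) φ :=
  rfl

theorem compFun_eq (φ : ∀ v, (⨂[k] _ : Fin (g.inn v), X) →ₗ[k] (⨂[k] _ : Fin (g.out v), X)) :
    g.compFun s φ = koszulPerm s (g.cutRank 0) (fun i : Fin m => (i : ℕ)) g.botEquiv.symm ∘ₗ
      g.compBelow s φ K le_rfl ∘ₗ
      koszulPerm s (fun i : Fin n => (i : ℕ)) (g.cutRank K) g.topEquiv :=
  rfl

end

theorem orderedD_step (hs : ∀ x, s (s x) = x) (hd : ∀ x, s (d x) = -d (s x)) (v : Fin K)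
    (φ : (⨂[k] _ : Fin (g.inn v), X) →ₗ[k] (⨂[k] _ : Fin (g.out v), X)) :
    orderedD s d (g.cutRank v) ∘ₗ g.step s v φ =
      g.step s v (conjOp s φ) ∘ₗ orderedD s d (g.cutRank (v + 1)) + g.step s v (opBoundary s d φ) :=
  orderedD_opStep hs hd (g.cutRank_injective _) (g.throughRank_injective _)
    (g.cutRank_injective _) _ _ _

theorem conjOp_step (hs : ∀ x, s (s x) = x) (v : Fin K)
    (φ : (⨂[k] _ : Fin (g.inn v), X) →ₗ[k] (⨂[k] _ : Fin (g.out v), X)) :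
    conjOp s (g.step s v φ) = g.step s v (conjOp s φ) :=
  conjOp_opStep hs _ _ _ _ _ _

/-- The derivation rule: the differential goes down through the vertices of the graph. -/
theorem orderedD_compBelow (hs : ∀ x, s (s x) = x) (hd : ∀ x, s (d x) = -d (s x))
    (φ : ∀ v, (⨂[k] _ : Fin (g.inn v), X) →ₗ[k] (⨂[k] _ : Fin (g.out v), X)) (j : ℕ)
    (hj : j ≤ K) :
    orderedD s d (g.cutRank 0) ∘ₗ g.compBelow s φ j hj =
      g.compBelow s (fun v => conjOp s (φ v)) j hj ∘ₗ
          orderedD s d (g.cutRank j) +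
        ∑ v : Fin K, if (v : ℕ) < j then g.compBelow s (fun u => if u < v then conjOp s (φ u)
          else if u = v then opBoundary s d (φ u) else φ u) j hj else 0 := by
  induction j with
  | zero => simp [compBelow]
  | succ j ih =>
    have hstep := g.orderedD_step hs hd ⟨j, hj⟩ (φ ⟨j, hj⟩)
    simp only [compBelow]
    rw [← LinearMap.comp_assoc, ih (Nat.le_of_succ_le hj), LinearMap.add_comp,
      LinearMap.comp_assoc, hstep, LinearMap.comp_add, ← LinearMap.comp_assoc, add_assoc]
    congr 1
    rw [← Finset.add_sum_erase _ _ (Finset.mem_univ (⟨j, hj⟩ : Fin K)),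
      ← Finset.add_sum_erase (a := (⟨j, hj⟩ : Fin K)) Finset.univ _ (Finset.mem_univ _),
      LinearMap.add_comp]
    simp only [lt_irrefl, if_false, if_true, LinearMap.zero_comp, zero_add, Nat.lt_succ_self]
    congr 1
    · congr 1
      refine g.compBelow_congr _ _ _ _ _ fun v hv => ?_
      rw [if_pos (show v < ⟨j, hj⟩ from hv)]
    · rw [sum_comp_linearMap]
      refine Finset.sum_congr rfl fun v hv => ?_
      have hne : (v : ℕ) ≠ j := fun h => Finset.ne_of_mem_erase hv (Fin.ext h)
      by_cases h : (v : ℕ) < j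
      · rw [if_pos h, if_pos (Nat.lt_succ_of_lt h),
          if_neg (show ¬ (⟨j, hj⟩ : Fin K) < v from not_lt.2 h.le),
          if_neg (fun e => hne (congrArg Fin.val e.symm))]
      · rw [if_neg h, if_neg (by omega), LinearMap.zero_comp]

/-- The composition along a graph is a derivation for the differential of operations. -/
theorem opBoundary_compFun (hs : ∀ x, s (s x) = x) (hd : ∀ x, s (d x) = -d (s x))
    (φ : ∀ v, (⨂[k] _ : Fin (g.inn v), X) →ₗ[k] (⨂[k] _ : Fin (g.out v), X)) :
    opBoundary s d (g.compFun s φ) =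
      ∑ v : Fin K, g.compFun s (fun u => if u < v then conjOp s (φ u)
          else if u = v then opBoundary s d (φ u) else φ u) := by
  have hconj : ∀ (j : ℕ) (hj : j ≤ K), conjOp s (g.compBelow s φ j hj) =
      g.compBelow s (fun v => conjOp s (φ v)) j hj := by
    intro j
    induction j with
    | zero =>
      intro hj
      simp only [compBelow, conjOp]
      rw [LinearMap.id_comp]
      exact diagMap_diagMap hs _
    | succ j ih =>
      intro hj
      have hst : conjOp s (g.step s ⟨j, hj⟩ (φ ⟨j, hj⟩)) =
          g.step s ⟨j, hj⟩ (conjOp s (φ ⟨j, hj⟩)) := g.conjOp_step hs _ _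
      rw [compBelow, compBelow, ← ih, ← hst]
      refine LinearMap.ext fun x => ?_
      have := LinearMap.ext_iff.1 (diagMap_diagMap hs (g.Cut j))
      simp only [LinearMap.comp_apply, LinearMap.id_apply] at this
      simp only [conjOp, LinearMap.comp_apply, this]
  set kb := koszulPerm s (g.cutRank 0) (fun i : Fin m => (i : ℕ))
    g.botEquiv.symm with hkb
  set kt := koszulPerm s (fun i : Fin n => (i : ℕ)) (g.cutRank K)
      g.topEquiv with hkt
  have h1 := koszulPerm_orderedD hs hd (g.cutRank_injective 0) (Fin.val_injective (n := m))
    g.botEquiv.symm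
  have h2 := koszulPerm_orderedD hs hd (Fin.val_injective (n := n)) (g.cutRank_injective K)
    g.topEquiv
  have h3 := koszulPerm_diagMap hs (g.cutRank 0) (fun i : Fin m => (i : ℕ))
    g.botEquiv.symm
  have h4 := koszulPerm_diagMap hs (fun i : Fin n => (i : ℕ)) (g.cutRank K)
      g.topEquiv
  rw [← hkb] at h1 h3
  rw [← hkt] at h2 h4
  have hc : conjOp s (g.compFun s φ) = g.compFun s (fun v => conjOp s (φ v)) := by
    rw [compFun_eq, compFun_eq]
    rw [← hkb, ← hkt, ← hconj, conjOp, conjOp, LinearMap.comp_assoc, LinearMap.comp_assoc, h4,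
      ← LinearMap.comp_assoc, ← h3]
    simp only [LinearMap.comp_assoc]
  rw [opBoundary, hc]
  simp only [compFun_eq]
  rw [← hkb, ← hkt, ← LinearMap.comp_assoc, ← h1, LinearMap.comp_assoc,
    ← LinearMap.comp_assoc kt, g.orderedD_compBelow hs hd, LinearMap.add_comp,
    LinearMap.comp_add, LinearMap.comp_assoc kt, ← h2]
  simp only [LinearMap.comp_assoc]
  rw [add_sub_cancel_left]
  refine LinearMap.ext fun x => ?_
  simp only [LinearMap.comp_apply, LinearMap.sum_apply, map_sum, Fin.is_lt, if_true]

end Graph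

/-! ### Gluing of wirings -/

/-- Two wirings `a` and `b` such that the targets `I` of `a` are sources of `b` and the targets
`O` of `b` are sources of `a`, without any composable path which goes back from `O` to `I` or from
`I` to `O`. -/
structure Gluing (S O T I P Q : Type) where
  a : S ⊕ O ≃ T ⊕ I
  b : I ⊕ P ≃ O ⊕ Q
  ha : ∀ o i, a (.inr o) ≠ .inr i
  hb : ∀ i o, b (.inl i) ≠ .inl o

namespace Gluing

variable {S O T I P Q : Type} (γ : Gluing S O T I P Q)

theorem exists_b_symm (o : O) : ∃ p, γ.b (.inr p) = .inl o := by
  obtain ⟨x, hx⟩ := γ.b.surjective (.inl o)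
  rcases x with i | p
  · exact absurd hx (γ.hb i o)
  · exact ⟨p, hx⟩

theorem exists_a_symm (i : I) : ∃ x, γ.a (.inl x) = .inr i := by
  obtain ⟨x, hx⟩ := γ.a.surjective (.inr i)
  rcases x with x | o
  · exact ⟨x, hx⟩
  · exact absurd hx (γ.ha o i)

theorem exists_b (i : I) : ∃ q, γ.b (.inl i) = .inr q := by
  rcases h : γ.b (.inl i) with o | q
  · exact absurd h (γ.hb i o)
  · exact ⟨q, rfl⟩

theorem exists_a (o : O) : ∃ t, γ.a (.inr o) = .inl t := by
  rcases h : γ.a (.inr o) with t | i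
  · exact ⟨t, rfl⟩
  · exact absurd h (γ.ha o i)

/-- The source in the glued wiring of the path through a source of `a`. -/
noncomputable def inlA : S ⊕ O → S ⊕ P
  | .inl x => .inl x
  | .inr o => .inr (γ.exists_b_symm o).choose

/-- The source in the glued wiring of the path through a source of `b`. -/
noncomputable def inlB : I ⊕ P → S ⊕ P
  | .inl i => .inl (γ.exists_a_symm i).choose
  | .inr p => .inr p

theorem inlA_inr {o : O} {p : P} (h : γ.b (.inr p) = .inl o) : γ.inlA (.inr o) = .inr p := by
  have := (γ.exists_b_symm o).choose_spec
  exact congrArg Sum.inr (Sum.inr_injective (γ.b.injective (this.trans h.symm)))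

theorem inlB_inl {i : I} {x : S} (h : γ.a (.inl x) = .inr i) : γ.inlB (.inl i) = .inl x := by
  have := (γ.exists_a_symm i).choose_spec
  exact congrArg Sum.inl (Sum.inl_injective (γ.a.injective (this.trans h.symm)))

theorem inlA_eq_inlB {e : S ⊕ O} {i : I} (h : γ.a e = .inr i) :
    γ.inlA e = γ.inlB (.inl i) := by
  rcases e with x | o
  · exact (γ.inlB_inl h).symm
  · exact absurd h (γ.ha o i)

theorem inlB_eq_inlA {e : I ⊕ P} {o : O} (h : γ.b e = .inl o) :
    γ.inlB e = γ.inlA (.inr o) := by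
  rcases e with i | p
  · exact absurd h (γ.hb i o)
  · exact (γ.inlA_inr h).symm

theorem inlA_injective : Function.Injective γ.inlA := by
  rintro (x | o) (y | o') h
  · exact congrArg Sum.inl (Sum.inl_injective h)
  · simp [inlA] at h
  · simp [inlA] at h
  · obtain ⟨p, hp⟩ := γ.exists_b_symm o
    obtain ⟨p', hp'⟩ := γ.exists_b_symm o'
    rw [γ.inlA_inr hp, γ.inlA_inr hp'] at h
    rw [← Sum.inr_injective h, hp] at hp'
    exact congrArg Sum.inr (Sum.inl_injective hp')

theorem inlB_injective : Function.Injective γ.inlB := by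
  rintro (i | p) (i' | p') h
  · obtain ⟨x, hx⟩ := γ.exists_a_symm i
    obtain ⟨x', hx'⟩ := γ.exists_a_symm i'
    rw [γ.inlB_inl hx, γ.inlB_inl hx'] at h
    rw [← Sum.inl_injective h, hx] at hx'
    exact congrArg Sum.inl (Sum.inr_injective hx')
  · simp [inlB] at h
  · simp [inlB] at h
  · exact congrArg Sum.inr (Sum.inr_injective h)

/-- The map `c` is the gluing of `a` and `b`: it sends the source of each path to its end. The last
segment of the path lies in `a` if the path ends in `T`, and in `b` if it ends in `Q`. -/
def IsGlued (c : S ⊕ P → T ⊕ Q) : Prop :=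
  (∀ e t, γ.a e = .inl t → c (γ.inlA e) = .inl t) ∧
    ∀ e q, γ.b e = .inr q → c (γ.inlB e) = .inr q

/-- Every path of the glued wiring either ends like a path of `a` or is inside `b`. -/
theorem cases_source (x : S ⊕ P) : (∃ e t, γ.a e = .inl t ∧ x = γ.inlA e) ∨
    ∃ e q, γ.b e = .inr q ∧ x = γ.inlB e := by
  rcases x with x | p
  · rcases h : γ.a (.inl x) with t | i
    · exact .inl ⟨_, t, h, rfl⟩
    · obtain ⟨q, hq⟩ := γ.exists_b i
      exact .inr ⟨_, q, hq, (γ.inlB_inl h).symm⟩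
  · rcases h : γ.b (.inr p) with o | q
    · obtain ⟨t, ht⟩ := γ.exists_a o
      exact .inl ⟨_, t, ht, (γ.inlA_inr h).symm⟩
    · exact .inr ⟨_, q, h, rfl⟩

variable {γ} in
theorem IsGlued.unique {c c' : S ⊕ P → T ⊕ Q} (h : γ.IsGlued c) (h' : γ.IsGlued c') : c = c' := by
  funext x
  rcases γ.cases_source x with ⟨e, t, ht, rfl⟩ | ⟨e, q, hq, rfl⟩
  · rw [h.1 e t ht, h'.1 e t ht]
  · rw [h.2 e q hq, h'.2 e q hq]

/-- The gluing is a bijection: an end determines the last segment, since `a` and `b` are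
bijections, and the last segment determines the source of the path. -/
theorem exists_glued : ∃ c : S ⊕ P ≃ T ⊕ Q, γ.IsGlued c := by
  classical
  -- the end of the path starting at a source, and the start of the path ending at a target
  let f : S ⊕ P → T ⊕ Q := Sum.elim
    (fun x => Sum.elim Sum.inl (fun i => Sum.inr (γ.exists_b i).choose) (γ.a (.inl x)))
    (fun p => Sum.elim (fun o => Sum.inl (γ.exists_a o).choose) Sum.inr (γ.b (.inr p)))
  have hf : γ.IsGlued f := by
    constructor
    · rintro (x | o) t ht
      · simp [f, inlA, ht]
      · obtain ⟨p, hp⟩ := γ.exists_b_symm o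
        rw [γ.inlA_inr hp]
        simp only [f, Sum.elim_inr, hp, Sum.elim_inl]
        have := (γ.exists_a o).choose_spec
        exact congrArg Sum.inl (Sum.inl_injective (this.symm.trans ht))
    · rintro (i | p) q hq
      · obtain ⟨x, hx⟩ := γ.exists_a_symm i
        rw [γ.inlB_inl hx]
        simp only [f, Sum.elim_inl, hx, Sum.elim_inr]
        have := (γ.exists_b i).choose_spec
        exact congrArg Sum.inr (Sum.inr_injective (this.symm.trans hq))
      · simp [f, inlB, hq]
  have hbij : Function.Bijective f := by
    constructor
    · intro x y hxy
      rcases γ.cases_source x with ⟨e, t, ht, rfl⟩ | ⟨e, q, hq, rfl⟩ <;>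
        rcases γ.cases_source y with ⟨e', t', ht', rfl⟩ | ⟨e', q', hq', rfl⟩
      · rw [hf.1 e t ht, hf.1 e' t' ht'] at hxy
        obtain rfl := Sum.inl_injective hxy
        rw [γ.a.injective (ht.trans ht'.symm)]
      · rw [hf.1 e t ht, hf.2 e' q' hq'] at hxy
        cases hxy
      · rw [hf.2 e q hq, hf.1 e' t' ht'] at hxy
        cases hxy
      · rw [hf.2 e q hq, hf.2 e' q' hq'] at hxy
        obtain rfl := Sum.inr_injective hxy
        rw [γ.b.injective (hq.trans hq'.symm)]
    · rintro (t | q)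
      · exact ⟨_, hf.1 _ t (γ.a.apply_symm_apply _)⟩
      · exact ⟨_, hf.2 _ q (γ.b.apply_symm_apply _)⟩
  exact ⟨Equiv.ofBijective f hbij, hf⟩

end Gluing

namespace Graph

variable {K L m n : ℕ}

/-- The flags, split into the flags outside the vertex `v` (and the legs) and the flags at `v`. -/
noncomputable def flagSplit {a : ℕ} (ar : Fin K → ℕ) (v : Fin K) :
    (Fin a ⊕ Σ u : ({v}ᶜ : Set (Fin K)), Fin (ar u)) ⊕ Fin (ar v) ≃ Fin a ⊕ Σ u, Fin (ar u) :=
  Equiv.ofBijective (Sum.elim (outerFlag ar v) (fun i => .inr ⟨v, i⟩)) (by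
    constructor
    · rintro ((i | ⟨⟨u, hu⟩, i⟩) | i) ((j | ⟨⟨w, hw⟩, j⟩) | j) h <;>
        simp only [Sum.elim_inl, Sum.elim_inr, outerFlag, Sum.map_inl, Sum.map_inr, id,
          reduceCtorEq, Sum.inl.injEq, Sum.inr.injEq, Sigma.mk.injEq] at h ⊢
      · exact h
      · obtain ⟨rfl, h⟩ := h
        obtain rfl := eq_of_heq h
        simp
      · exact absurd h.1 hu
      · exact absurd h.1.symm hw
      · exact eq_of_heq h.2
    · rintro (i | ⟨u, i⟩)
      · exact ⟨.inl (.inl i), rfl⟩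
      · by_cases hu : u = v
        · subst hu
          exact ⟨.inr i, rfl⟩
        · exact ⟨.inl (.inr ⟨⟨u, hu⟩, i⟩), rfl⟩)

theorem flagSplit_inr {a : ℕ} (ar : Fin K → ℕ) (v : Fin K) (i : Fin (ar v)) :
    flagSplit (a := a) ar v (.inr i) = .inr ⟨v, i⟩ := rfl

variable (g : Graph K m n) (v : Fin K) (h : Graph L (g.out v) (g.inn v))

/-- The wirings of `g` and of `h`, to be glued at the flags of the vertex `v`. -/
noncomputable def gluing : Gluing (Fin n ⊕ Σ u : ({v}ᶜ : Set (Fin K)), Fin (g.out u))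
    (Fin (g.out v)) (Fin m ⊕ Σ u : ({v}ᶜ : Set (Fin K)), Fin (g.inn u)) (Fin (g.inn v))
    (Σ w, Fin (h.out w)) (Σ w, Fin (h.inn w)) where
  a := (flagSplit g.out v).trans (g.wire.trans (flagSplit g.inn v).symm)
  b := h.wire
  ha := by
    intro o i hoi
    simp only [Equiv.trans_apply, flagSplit_inr, Equiv.symm_apply_eq] at hoi
    exact lt_irrefl _ (g.progressive _ _ _ _ hoi)
  hb := h.no_strand

theorem gluing_a_iff (e : _ ⊕ Fin (g.out v)) (t : _ ⊕ Fin (g.inn v)) :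
    (g.gluing v h).a e = t ↔ g.wire (flagSplit g.out v e) = flagSplit g.inn v t := by
  simp [gluing, Equiv.symm_apply_eq]

/-- The flags of a graph `G` whose vertices are those of `g` other than `v` and those of `h`. -/
noncomputable def glueFlags {N a L : ℕ} {ar : Fin K → ℕ} {ar' : Fin L → ℕ} {AR : Fin N → ℕ}
    {v : Fin K} (vert : ({v}ᶜ : Set (Fin K)) ⊕ Fin L ≃ Fin N)
    (h : ∀ y, Sum.elim (fun u : ({v}ᶜ : Set (Fin K)) => ar u) ar' y = AR (vert y)) :
    (Fin a ⊕ Σ u : ({v}ᶜ : Set (Fin K)), Fin (ar u)) ⊕ (Σ w, Fin (ar' w)) ≃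
      Fin a ⊕ Σ x, Fin (AR x) :=
  Equiv.ofBijective (Sum.elim
    (Sum.map id (fun y => ⟨vert (.inl y.1), Fin.cast (h (.inl y.1)) y.2⟩))
    (fun y => .inr ⟨vert (.inr y.1), Fin.cast (h (.inr y.1)) y.2⟩)) (by
    constructor
    · have key : ∀ (y y' : ({v}ᶜ : Set (Fin K)) ⊕ Fin L)
          (i : Fin (Sum.elim (fun u : ({v}ᶜ : Set (Fin K)) => ar u) ar' y))
          (i' : Fin (Sum.elim (fun u : ({v}ᶜ : Set (Fin K)) => ar u) ar' y')),
          (⟨vert y, Fin.cast (h y) i⟩ : Σ x, Fin (AR x)) = ⟨vert y', Fin.cast (h y') i'⟩ →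
          (⟨y, i⟩ : Σ y : ({v}ᶜ : Set (Fin K)) ⊕ Fin L,
            Fin (Sum.elim (fun u : ({v}ᶜ : Set (Fin K)) => ar u) ar' y)) =
            ⟨y', i'⟩ := by
        intro y y' i i' hyy
        obtain ⟨h1, h2⟩ := Sigma.mk.inj hyy
        obtain rfl := vert.injective h1
        have := eq_of_heq h2
        rw [Fin.ext_iff] at this
        rw [Fin.ext (by simpa using this) (a := i) (b := i')]
      rintro ((i | ⟨u, i⟩) | ⟨w, i⟩) ((j | ⟨u', j⟩) | ⟨w', j⟩) hij <;>
        simp only [Sum.elim_inl, Sum.elim_inr, Sum.map_inl, Sum.map_inr, id,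
          reduceCtorEq, Sum.inl.injEq, Sum.inr.injEq] at hij ⊢
      · exact hij
      · have := key (.inl u) (.inl u') i j hij
        obtain ⟨h1, h2⟩ := Sigma.mk.inj this
        obtain rfl := Sum.inl_injective h1
        rw [eq_of_heq h2]
      · have := key (.inl u) (.inr w') i j hij
        cases (Sigma.mk.inj this).1
      · have := key (.inr w) (.inl u') i j hij
        cases (Sigma.mk.inj this).1
      · have := key (.inr w) (.inr w') i j hij
        obtain ⟨h1, h2⟩ := Sigma.mk.inj this
        obtain rfl := Sum.inr_injective h1
        rw [eq_of_heq h2]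
    · rintro (i | ⟨x, i⟩)
      · exact ⟨.inl (.inl i), rfl⟩
      · obtain ⟨y, rfl⟩ := vert.surjective x
        rcases y with u | w
        · exact ⟨.inl (.inr ⟨u, Fin.cast (h (.inl u)).symm i⟩), rfl⟩
        · exact ⟨.inr ⟨w, Fin.cast (h (.inr w)).symm i⟩, rfl⟩)

namespace Insertion

variable {g v h} (σ : g.Insertion v h)

/-- The sources of the edges of the inserted graph. -/
noncomputable def srcEquiv : (Fin n ⊕ Σ u : ({v}ᶜ : Set (Fin K)), Fin (g.out u)) ⊕
    (Σ w, Fin (h.out w)) ≃ σ.G.Edge :=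
  glueFlags σ.vert σ.out_eq

/-- The targets of the edges of the inserted graph. -/
noncomputable def tgtEquiv : (Fin m ⊕ Σ u : ({v}ᶜ : Set (Fin K)), Fin (g.inn u)) ⊕
    (Σ w, Fin (h.inn w)) ≃ (Fin m ⊕ Σ x, Fin (σ.G.inn x)) :=
  glueFlags σ.vert σ.inn_eq

/-- The wiring of the inserted graph is the gluing of the two wirings. -/
theorem isGlued : (g.gluing v h).IsGlued (fun e => σ.tgtEquiv.symm (σ.G.wire (σ.srcEquiv e))) := by
  constructor
  · rintro e t ht
    rw [Equiv.symm_apply_eq]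
    rcases e with x | o
    · exact σ.wire_outer x t ((g.gluing_a_iff v h _ _).1 ht)
    · obtain ⟨⟨w, i⟩, hp⟩ := (g.gluing v h).exists_b_symm o
      rw [Gluing.inlA_inr _ hp]
      exact σ.wire_exit w i o t hp ((g.gluing_a_iff v h _ _).1 ht)
  · rintro e ⟨w', j⟩ hq
    rw [Equiv.symm_apply_eq]
    rcases e with i | ⟨w, i⟩
    · obtain ⟨x, hx⟩ := (g.gluing v h).exists_a_symm i
      rw [Gluing.inlB_inl _ hx]
      exact σ.wire_enter x i w' j ((g.gluing_a_iff v h _ _).1 hx) hq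
    · exact σ.wire_inner w i w' j hq

end Insertion

end Graph

namespace Graph

/-! ### Levels of edges and insertion of graphs -/

section Levels

variable {K m n : ℕ} (g : Graph K m n)

/-- The level from which an edge starts: its initial vertex, or `K` for an input leg. -/
def srcLevel (e : g.Edge) : ℕ := Sum.elim (fun _ => K) (fun x => (x.1 : ℕ)) e

/-- The level at which an edge ends: just above its final vertex, or `0` for an output leg. -/
def tgtLevel (e : g.Edge) : ℕ := Sum.elim (fun _ => 0) (fun x => (x.1 : ℕ) + 1) (g.wire e)

theorem startsAbove_iff {j : ℕ} (hj : j ≤ K) (e : g.Edge) :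
    g.StartsAbove j e ↔ j ≤ g.srcLevel e := by
  rcases e with i | ⟨u, i⟩
  · exact ⟨fun _ => hj, fun _ v i h => by cases h⟩
  · refine ⟨fun h => h u i rfl, fun h v i h' => ?_⟩
    cases h'
    exact h

theorem endsBelow_iff {j : ℕ} (e : g.Edge) : g.EndsBelow j e ↔ g.tgtLevel e ≤ j := by
  unfold EndsBelow tgtLevel
  rcases h : g.wire e with i | ⟨u, i⟩
  · simp
  · refine ⟨fun h' => h' u i rfl, fun h' v i h'' => ?_⟩
    cases h''
    exact h'

theorem tgtLevel_le_srcLevel (e : g.Edge) : g.tgtLevel e ≤ g.srcLevel e := by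
  rcases e with i | ⟨u, i⟩
  · unfold tgtLevel srcLevel
    rcases h : g.wire (.inl i) with j | ⟨w, j⟩
    · simp
    · exact w.2
  · unfold tgtLevel srcLevel
    rcases h : g.wire (.inr ⟨u, i⟩) with j | ⟨w, j⟩
    · simp
    · exact g.progressive _ _ _ _ h

theorem srcLevel_le (e : g.Edge) : g.srcLevel e ≤ K := by
  rcases e with i | ⟨u, i⟩
  · exact le_rfl
  · exact u.2.le

theorem tgtLevel_of_wire {e : g.Edge} {w : Fin K} {j : Fin (g.inn w)}
    (h : g.wire e = .inr ⟨w, j⟩) : g.tgtLevel e = w + 1 := by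
  simp [tgtLevel, h]

end Levels

variable {K L m n : ℕ}

/-- The position, in a graph obtained by inserting a graph with `L` vertices at the vertex `v`, of
a vertex of the outer graph or of the inner graph. -/
def insertPos (v : Fin K) (L : ℕ) : ({v}ᶜ : Set (Fin K)) ⊕ Fin L → ℕ :=
  Sum.elim (fun u => if u.1 < v then (u.1 : ℕ) else u.1 - 1 + L) (fun w => v + w)

theorem insertPos_inl (v : Fin K) (L : ℕ) (u : ({v}ᶜ : Set (Fin K))) :
    ((u.1 : ℕ) < v ∧ insertPos v L (.inl u) = u.1) ∨
      ((v : ℕ) < u.1 ∧ insertPos v L (.inl u) + 1 = u.1 + L) := by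
  have hne : (u.1 : ℕ) ≠ v := fun h => u.2 (Fin.ext h)
  rcases lt_or_gt_of_ne hne with h | h
  · left
    exact ⟨h, if_pos h⟩
  · right
    refine ⟨h, ?_⟩
    have : insertPos v L (.inl u) = u.1 - 1 + L := if_neg (not_lt.2 (le_of_lt h))
    omega

theorem insertPos_inr (v : Fin K) (w : Fin L) : insertPos v L (.inr w) = v + w := rfl

theorem insertPos_injective (v : Fin K) (L : ℕ) : Function.Injective (insertPos v L) := by
  rintro (u | w) (u' | w') h
  · have h1 := insertPos_inl v L u
    have h2 := insertPos_inl v L u'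
    exact congrArg Sum.inl (Subtype.ext (Fin.ext (by omega)))
  · have h1 := insertPos_inl v L u
    rw [insertPos_inr] at h
    omega
  · have h1 := insertPos_inl v L u'
    rw [insertPos_inr] at h
    omega
  · rw [insertPos_inr, insertPos_inr] at h
    exact congrArg Sum.inr (Fin.ext (by omega))

theorem insertPos_lt (v : Fin K) (L : ℕ) (y) : insertPos v L y < K - 1 + L := by
  have hv := v.2
  rcases y with u | w
  · have h1 := insertPos_inl v L u
    have := u.1.2
    omega
  · rw [insertPos_inr]
    omega

theorem insertPos_lt_insertPos (v : Fin K) {y y' : ({v}ᶜ : Set (Fin K)) ⊕ Fin L}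
    (h : Sum.elim Subtype.val (fun _ => v) y < Sum.elim Subtype.val (fun _ => v) y') :
    insertPos v L y < insertPos v L y' := by
  rcases y with u | w <;> rcases y' with u' | w' <;>
    simp only [Sum.elim_inl, Sum.elim_inr, Fin.lt_def] at h
  · have h1 := insertPos_inl v L u
    have h2 := insertPos_inl v L u'
    omega
  · have h1 := insertPos_inl v L u
    rw [insertPos_inr]
    omega
  · have h1 := insertPos_inl v L u'
    rw [insertPos_inr]
    omega
  · omega

theorem card_insert (v : Fin K) (L : ℕ) :
    Fintype.card (({v}ᶜ : Set (Fin K)) ⊕ Fin L) = K - 1 + L := by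
  rw [Fintype.card_sum, Fintype.card_fin, Fintype.card_compl_set]
  simp

variable {g : Graph K m n} {v : Fin K} {h : Graph L (g.out v) (g.inn v)}

namespace Insertion

theorem N_eq (σ : g.Insertion v h) : σ.N = K - 1 + L := by
  rw [← card_insert v L, Fintype.card_congr σ.vert, Fintype.card_fin]

/-- The order conditions determine the positions of all the vertices. -/
theorem vert_val (σ : g.Insertion v h) (y) : (σ.vert y : ℕ) = insertPos v L y := by
  have hlt : ∀ x, insertPos v L (σ.vert.symm x) < σ.N := fun x =>
    lt_of_lt_of_eq (insertPos_lt v L _) σ.N_eq.symm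
  let f : Fin σ.N → Fin σ.N := fun x => ⟨insertPos v L (σ.vert.symm x), hlt x⟩
  have hf : StrictMono f := by
    intro x x' hx
    obtain ⟨y, rfl⟩ := σ.vert.surjective x
    obtain ⟨y', rfl⟩ := σ.vert.surjective x'
    simp only [f, Equiv.symm_apply_apply, Fin.mk_lt_mk]
    rcases lt_trichotomy (Sum.elim Subtype.val (fun _ => v) y : Fin K)
      (Sum.elim Subtype.val (fun _ => v) y') with hy | hy | hy
    · exact insertPos_lt_insertPos v hy
    · rcases y with u | w <;> rcases y' with u' | w' <;>
        simp only [Sum.elim_inl, Sum.elim_inr] at hy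
      · obtain rfl := Subtype.ext hy
        exact absurd hx (lt_irrefl _)
      · exact absurd hy u.2
      · exact absurd hy.symm u'.2
      · rcases lt_trichotomy w w' with hw | hw | hw
        · rw [insertPos_inr, insertPos_inr]
          exact Nat.add_lt_add_left hw _
        · subst hw
          exact absurd hx (lt_irrefl _)
        · exact absurd (σ.vert_lt_inner _ _ hw) (not_lt.2 hx.le)
    · exact absurd (σ.vert_lt _ _ hy) (not_lt.2 hx.le)
  have h1 : f (σ.vert y) = σ.vert y := le_antisymm hf.apply_le hf.le_apply
  have := congrArg Fin.val h1
  simpa [f] using this.symm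

instance : Subsingleton (g.Insertion v h) := by
  constructor
  intro σ σ'
  have hN : σ.N = σ'.N := σ.N_eq.trans σ'.N_eq.symm
  have hv := σ.vert_val
  have hv' := σ'.vert_val
  have hg := σ.isGlued
  have hg' := σ'.isGlued
  rcases σ with ⟨N, ⟨out, inn, wire, _, _, _, _⟩, vert, l1, l2, ho, hi, w1, w2, w3, w4⟩
  rcases σ' with ⟨N', ⟨out', inn', wire', _, _, _, _⟩, vert', l1', l2', ho', hi', w1', w2', w3',
    w4'⟩
  dsimp only at hN hv hv' ho ho' hi hi'
  subst hN
  obtain rfl : vert = vert' := Equiv.ext fun y => Fin.ext ((hv y).trans (hv' y).symm)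
  obtain rfl : out = out' := funext fun x => by
    obtain ⟨y, rfl⟩ := vert.surjective x
    rw [← ho y, ← ho' y]
  obtain rfl : inn = inn' := funext fun x => by
    obtain ⟨y, rfl⟩ := vert.surjective x
    rw [← hi y, ← hi' y]
  obtain rfl : wire = wire' := Equiv.ext fun e => by
    have := congrFun (hg.unique hg') ((glueFlags vert ho).symm e)
    have h2 := (glueFlags vert hi).symm.injective this
    dsimp only [srcEquiv] at h2
    rwa [Equiv.apply_symm_apply] at h2
  rfl

end Insertion

section LevelsOfGluing

/-- The level from which an edge of the glued graph starts. -/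
noncomputable def glueSrcLevel (g : Graph K m n) (v : Fin K) (h : Graph L (g.out v) (g.inn v)) :
    (Fin n ⊕ Σ u : ({v}ᶜ : Set (Fin K)), Fin (g.out u)) ⊕ (Σ w, Fin (h.out w)) → ℕ :=
  Sum.elim (Sum.elim (fun _ => K - 1 + L) (fun x => insertPos v L (.inl x.1)))
    (fun x => insertPos v L (.inr x.1))

/-- The level at which a target of the glued graph is located. -/
noncomputable def glueTgtLevel (g : Graph K m n) (v : Fin K) (h : Graph L (g.out v) (g.inn v)) :
    (Fin m ⊕ Σ u : ({v}ᶜ : Set (Fin K)), Fin (g.inn u)) ⊕ (Σ w, Fin (h.inn w)) → ℕ :=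
  Sum.elim (Sum.elim (fun _ => 0) (fun x => insertPos v L (.inl x.1) + 1))
    (fun x => insertPos v L (.inr x.1) + 1)

theorem glueSrcLevel_inlA (h : Graph L (g.out v) (g.inn v)) (e) :
    (g.srcLevel (flagSplit g.out v e) < v ∧
      glueSrcLevel g v h ((g.gluing v h).inlA e) = g.srcLevel (flagSplit g.out v e)) ∨
    (g.srcLevel (flagSplit g.out v e) = v ∧
      v ≤ glueSrcLevel g v h ((g.gluing v h).inlA e) ∧
      glueSrcLevel g v h ((g.gluing v h).inlA e) < v + L) ∨
    (v < g.srcLevel (flagSplit g.out v e) ∧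
      glueSrcLevel g v h ((g.gluing v h).inlA e) + 1 = g.srcLevel (flagSplit g.out v e) + L) := by
  rcases e with (i | ⟨u, i⟩) | o
  · right; right
    have := v.2
    refine ⟨this, ?_⟩
    change K - 1 + L + 1 = K + L
    omega
  · have h1 := insertPos_inl v L u
    have e1 : g.srcLevel (flagSplit g.out v (.inl (.inr ⟨u, i⟩))) = u.1 := rfl
    have e2 : glueSrcLevel g v h ((g.gluing v h).inlA (.inl (.inr ⟨u, i⟩))) =
      insertPos v L (.inl u) := rfl
    omega
  · obtain ⟨p, hp⟩ := (g.gluing v h).exists_b_symm o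
    have e1 : g.srcLevel (flagSplit g.out v (.inr o)) = v := rfl
    have e2 : glueSrcLevel g v h (.inr p) = v + p.1 := rfl
    rw [Gluing.inlA_inr _ hp]
    have := p.1.2
    omega

theorem glueTgtLevel_inl {e t} (ht : (g.gluing v h).a e = .inl t) :
    (g.tgtLevel (flagSplit g.out v e) ≤ v ∧
      glueTgtLevel g v h (.inl t) = g.tgtLevel (flagSplit g.out v e)) ∨
    (v + 1 < g.tgtLevel (flagSplit g.out v e) ∧
      glueTgtLevel g v h (.inl t) + 1 = g.tgtLevel (flagSplit g.out v e) + L) := by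
  rw [gluing_a_iff] at ht
  unfold tgtLevel
  rw [ht]
  rcases t with i | ⟨u, i⟩
  · exact .inl ⟨Nat.zero_le _, rfl⟩
  · have h1 := insertPos_inl v L u
    have e1 : Sum.elim (fun _ => 0) (fun x => (x.1 : ℕ) + 1)
      (flagSplit (a := m) g.inn v (.inl (.inr ⟨u, i⟩))) = u.1 + 1 := rfl
    have e2 : glueTgtLevel g v h (.inl (.inr ⟨u, i⟩)) = insertPos v L (.inl u) + 1 := rfl
    omega

theorem glueSrcLevel_inlB (h : Graph L (g.out v) (g.inn v)) (e) :
    (h.srcLevel e < L ∧ glueSrcLevel g v h ((g.gluing v h).inlB e) = v + h.srcLevel e) ∨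
    (h.srcLevel e = L ∧ v + L ≤ glueSrcLevel g v h ((g.gluing v h).inlB e)) := by
  rcases e with i | p
  · right
    refine ⟨rfl, ?_⟩
    obtain ⟨x, hx⟩ := (g.gluing v h).exists_a_symm i
    rw [Gluing.inlB_inl _ hx]
    have h1 := glueSrcLevel_inlA h (.inl x)
    have h2 := g.tgtLevel_le_srcLevel (flagSplit g.out v (.inl x))
    rw [gluing_a_iff] at hx
    rw [g.tgtLevel_of_wire hx] at h2
    have : (g.gluing v h).inlA (.inl x) = .inl x := rfl
    rw [this] at h1
    omega
  · left
    exact ⟨p.1.2, rfl⟩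

theorem glueTgtLevel_inr {e q} (hq : (g.gluing v h).b e = .inr q) :
    0 < h.tgtLevel e ∧ glueTgtLevel g v h (.inr q) = v + h.tgtLevel e := by
  have : h.tgtLevel e = q.1 + 1 := h.tgtLevel_of_wire hq
  have e2 : glueTgtLevel g v h (.inr q) = v + q.1 + 1 := rfl
  omega

/-- A glued graph has no edge going up. -/
theorem glueTgtLevel_le {c} (hc : (g.gluing v h).IsGlued c) (z) :
    glueTgtLevel g v h (c z) ≤ glueSrcLevel g v h z := by
  rcases (g.gluing v h).cases_source z with ⟨e, t, ht, rfl⟩ | ⟨e, q, hq, rfl⟩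
  · rw [hc.1 e t ht]
    have h1 := glueSrcLevel_inlA h e
    have h2 := glueTgtLevel_inl ht
    have h3 := g.tgtLevel_le_srcLevel (flagSplit g.out v e)
    omega
  · rw [hc.2 e q hq]
    have h1 := glueSrcLevel_inlB h e
    have h2 := glueTgtLevel_inr hq
    have h3 := h.tgtLevel_le_srcLevel e
    omega

end LevelsOfGluing

variable (g v h)

/-- The insertion of a graph at a vertex exists. -/
theorem nonempty_insertion : Nonempty (g.Insertion v h) := by
  obtain ⟨c, hc⟩ := (g.gluing v h).exists_glued
  let vert : ({v}ᶜ : Set (Fin K)) ⊕ Fin L ≃ Fin (K - 1 + L) :=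
    Equiv.ofBijective (fun y => ⟨insertPos v L y, insertPos_lt v L y⟩)
      ((Fintype.bijective_iff_injective_and_card _).2
        ⟨fun y y' hy => insertPos_injective v L (Fin.mk.inj hy),
          (card_insert v L).trans (Fintype.card_fin _).symm⟩)
  have vert_val : ∀ y, (vert y : ℕ) = insertPos v L y := fun y => rfl
  let out : Fin (K - 1 + L) → ℕ :=
    fun x => Sum.elim (fun u : ({v}ᶜ : Set (Fin K)) => g.out u) h.out (vert.symm x)
  let inn : Fin (K - 1 + L) → ℕ :=
    fun x => Sum.elim (fun u : ({v}ᶜ : Set (Fin K)) => g.inn u) h.inn (vert.symm x)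
  have ho : ∀ y, Sum.elim (fun u : ({v}ᶜ : Set (Fin K)) => g.out u) h.out y = out (vert y) :=
    fun y => by simp only [out, Equiv.symm_apply_apply]
  have hi : ∀ y, Sum.elim (fun u : ({v}ᶜ : Set (Fin K)) => g.inn u) h.inn y = inn (vert y) :=
    fun y => by simp only [inn, Equiv.symm_apply_apply]
  let S := glueFlags (a := n) vert ho
  let T := glueFlags (a := m) vert hi
  let wire : (Fin n ⊕ Σ x, Fin (out x)) ≃ (Fin m ⊕ Σ x, Fin (inn x)) := S.symm.trans (c.trans T)
  have hw : ∀ z, wire (S z) = T (c z) := fun z => by simp [wire]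
  have hS : ∀ z, glueSrcLevel g v h z =
      Sum.elim (fun _ => K - 1 + L) (fun x => (x.1 : ℕ)) (S z) := by
    rintro ((i | i) | i) <;> rfl
  have hT : ∀ z, glueTgtLevel g v h z = Sum.elim (fun _ => 0) (fun x => (x.1 : ℕ) + 1) (T z) := by
    rintro ((i | i) | i) <;> rfl
  have hL := h.nonempty
  let R : Fin (K - 1 + L) → Fin (K - 1 + L) → Prop :=
    fun a b => ∃ i j, wire (.inr ⟨a, i⟩) = .inr ⟨b, j⟩
  have hR : ∀ z x i x' j, S z = .inr ⟨x, i⟩ → T (c z) = .inr ⟨x', j⟩ → R x x' := by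
    intro z x i x' j h1 h2
    exact ⟨i, j, by rw [← h1, hw, h2]⟩
  -- the vertices of the inner graph are connected with each other
  have hinner : ∀ w w' : Fin L, Relation.EqvGen R (vert (.inr w)) (vert (.inr w')) := by
    intro w w'
    have := h.connected w w'
    induction this with
    | rel a b hab =>
      obtain ⟨i, j, hij⟩ := hab
      refine Relation.EqvGen.rel _ _ (hR (.inr ⟨a, i⟩) _ _ _ (Fin.cast (hi (.inr b)) j) rfl ?_)
      have := hc.2 (.inr ⟨a, i⟩) ⟨b, j⟩ hij
      have e : (g.gluing v h).inlB (.inr ⟨a, i⟩) = .inr ⟨a, i⟩ := rfl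
      rw [e] at this
      rw [this]
      rfl
    | refl a => exact Relation.EqvGen.refl _
    | symm a b _ ih => exact Relation.EqvGen.symm _ _ ih
    | trans a b d _ _ ih1 ih2 => exact Relation.EqvGen.trans _ _ _ ih1 ih2
  let rep : Fin K → Fin (K - 1 + L) := fun u =>
    if hu : u = v then vert (.inr ⟨0, hL⟩) else vert (.inl ⟨u, hu⟩)
  have hrepv : rep v = vert (.inr ⟨0, hL⟩) := by simp [rep]
  have hrepu : ∀ u : ({v}ᶜ : Set (Fin K)), rep u = vert (.inl u) := fun u => by
    have : (u : Fin K) ≠ v := u.2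
    simp [rep, this]
  -- an edge of the outer graph gives an edge between the corresponding clusters
  have hedge : ∀ a b : Fin K, (∃ i j, g.wire (.inr ⟨a, i⟩) = .inr ⟨b, j⟩) →
      Relation.EqvGen R (rep a) (rep b) := by
    rintro a b ⟨i, j, hij⟩
    by_cases ha : a = v
    · subst ha
      have hb : b ≠ a := fun e => by
        subst e
        exact lt_irrefl _ (g.progressive _ _ _ _ hij)
      rw [hrepv, hrepu ⟨b, hb⟩]
      obtain ⟨p, hp⟩ := (g.gluing a h).exists_b_symm i
      have h1 := hc.1 (.inr i) (.inr ⟨⟨b, hb⟩, j⟩) ((g.gluing_a_iff a h _ _).2 hij)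
      rw [Gluing.inlA_inr _ hp] at h1
      refine Relation.EqvGen.trans _ _ _ (hinner _ p.1)
        (Relation.EqvGen.rel _ _ (hR (.inr p) _ _ _ (Fin.cast (hi (.inl ⟨b, hb⟩)) j) rfl ?_))
      rw [h1]
      rfl
    · by_cases hb : b = v
      · subst hb
        rw [hrepv, hrepu ⟨a, ha⟩]
        obtain ⟨q, hq⟩ := (g.gluing b h).exists_b j
        have h1 := hc.2 (.inl j) q hq
        have h2 : (g.gluing b h).a (.inl (.inr ⟨⟨a, ha⟩, i⟩)) = .inr j :=
          (g.gluing_a_iff b h _ _).2 hij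
        rw [Gluing.inlB_inl _ h2] at h1
        refine Relation.EqvGen.trans _ _ _ (Relation.EqvGen.rel _ _
          (hR (.inl (.inr ⟨⟨a, ha⟩, i⟩)) _ _ _ (Fin.cast (hi (.inr q.1)) q.2) rfl ?_))
          (hinner q.1 _)
        rw [h1]
        rfl
      · rw [hrepu ⟨a, ha⟩, hrepu ⟨b, hb⟩]
        have h1 := hc.1 (.inl (.inr ⟨⟨a, ha⟩, i⟩)) (.inr ⟨⟨b, hb⟩, j⟩)
          ((g.gluing_a_iff v h _ _).2 hij)
        refine Relation.EqvGen.rel _ _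
          (hR (.inl (.inr ⟨⟨a, ha⟩, i⟩)) _ _ _ (Fin.cast (hi (.inl ⟨b, hb⟩)) j) rfl ?_)
        have e : (g.gluing v h).inlA (.inl (.inr ⟨⟨a, ha⟩, i⟩)) = .inl (.inr ⟨⟨a, ha⟩, i⟩) := rfl
        rw [e] at h1
        rw [h1]
        rfl
  have houter : ∀ a b : Fin K, Relation.EqvGen R (rep a) (rep b) := by
    intro a b
    have := g.connected a b
    induction this with
    | rel a b hab => exact hedge a b hab
    | refl a => exact Relation.EqvGen.refl _
    | symm a b _ ih => exact Relation.EqvGen.symm _ _ ih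
    | trans a b d _ _ ih1 ih2 => exact Relation.EqvGen.trans _ _ _ ih1 ih2
  have hproj : ∀ x, ∃ a, Relation.EqvGen R x (rep a) := by
    intro x
    obtain ⟨y, rfl⟩ := vert.surjective x
    rcases y with u | w
    · exact ⟨u, by rw [hrepu]; exact Relation.EqvGen.refl _⟩
    · exact ⟨v, by rw [hrepv]; exact hinner _ _⟩
  let G : Graph (K - 1 + L) m n :=
    { out := out
      inn := inn
      wire := wire
      progressive := by
        intro x x' i j hx
        obtain ⟨z, hz⟩ := S.surjective (.inr ⟨x, i⟩)
        have h1 := glueTgtLevel_le hc z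
        rw [hS, hT, ← hw, hz, hx] at h1
        exact h1
      nonempty := by omega
      no_strand := by
        intro i j hij
        have e : S (.inl (.inl i)) = .inl i := rfl
        have e' : T (.inl (.inl j)) = .inl j := rfl
        rw [← e, hw, ← e'] at hij
        have h1 := T.injective hij
        rcases (g.gluing v h).cases_source (.inl (.inl i)) with ⟨x, t, ht, hx⟩ | ⟨x, q, hq, hx⟩
        · rw [hx, hc.1 _ _ ht] at h1
          obtain rfl := Sum.inl_injective h1
          rcases x with x | o
          · obtain rfl := Sum.inl_injective hx
            exact g.no_strand _ _ ((g.gluing_a_iff v h _ _).1 ht)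
          · simp [Gluing.inlA] at hx
        · rw [hx, hc.2 _ _ hq] at h1
          cases h1
      connected := by
        intro x x'
        obtain ⟨a, ha⟩ := hproj x
        obtain ⟨b, hb⟩ := hproj x'
        exact Relation.EqvGen.trans _ _ _ ha
          (Relation.EqvGen.trans _ _ _ (houter a b) (Relation.EqvGen.symm _ _ hb)) }
  have key1 : ∀ e t, (g.gluing v h).a e = .inl t →
      wire (S ((g.gluing v h).inlA e)) = T (.inl t) := fun e t ht => by rw [hw, hc.1 e t ht]
  have key2 : ∀ e q, (g.gluing v h).b e = .inr q →
      wire (S ((g.gluing v h).inlB e)) = T (.inr q) := fun e q hq => by rw [hw, hc.2 e q hq]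
  exact ⟨
    { N := K - 1 + L
      G := G
      vert := vert
      vert_lt := fun y y' hy => insertPos_lt_insertPos v hy
      vert_lt_inner := fun w w' hw' => by
        rw [Fin.lt_def, vert_val, vert_val, insertPos_inr, insertPos_inr]
        exact Nat.add_lt_add_left hw' _
      out_eq := ho
      inn_eq := hi
      wire_outer := fun e t he => key1 (.inl e) t ((g.gluing_a_iff v h _ _).2 he)
      wire_enter := fun e j w j' he hj => by
        have := key2 (.inl j) ⟨w, j'⟩ hj
        rw [Gluing.inlB_inl _ ((g.gluing_a_iff v h _ (.inr j)).2 he)] at this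
        exact this
      wire_inner := fun w i w' j hij => key2 (.inr ⟨w, i⟩) ⟨w', j⟩ hij
      wire_exit := fun w i i' t hi' ht => by
        have := key1 (.inr i') t ((g.gluing_a_iff v h _ _).2 ht)
        rw [Gluing.inlA_inr _ hi'] at this
        exact this }⟩

/-- A graph can be inserted at a vertex in exactly one way. -/
noncomputable instance : Unique (g.Insertion v h) where
  default := (g.nonempty_insertion v h).some
  uniq _ := Subsingleton.elim _ _

end Graph

namespace Graph.Insertion

/-! ### Composition along an inserted graph -/

variable {K L m n : ℕ} {g : Graph K m n} {v : Fin K} {h : Graph L (g.out v) (g.inn v)}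
  (σ : g.Insertion v h)

section Edges

/-- The edge of the inserted graph which contains a given edge of the outer graph. -/
noncomputable def outerEdge (e : g.Edge) : σ.G.Edge :=
  σ.srcEquiv ((g.gluing v h).inlA ((flagSplit g.out v).symm e))

/-- The edge of the inserted graph which contains a given edge of the inner graph. -/
noncomputable def innerEdge (e : h.Edge) : σ.G.Edge := σ.srcEquiv ((g.gluing v h).inlB e)

theorem outerEdge_injective : Function.Injective σ.outerEdge :=
  σ.srcEquiv.injective.comp ((g.gluing v h).inlA_injective.comp (Equiv.injective _))

theorem innerEdge_injective : Function.Injective σ.innerEdge :=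
  σ.srcEquiv.injective.comp (g.gluing v h).inlB_injective

theorem outerEdge_flag (u : ({v}ᶜ : Set (Fin K))) (i : Fin (g.out u)) :
    σ.outerEdge (.inr ⟨u, i⟩) = .inr ⟨σ.vert (.inl u), Fin.cast (σ.out_eq (.inl u)) i⟩ := by
  have : (flagSplit g.out v).symm (.inr ⟨u, i⟩ : g.Edge) = .inl (.inr ⟨u, i⟩) :=
    (Equiv.symm_apply_eq _).2 rfl
  rw [outerEdge, this]
  rfl

theorem outerEdge_leg (i : Fin n) : σ.outerEdge (.inl i) = .inl i := by
  have : (flagSplit g.out v).symm (.inl i) = .inl (.inl i) := (Equiv.symm_apply_eq _).2 rfl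
  rw [outerEdge, this]
  rfl

theorem innerEdge_flag (w : Fin L) (i : Fin (h.out w)) :
    σ.innerEdge (.inr ⟨w, i⟩) = .inr ⟨σ.vert (.inr w), Fin.cast (σ.out_eq (.inr w)) i⟩ := rfl

theorem wire_outerEdge_aux {e : g.Edge} {t} (ht : g.wire e = flagSplit g.inn v (.inl t)) :
    σ.G.wire (σ.outerEdge e) = σ.tgtEquiv (.inl t) := by
  have := σ.isGlued.1 ((flagSplit g.out v).symm e) t
    ((g.gluing_a_iff v h _ _).2 (by rw [Equiv.apply_symm_apply, ht]))
  exact (Equiv.symm_apply_eq _).1 this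

theorem wire_outerEdge {e : g.Edge} {u : ({v}ᶜ : Set (Fin K))} {j : Fin (g.inn u)}
    (he : g.wire e = .inr ⟨u, j⟩) :
    σ.G.wire (σ.outerEdge e) = .inr ⟨σ.vert (.inl u), Fin.cast (σ.inn_eq (.inl u)) j⟩ :=
  σ.wire_outerEdge_aux (t := .inr ⟨u, j⟩) he

theorem wire_outerEdge_leg {e : g.Edge} {i : Fin m} (he : g.wire e = .inl i) :
    σ.G.wire (σ.outerEdge e) = .inl i :=
  σ.wire_outerEdge_aux (t := .inl i) he

theorem wire_innerEdge {e : h.Edge} {w : Fin L} {j : Fin (h.inn w)} (he : h.wire e = .inr ⟨w, j⟩) :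
    σ.G.wire (σ.innerEdge e) = .inr ⟨σ.vert (.inr w), Fin.cast (σ.inn_eq (.inr w)) j⟩ :=
  (Equiv.symm_apply_eq _).1 (σ.isGlued.2 e ⟨w, j⟩ he)

theorem outerEdge_eq_innerEdge {e : g.Edge} {j : Fin (g.inn v)} (he : g.wire e = .inr ⟨v, j⟩) :
    σ.outerEdge e = σ.innerEdge (.inl j) := by
  have := (g.gluing v h).inlA_eq_inlB (e := (flagSplit g.out v).symm e) (i := j)
    ((g.gluing_a_iff v h _ _).2 (by rw [Equiv.apply_symm_apply, he]; rfl))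
  rw [outerEdge, this, innerEdge]

theorem innerEdge_eq_outerEdge {e : h.Edge} {o : Fin (g.out v)} (he : h.wire e = .inl o) :
    σ.innerEdge e = σ.outerEdge (.inr ⟨v, o⟩) := by
  have h1 : (flagSplit g.out v).symm (.inr ⟨v, o⟩ : g.Edge) = .inr o :=
    (Equiv.symm_apply_eq _).2 rfl
  rw [innerEdge, (g.gluing v h).inlB_eq_inlA he, outerEdge, h1]

theorem srcLevel_srcEquiv (z) : σ.G.srcLevel (σ.srcEquiv z) = glueSrcLevel g v h z := by
  rcases z with (i | ⟨u, i⟩) | ⟨w, i⟩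
  · exact σ.N_eq
  · exact σ.vert_val _
  · exact σ.vert_val _

theorem tgtLevel_srcEquiv (z) : σ.G.tgtLevel (σ.srcEquiv z) =
    glueTgtLevel g v h (σ.tgtEquiv.symm (σ.G.wire (σ.srcEquiv z))) := by
  unfold tgtLevel
  obtain ⟨t, ht⟩ := σ.tgtEquiv.surjective (σ.G.wire (σ.srcEquiv z))
  rw [← ht, Equiv.symm_apply_apply]
  rcases t with (i | ⟨u, i⟩) | ⟨w, i⟩
  · rfl
  · exact congrArg (· + 1) (σ.vert_val (.inl u))
  · exact congrArg (· + 1) (σ.vert_val (.inr w))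

theorem srcLevel_outerEdge (e : g.Edge) :
    (g.srcLevel e < v ∧ σ.G.srcLevel (σ.outerEdge e) = g.srcLevel e) ∨
    (g.srcLevel e = v ∧ v ≤ σ.G.srcLevel (σ.outerEdge e) ∧
      σ.G.srcLevel (σ.outerEdge e) < v + L) ∨
    (v < g.srcLevel e ∧ σ.G.srcLevel (σ.outerEdge e) + 1 = g.srcLevel e + L) := by
  have := glueSrcLevel_inlA h ((flagSplit g.out v).symm e)
  rwa [Equiv.apply_symm_apply, ← σ.srcLevel_srcEquiv] at this

theorem srcLevel_innerEdge (e : h.Edge) :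
    (h.srcLevel e < L ∧ σ.G.srcLevel (σ.innerEdge e) = v + h.srcLevel e) ∨
    (h.srcLevel e = L ∧ v + L ≤ σ.G.srcLevel (σ.innerEdge e)) := by
  have := glueSrcLevel_inlB h e
  rwa [← σ.srcLevel_srcEquiv] at this

theorem tgtLevel_innerEdge_aux {e : h.Edge} {q} (hq : (g.gluing v h).b e = .inr q) :
    0 < h.tgtLevel e ∧ σ.G.tgtLevel (σ.innerEdge e) = v + h.tgtLevel e := by
  have := σ.isGlued.2 e q hq
  dsimp only at this
  rw [innerEdge, tgtLevel_srcEquiv, this]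
  exact glueTgtLevel_inr hq

theorem tgtLevel_outerEdge (e : g.Edge) :
    (g.tgtLevel e ≤ v ∧ σ.G.tgtLevel (σ.outerEdge e) = g.tgtLevel e) ∨
    (g.tgtLevel e = v + 1 ∧ v + 1 ≤ σ.G.tgtLevel (σ.outerEdge e) ∧
      σ.G.tgtLevel (σ.outerEdge e) ≤ v + L) ∨
    (v + 1 < g.tgtLevel e ∧ σ.G.tgtLevel (σ.outerEdge e) + 1 = g.tgtLevel e + L) := by
  rcases ht : (g.gluing v h).a ((flagSplit g.out v).symm e) with t | j
  · have h1 := glueTgtLevel_inl ht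
    rw [Equiv.apply_symm_apply, ← σ.isGlued.1 _ t ht, ← σ.tgtLevel_srcEquiv] at h1
    rcases h1 with h1 | h1
    · exact .inl h1
    · exact .inr (.inr h1)
  · have h1 := (g.gluing_a_iff v h _ _).1 ht
    rw [Equiv.apply_symm_apply] at h1
    rw [σ.outerEdge_eq_innerEdge h1, g.tgtLevel_of_wire h1]
    obtain ⟨q, hq⟩ := (g.gluing v h).exists_b j
    have h2 := σ.tgtLevel_innerEdge_aux hq
    have h3 := h.tgtLevel_le_srcLevel (.inl j)
    have h4 := h.srcLevel_le (.inl j)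
    omega

theorem tgtLevel_innerEdge (e : h.Edge) :
    (0 < h.tgtLevel e ∧ σ.G.tgtLevel (σ.innerEdge e) = v + h.tgtLevel e) ∨
    (h.tgtLevel e = 0 ∧ σ.G.tgtLevel (σ.innerEdge e) ≤ v) := by
  rcases hq : (g.gluing v h).b e with o | q
  · right
    refine ⟨?_, ?_⟩
    · unfold tgtLevel
      rw [show h.wire e = .inl o from hq]
      rfl
    · rw [σ.innerEdge_eq_outerEdge hq]
      have h1 := σ.tgtLevel_outerEdge (.inr ⟨v, o⟩)
      have h2 := g.tgtLevel_le_srcLevel (.inr ⟨v, o⟩)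
      have h3 : g.srcLevel (.inr ⟨v, o⟩) = v := rfl
      omega
  · exact .inl (σ.tgtLevel_innerEdge_aux hq)

/-- No edge of a reduced graph joins an input leg to an output leg. -/
theorem not_strand (e : h.Edge) : h.srcLevel e < L ∨ 0 < h.tgtLevel e := by
  rcases e with j | ⟨w, i⟩
  · right
    obtain ⟨q, hq⟩ := (g.gluing v h).exists_b j
    exact (glueTgtLevel_inr hq).1
  · exact .inl w.2

/-- An edge of the inserted graph comes from an edge of `g`, or from an edge of `h` between two
vertices of `h`. -/
theorem cases_edge (x : σ.G.Edge) : (∃ e, x = σ.outerEdge e) ∨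
    ∃ e, x = σ.innerEdge e ∧ h.srcLevel e < L ∧ 0 < h.tgtLevel e := by
  obtain ⟨z, rfl⟩ := σ.srcEquiv.surjective x
  rcases z with s | p
  · refine .inl ⟨flagSplit g.out v (.inl s), ?_⟩
    rw [outerEdge, Equiv.symm_apply_apply]
    rfl
  · rcases hq : (g.gluing v h).b (.inr p) with o | q
    · exact .inl ⟨_, σ.innerEdge_eq_outerEdge hq⟩
    · exact .inr ⟨.inr p, rfl, p.1.2, (glueTgtLevel_inr hq).1⟩

theorem exists_innerEdge_of_srcLevel {e : g.Edge} (he : g.srcLevel e = v) :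
    ∃ e', σ.outerEdge e = σ.innerEdge e' := by
  rcases e with i | ⟨u, i⟩
  · exact absurd he v.2.ne'
  · obtain rfl : u = v := Fin.ext he
    obtain ⟨p, hp⟩ := (g.gluing u h).exists_b_symm i
    exact ⟨.inr p, (σ.innerEdge_eq_outerEdge hp).symm⟩

theorem exists_innerEdge_of_tgtLevel {e : g.Edge} (he : g.tgtLevel e = v + 1) :
    ∃ e', σ.outerEdge e = σ.innerEdge e' := by
  unfold tgtLevel at he
  rcases hw : g.wire e with i | ⟨u, i⟩
  · rw [hw] at he
    exact absurd he (Nat.succ_ne_zero _).symm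
  · rw [hw] at he
    obtain rfl : u = v := Fin.ext (Nat.succ_injective he)
    exact ⟨_, σ.outerEdge_eq_innerEdge hw⟩

theorem exists_equiv_of_image {E E' : Type} {p : E → Prop} {q : E' → Prop} {f : E → E'}
    (hf : Function.Injective f) (h1 : ∀ e, p e → q (f e)) (h2 : ∀ x, q x → ∃ e, p e ∧ x = f e) :
    ∃ ξ : {e // p e} ≃ {x // q x}, ∀ e, (ξ e).1 = f e.1 :=
  ⟨Equiv.ofBijective (fun e => ⟨f e.1, h1 _ e.2⟩)
    ⟨fun _ _ he => Subtype.ext (hf (congrArg Subtype.val he)), fun x => by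
      obtain ⟨e, he, hx⟩ := h2 x.1 x.2
      exact ⟨⟨e, he⟩, Subtype.ext hx.symm⟩⟩, fun _ => rfl⟩

theorem exists_equiv_of_images {E₁ E₂ E' : Type} {p₁ : E₁ → Prop} {p₂ : E₂ → Prop} {q : E' → Prop}
    {f₁ : E₁ → E'} {f₂ : E₂ → E'} (hf₁ : Function.Injective f₁) (hf₂ : Function.Injective f₂)
    (hd : ∀ e₁ e₂, p₁ e₁ → p₂ e₂ → f₁ e₁ ≠ f₂ e₂)
    (h1 : ∀ e, p₁ e → q (f₁ e)) (h1' : ∀ e, p₂ e → q (f₂ e))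
    (h2 : ∀ x, q x → (∃ e, p₁ e ∧ x = f₁ e) ∨ ∃ e, p₂ e ∧ x = f₂ e) :
    ∃ ξ : {e // p₁ e} ⊕ {e // p₂ e} ≃ {x // q x},
      (∀ e, (ξ (.inl e)).1 = f₁ e.1) ∧ ∀ e, (ξ (.inr e)).1 = f₂ e.1 :=
  ⟨Equiv.ofBijective
    (Sum.elim (fun e => ⟨f₁ e.1, h1 _ e.2⟩) (fun e => ⟨f₂ e.1, h1' _ e.2⟩))
    ⟨by
      rintro (e | e) (e' | e') he <;> have he' := congrArg Subtype.val he
      · exact congrArg Sum.inl (Subtype.ext (hf₁ he'))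
      · exact absurd he' (hd _ _ e.2 e'.2)
      · exact absurd he'.symm (hd _ _ e'.2 e.2)
      · exact congrArg Sum.inr (Subtype.ext (hf₂ he')),
    fun x => by
      rcases h2 x.1 x.2 with ⟨e, he, hx⟩ | ⟨e, he, hx⟩
      · exact ⟨.inl ⟨e, he⟩, Subtype.ext hx.symm⟩
      · exact ⟨.inr ⟨e, he⟩, Subtype.ext hx.symm⟩⟩, fun _ => rfl, fun _ => rfl⟩

/-- Away from the inserted vertices, the levels of the inserted graph are those of the outer
graph. -/
theorem exists_cutEquiv {j j' : ℕ} (hj : (j = j' ∧ j ≤ v) ∨ (v + 1 ≤ j ∧ j' + 1 = j + L))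
    (hjK : j ≤ K) : ∃ ξ : g.Cut j ≃ σ.G.Cut j', ∀ x, (ξ x).1 = σ.outerEdge x.1 := by
  have hN := σ.N_eq
  have hv := v.2
  have hjN : j' ≤ σ.N := by omega
  refine exists_equiv_of_image σ.outerEdge_injective ?_ ?_
  · rintro e ⟨h1, h2⟩
    rw [startsAbove_iff _ hjK] at h1
    rw [endsBelow_iff] at h2
    rw [startsAbove_iff _ hjN, endsBelow_iff]
    have h3 := σ.srcLevel_outerEdge e
    have h4 := σ.tgtLevel_outerEdge e
    omega
  · rintro x ⟨h1, h2⟩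
    rw [startsAbove_iff _ hjN] at h1
    rw [endsBelow_iff] at h2
    rcases σ.cases_edge x with ⟨e, rfl⟩ | ⟨e, rfl, h3, h4⟩
    · refine ⟨e, ?_, rfl⟩
      rw [startsAbove_iff _ hjK, endsBelow_iff]
      have h3 := σ.srcLevel_outerEdge e
      have h4 := σ.tgtLevel_outerEdge e
      omega
    · have h5 := σ.srcLevel_innerEdge e
      have h6 := σ.tgtLevel_innerEdge e
      have h7 := h.tgtLevel_le_srcLevel e
      omega

theorem exists_throughEquiv (u : ({v}ᶜ : Set (Fin K))) :
    ∃ τ : g.Through u ≃ σ.G.Through (σ.vert (.inl u)), ∀ x, (τ x).1 = σ.outerEdge x.1 := by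
  have hu := insertPos_inl v L u
  rw [← σ.vert_val] at hu
  refine exists_equiv_of_image σ.outerEdge_injective ?_ ?_
  · rintro e ⟨h1, h2⟩
    rw [startsAbove_iff _ u.1.2] at h1
    rw [endsBelow_iff] at h2
    rw [startsAbove_iff _ (σ.vert (.inl u)).2, endsBelow_iff]
    have h3 := σ.srcLevel_outerEdge e
    have h4 := σ.tgtLevel_outerEdge e
    omega
  · rintro x ⟨h1, h2⟩
    rw [startsAbove_iff _ (σ.vert (.inl u)).2] at h1
    rw [endsBelow_iff] at h2
    rcases σ.cases_edge x with ⟨e, rfl⟩ | ⟨e, rfl, h3, h4⟩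
    · refine ⟨e, ?_, rfl⟩
      rw [startsAbove_iff _ u.1.2, endsBelow_iff]
      have h3 := σ.srcLevel_outerEdge e
      have h4 := σ.tgtLevel_outerEdge e
      omega
    · have h5 := σ.srcLevel_innerEdge e
      have h6 := σ.tgtLevel_innerEdge e
      have h7 := h.tgtLevel_le_srcLevel e
      omega

theorem innerEdge_ne_outerEdge {e : h.Edge} {e' : g.Edge} (h1 : g.StartsAbove (v + 1) e')
    (h2 : g.EndsBelow v e') : σ.innerEdge e ≠ σ.outerEdge e' := by
  intro he
  rw [startsAbove_iff _ v.2] at h1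
  rw [endsBelow_iff] at h2
  have h3 := σ.srcLevel_outerEdge e'
  have h4 := σ.tgtLevel_outerEdge e'
  have h5 := σ.srcLevel_innerEdge e
  have h6 := σ.tgtLevel_innerEdge e
  have h7 := not_strand e
  rw [he] at h5 h6
  omega

/-- At the height of the inserted vertices, the levels of the inserted graph are those of the
inner graph together with the edges of the outer graph passing by the vertex. -/
theorem exists_innerCutEquiv {i j' : ℕ} (hi : i ≤ L) (hj' : j' = v + i) :
    ∃ ζ : h.Cut i ⊕ g.Through v ≃ σ.G.Cut j',
      (∀ x, (ζ (.inl x)).1 = σ.innerEdge x.1) ∧ ∀ x, (ζ (.inr x)).1 = σ.outerEdge x.1 := by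
  have hN := σ.N_eq
  have hv := v.2
  have hjN : j' ≤ σ.N := by omega
  refine exists_equiv_of_images σ.innerEdge_injective σ.outerEdge_injective
    (fun e₁ e₂ _ h2 => σ.innerEdge_ne_outerEdge h2.1 h2.2) ?_ ?_ ?_
  · rintro e ⟨h1, h2⟩
    rw [startsAbove_iff _ hi] at h1
    rw [endsBelow_iff] at h2
    rw [startsAbove_iff _ hjN, endsBelow_iff]
    have h3 := σ.srcLevel_innerEdge e
    have h4 := σ.tgtLevel_innerEdge e
    omega
  · rintro e ⟨h1, h2⟩
    rw [startsAbove_iff _ v.2] at h1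
    rw [endsBelow_iff] at h2
    rw [startsAbove_iff _ hjN, endsBelow_iff]
    have h3 := σ.srcLevel_outerEdge e
    have h4 := σ.tgtLevel_outerEdge e
    omega
  · rintro x ⟨h1, h2⟩
    rw [startsAbove_iff _ hjN] at h1
    rw [endsBelow_iff] at h2
    have key : ∀ e, σ.innerEdge e = x → ∃ e, (h.StartsAbove i e ∧ h.EndsBelow i e) ∧
        x = σ.innerEdge e := by
      rintro e rfl
      refine ⟨e, ?_, rfl⟩
      rw [startsAbove_iff _ hi, endsBelow_iff]
      have h3 := σ.srcLevel_innerEdge e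
      have h4 := σ.tgtLevel_innerEdge e
      omega
    rcases σ.cases_edge x with ⟨e, rfl⟩ | ⟨e, rfl, h3, h4⟩
    · by_cases c1 : g.srcLevel e = v
      · obtain ⟨e', he'⟩ := σ.exists_innerEdge_of_srcLevel c1
        exact .inl (key e' he'.symm)
      · by_cases c2 : g.tgtLevel e = v + 1
        · obtain ⟨e', he'⟩ := σ.exists_innerEdge_of_tgtLevel c2
          exact .inl (key e' he'.symm)
        · refine .inr ⟨e, ?_, rfl⟩
          rw [startsAbove_iff _ v.2, endsBelow_iff]
          have h3 := σ.srcLevel_outerEdge e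
          have h4 := σ.tgtLevel_outerEdge e
          omega
    · exact .inl (key e rfl)

theorem exists_innerThroughEquiv (w : Fin L) :
    ∃ τ : h.Through w ⊕ g.Through v ≃ σ.G.Through (σ.vert (.inr w)),
      (∀ x, (τ (.inl x)).1 = σ.innerEdge x.1) ∧ ∀ x, (τ (.inr x)).1 = σ.outerEdge x.1 := by
  have hN := σ.N_eq
  have hv := v.2
  have hw := insertPos_inr v w
  rw [← σ.vert_val] at hw
  have hw' := w.2
  have hjN := (σ.vert (.inr w)).2
  refine exists_equiv_of_images σ.innerEdge_injective σ.outerEdge_injective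
    (fun e₁ e₂ _ h2 => σ.innerEdge_ne_outerEdge h2.1 h2.2) ?_ ?_ ?_
  · rintro e ⟨h1, h2⟩
    rw [startsAbove_iff _ w.2] at h1
    rw [endsBelow_iff] at h2
    rw [startsAbove_iff _ hjN, endsBelow_iff]
    have h3 := σ.srcLevel_innerEdge e
    have h4 := σ.tgtLevel_innerEdge e
    omega
  · rintro e ⟨h1, h2⟩
    rw [startsAbove_iff _ v.2] at h1
    rw [endsBelow_iff] at h2
    rw [startsAbove_iff _ hjN, endsBelow_iff]
    have h3 := σ.srcLevel_outerEdge e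
    have h4 := σ.tgtLevel_outerEdge e
    omega
  · rintro x ⟨h1, h2⟩
    rw [startsAbove_iff _ hjN] at h1
    rw [endsBelow_iff] at h2
    have key : ∀ e, σ.innerEdge e = x → ∃ e, (h.StartsAbove (w + 1) e ∧ h.EndsBelow w e) ∧
        x = σ.innerEdge e := by
      rintro e rfl
      refine ⟨e, ?_, rfl⟩
      rw [startsAbove_iff _ w.2, endsBelow_iff]
      have h3 := σ.srcLevel_innerEdge e
      have h4 := σ.tgtLevel_innerEdge e
      omega
    rcases σ.cases_edge x with ⟨e, rfl⟩ | ⟨e, rfl, h3, h4⟩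
    · by_cases c1 : g.srcLevel e = v
      · obtain ⟨e', he'⟩ := σ.exists_innerEdge_of_srcLevel c1
        exact .inl (key e' he'.symm)
      · by_cases c2 : g.tgtLevel e = v + 1
        · obtain ⟨e', he'⟩ := σ.exists_innerEdge_of_tgtLevel c2
          exact .inl (key e' he'.symm)
        · refine .inr ⟨e, ?_, rfl⟩
          rw [startsAbove_iff _ v.2, endsBelow_iff]
          have h3 := σ.srcLevel_outerEdge e
          have h4 := σ.tgtLevel_outerEdge e
          omega
    · exact .inl (key e rfl)

end Edges

end Graph.Insertion

namespace Graph.Insertion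

variable {k : Type uk} [Field k] [CharZero k] {X : Type ua} [AddCommGroup X] [Module k X]
  {s : X →ₗ[k] X}
  {K L m n : ℕ} {g : Graph K m n} {v : Fin K} {h : Graph L (g.out v) (g.inn v)}
  (σ : g.Insertion v h)

section

omit [CharZero k]

/-- The ordering of the edges of the inner graph crossing a level, followed by the edges of the
outer graph passing by the vertex. -/
def innerRank (v : Fin K) (h : Graph L (g.out v) (g.inn v)) (i : ℕ) :
    h.Cut i ⊕ g.Through v → ℕ :=
  Sum.elim (h.cutRank i) (fun t => g.inn v + ∑ w, h.out w + g.throughRank v t)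

/-- The ordering of the edges of the inner graph passing by a vertex, followed by the edges of the
outer graph passing by the vertex. -/
def innerThroughRank (v : Fin K) (h : Graph L (g.out v) (g.inn v)) (w : Fin L) :
    h.Through w ⊕ g.Through v → ℕ :=
  Sum.elim (h.throughRank w) (fun t => g.inn v + ∑ w, h.out w + g.throughRank v t)

theorem edgeRank_lt (e : g.Edge) : g.edgeRank e < n + ∑ u, g.out u := by
  rcases e with i | x
  · simp only [edgeRank, Sum.elim_inl]
    omega
  · simp only [edgeRank, Sum.elim_inr]
    exact Nat.add_lt_add_left (finSigmaFinEquiv x).2 _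

theorem sumRank_injective {I J : Type} {r : I → ℕ} {t : J → ℕ} {B : ℕ} (hr : r.Injective)
    (ht : t.Injective) (hB : ∀ i, r i < B) : (Sum.elim r (fun j => B + t j)).Injective := by
  rintro (i | i) (j | j) hij <;> simp only [Sum.elim_inl, Sum.elim_inr] at hij
  · rw [hr hij]
  · have := hB i; omega
  · have := hB j; omega
  · rw [ht (Nat.add_left_cancel hij)]

theorem innerRank_injective (i : ℕ) : (innerRank v h i).Injective :=
  sumRank_injective (h.cutRank_injective i) (g.throughRank_injective v) fun x => edgeRank_lt x.1

theorem innerThroughRank_injective (w : Fin L) : (innerThroughRank v h w).Injective :=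
  sumRank_injective (h.throughRank_injective w) (g.throughRank_injective v)
    fun x => edgeRank_lt x.1

theorem innerRank_lt (i : ℕ) (x : h.Cut i) (t : g.Through v) :
    innerRank v h i (.inl x) < innerRank v h i (.inr t) :=
  lt_of_lt_of_le (edgeRank_lt (g := h) x.1) (Nat.le_add_right _ _)

theorem innerThroughRank_lt (w : Fin L) (x : h.Through w) (t : g.Through v) :
    innerThroughRank v h w (.inl x) < innerThroughRank v h w (.inr t) :=
  lt_of_lt_of_le (edgeRank_lt (g := h) x.1) (Nat.le_add_right _ _)

end

/-- Passing a vertex of `g` other than `v` is the same in `g` and in the inserted graph, up to the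
identification of the edges which cross the levels. -/
theorem step_outer (hs : ∀ x, s (s x) = x) (u : ({v}ᶜ : Set (Fin K)))
    {x : Fin σ.N} (hx : x = σ.vert (.inl u)) (ξ : g.Cut (u + 1) ≃ σ.G.Cut (x + 1))
    (ξ' : g.Cut u ≃ σ.G.Cut x) (hξ : ∀ y, (ξ y).1 = σ.outerEdge y.1)
    (hξ' : ∀ y, (ξ' y).1 = σ.outerEdge y.1)
    (φ : (⨂[k] _ : Fin (g.inn u), X) →ₗ[k] (⨂[k] _ : Fin (g.out u), X))
    (Φ : (⨂[k] _ : Fin (σ.G.inn x), X) →ₗ[k] (⨂[k] _ : Fin (σ.G.out x), X))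
    (hΦ : Φ = castOp ((σ.inn_eq (.inl u)).trans (by rw [hx]))
      ((σ.out_eq (.inl u)).trans (by rw [hx])) φ) :
    koszulPerm s (g.cutRank u) (σ.G.cutRank x) ξ' ∘ₗ g.step s u φ =
      σ.G.step s x Φ ∘ₗ koszulPerm s (g.cutRank (u + 1)) (σ.G.cutRank (x + 1)) ξ := by
  subst hx hΦ
  obtain ⟨τ, hτ⟩ := σ.exists_throughEquiv u
  rw [step_eq_opStep, step_eq_opStep]
  refine koszulPerm_opStep hs _ _ (g.cutRank_injective _) (g.throughRank_injective _)
    (g.cutRank_injective _) (σ.G.cutRank_injective _) (σ.G.throughRank_injective _)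
    (σ.G.cutRank_injective _) ξ ξ' τ ?_ ?_ ?_ ?_ φ
  · intro i
    refine Subtype.ext ((hξ _).trans ?_)
    change σ.outerEdge (g.wire.symm (.inr ⟨u, i⟩)) =
      σ.G.wire.symm (.inr ⟨_, Fin.cast (σ.inn_eq (.inl u)) i⟩)
    rw [Equiv.eq_symm_apply, σ.wire_outerEdge (Equiv.apply_symm_apply _ _)]
  · intro t
    exact Subtype.ext ((hξ _).trans (hτ t).symm)
  · intro i
    refine Subtype.ext ((hξ' _).trans ?_)
    exact σ.outerEdge_flag u i
  · intro t
    exact Subtype.ext ((hξ' _).trans (hτ t).symm)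

/-- Passing a vertex of `h` in the inserted graph is passing it in `h`, next to the edges of `g`
which pass by `v`. -/
theorem step_inner (hs : ∀ x, s (s x) = x) (w : Fin L)
    {x : Fin σ.N} (hx : x = σ.vert (.inr w)) (ζ : h.Cut (w + 1) ⊕ g.Through v ≃ σ.G.Cut (x + 1))
    (ζ' : h.Cut w ⊕ g.Through v ≃ σ.G.Cut x)
    (hζ : (∀ y, (ζ (.inl y)).1 = σ.innerEdge y.1) ∧ ∀ y, (ζ (.inr y)).1 = σ.outerEdge y.1)
    (hζ' : (∀ y, (ζ' (.inl y)).1 = σ.innerEdge y.1) ∧ ∀ y, (ζ' (.inr y)).1 = σ.outerEdge y.1)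
    (ψ : (⨂[k] _ : Fin (h.inn w), X) →ₗ[k] (⨂[k] _ : Fin (h.out w), X))
    (Φ : (⨂[k] _ : Fin (σ.G.inn x), X) →ₗ[k] (⨂[k] _ : Fin (σ.G.out x), X))
    (hΦ : Φ = castOp ((σ.inn_eq (.inr w)).trans (by rw [hx]))
      ((σ.out_eq (.inr w)).trans (by rw [hx])) ψ) :
    koszulPerm s (innerRank v h w) (σ.G.cutRank x) ζ' ∘ₗ blockMap (g.Through v) (h.step s w ψ) =
      σ.G.step s x Φ ∘ₗ koszulPerm s (innerRank v h (w + 1)) (σ.G.cutRank (x + 1)) ζ := by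
  subst hx hΦ
  obtain ⟨τ, hτ, hτ'⟩ := σ.exists_innerThroughEquiv w
  have hblock := opStep_blockMap hs (innerRank_injective (v := v) (h := h) (w + 1))
    (innerRank_injective (v := v) (h := h) w) (innerThroughRank_injective (v := v) w)
    (innerRank_lt _) (innerRank_lt _) (innerThroughRank_lt w) (fun _ _ => Iff.rfl)
    (fun _ _ => Iff.rfl) (h.inEquiv w) (h.outEquiv w) ψ
  have hstep : h.step s w ψ = opStep s (innerRank v h (w + 1) ∘ Sum.inl)
      (innerThroughRank v h w ∘ Sum.inl) (innerRank v h w ∘ Sum.inl) (h.inEquiv w)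
      (h.outEquiv w) ψ := rfl
  rw [hstep, ← hblock, step_eq_opStep]
  refine koszulPerm_opStep hs (σ.inn_eq (.inr w)) (σ.out_eq (.inr w)) (innerRank_injective _)
    (innerThroughRank_injective _)
    (innerRank_injective _) (σ.G.cutRank_injective _) (σ.G.throughRank_injective _)
    (σ.G.cutRank_injective _) ζ ζ' τ ?_ ?_ ?_ ?_ ψ
  · intro i
    refine Subtype.ext ((hζ.1 _).trans ?_)
    change σ.innerEdge (h.wire.symm (.inr ⟨w, i⟩)) =
      σ.G.wire.symm (.inr ⟨_, Fin.cast (σ.inn_eq (.inr w)) i⟩)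
    rw [Equiv.eq_symm_apply]
    exact σ.wire_innerEdge (w := w) (j := i) (Equiv.apply_symm_apply _ _)
  · rintro (t | t)
    · exact Subtype.ext ((hζ.1 _).trans (hτ t).symm)
    · exact Subtype.ext ((hζ.2 _).trans (hτ' t).symm)
  · intro i
    exact Subtype.ext ((hζ'.1 _).trans (σ.innerEdge_flag w i))
  · rintro (t | t)
    · exact Subtype.ext ((hζ'.1 _).trans (hτ t).symm)
    · exact Subtype.ext ((hζ'.2 _).trans (hτ' t).symm)

variable (φ : ∀ u, (⨂[k] _ : Fin (g.inn u), X) →ₗ[k] (⨂[k] _ : Fin (g.out u), X))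
  (ψ : ∀ w, (⨂[k] _ : Fin (h.inn w), X) →ₗ[k] (⨂[k] _ : Fin (h.out w), X))
  (Φ : ∀ x, (⨂[k] _ : Fin (σ.G.inn x), X) →ₗ[k] (⨂[k] _ : Fin (σ.G.out x), X))

section Induction

variable (hs : ∀ x, s (s x) = x)
  (hφ : ∀ u : ({v}ᶜ : Set (Fin K)), Φ (σ.vert (.inl u)) =
    castOp (σ.inn_eq (.inl u)) (σ.out_eq (.inl u)) (φ u))
  (hψ : ∀ w, Φ (σ.vert (.inr w)) = castOp (σ.inn_eq (.inr w)) (σ.out_eq (.inr w)) (ψ w))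
  (ξ₀ : g.Cut 0 ≃ σ.G.Cut 0) (hξ₀ : ∀ y, (ξ₀ y).1 = σ.outerEdge y.1)

omit [CharZero k] in
include hφ in
theorem apply_eq_castOp_outer {x : Fin σ.N} {u : ({v}ᶜ : Set (Fin K))}
    (hx : x = σ.vert (.inl u)) : Φ x = castOp ((σ.inn_eq (.inl u)).trans (by rw [hx]))
      ((σ.out_eq (.inl u)).trans (by rw [hx])) (φ u) := by
  subst hx
  exact hφ u

omit [CharZero k] in
include hψ in
theorem apply_eq_castOp_inner {x : Fin σ.N} {w : Fin L}
    (hx : x = σ.vert (.inr w)) : Φ x = castOp ((σ.inn_eq (.inr w)).trans (by rw [hx]))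
      ((σ.out_eq (.inr w)).trans (by rw [hx])) (ψ w) := by
  subst hx
  exact hψ w

include hs

include hφ hξ₀ in
/-- Below the vertex `v`, the composites along `g` and along the inserted graph agree. -/
theorem compBelow_low (j : ℕ) (hj : j ≤ v) (hjK : j ≤ K) (hjN : j ≤ σ.N)
    (ξ : g.Cut j ≃ σ.G.Cut j) (hξ : ∀ y, (ξ y).1 = σ.outerEdge y.1) :
    koszulPerm s (g.cutRank 0) (σ.G.cutRank 0) ξ₀ ∘ₗ g.compBelow s φ j hjK =
      σ.G.compBelow s Φ j hjN ∘ₗ koszulPerm s (g.cutRank j) (σ.G.cutRank j) ξ := by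
  induction j with
  | zero =>
    obtain rfl : ξ = ξ₀ := Equiv.ext fun y => Subtype.ext ((hξ y).trans (hξ₀ y).symm)
    rfl
  | succ j ih =>
    obtain ⟨ξ', hξ'⟩ := σ.exists_cutEquiv (j := j) (j' := j) (.inl ⟨rfl, by omega⟩) (by omega)
    have hne : (⟨j, hjK⟩ : Fin K) ∈ ({v}ᶜ : Set (Fin K)) := fun e => by
      have := congrArg Fin.val e
      simp only at this
      omega
    have hx : (⟨j, hjN⟩ : Fin σ.N) = σ.vert (.inl ⟨⟨j, hjK⟩, hne⟩) := Fin.ext (by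
      have := insertPos_inl v L ⟨⟨j, hjK⟩, hne⟩
      rw [σ.vert_val]
      simp only at this ⊢
      omega)
    rw [compBelow, compBelow, ← LinearMap.comp_assoc,
      ih (by omega) (by omega) (by omega) ξ' hξ', LinearMap.comp_assoc, LinearMap.comp_assoc]
    congr 1
    exact σ.step_outer hs ⟨⟨j, hjK⟩, hne⟩ hx ξ ξ' hξ hξ' _ _
      (σ.apply_eq_castOp_outer φ Φ hφ hx)

include hφ hψ hξ₀ in
/-- At the levels of the vertices of `h`, the composite along the inserted graph is the composite
along `g` below `v` applied after the partial composite along `h`, placed next to the edges of `g`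
which pass by `v`. -/
theorem compBelow_mid (i : ℕ) (hi : i ≤ L) (hiN : v + i ≤ σ.N)
    (ζ : h.Cut i ⊕ g.Through v ≃ σ.G.Cut (v + i))
    (hζ : (∀ y, (ζ (.inl y)).1 = σ.innerEdge y.1) ∧ ∀ y, (ζ (.inr y)).1 = σ.outerEdge y.1) :
    koszulPerm s (g.cutRank 0) (σ.G.cutRank 0) ξ₀ ∘ₗ g.compBelow s φ v v.2.le ∘ₗ
        koszulPerm s (blockRank (g.out v) (g.throughRank v)) (g.cutRank v) (g.outEquiv v) ∘ₗ
        blockMap (g.Through v)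
          (koszulPerm s (h.cutRank 0) (fun i : Fin (g.out v) => (i : ℕ)) h.botEquiv.symm ∘ₗ
            h.compBelow s ψ i hi) =
      σ.G.compBelow s Φ (v + i) hiN ∘ₗ
        koszulPerm s (innerRank v h i) (σ.G.cutRank (v + i)) ζ := by
  induction i with
  | zero =>
    obtain ⟨ξ', hξ'⟩ := σ.exists_cutEquiv (j := v) (j' := v) (.inl ⟨rfl, le_rfl⟩) v.2.le
    have h1 : blockMap (g.Through v)
        (koszulPerm s (h.cutRank 0) (fun i : Fin (g.out v) => (i : ℕ)) h.botEquiv.symm) =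
        koszulPerm s (innerRank v h 0) (blockRank (g.out v) (g.throughRank v))
          (Equiv.sumCongr h.botEquiv.symm (Equiv.refl _)) := by
      rw [koszulPerm_sumCongr hs _ _ (innerRank_lt 0) (blockRank_lt _ _),
        koszulPerm_refl hs (by simp [innerRank, blockRank])]
      rfl
    have h2 : ((Equiv.sumCongr h.botEquiv.symm (Equiv.refl _)).trans (g.outEquiv v)).trans ξ' =
        ζ := by
      refine Equiv.ext fun y => ?_
      rcases y with y | y
      · refine Subtype.ext (Eq.trans ?_ (hζ.1 y).symm)
        obtain ⟨o, rfl⟩ := h.botEquiv.surjective y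
        simp only [Equiv.trans_apply, Equiv.sumCongr_apply, Sum.map_inl, Equiv.symm_apply_apply]
        rw [hξ']
        exact (σ.innerEdge_eq_outerEdge (Equiv.apply_symm_apply _ _)).symm
      · exact Subtype.ext ((hξ' _).trans (hζ.2 y).symm)
    have h3 : h.compBelow s ψ 0 hi = LinearMap.id := rfl
    have low := σ.compBelow_low φ Φ hs hφ ξ₀ hξ₀ v le_rfl v.2.le hiN ξ' hξ'
    rw [h3, LinearMap.comp_id, h1, koszulPerm_comp hs (innerRank_injective _)
      (blockRank_injective _ (g.throughRank_injective v)) (g.cutRank_injective _),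
      ← LinearMap.comp_assoc, low, LinearMap.comp_assoc, koszulPerm_comp hs
      (innerRank_injective _) (g.cutRank_injective _) (σ.G.cutRank_injective _), h2]
    rfl
  | succ i ih =>
    obtain ⟨ζ', hζ'⟩ := σ.exists_innerCutEquiv (i := i) (j' := v + i) (by omega) rfl
    have hx : (⟨v + i, hiN⟩ : Fin σ.N) = σ.vert (.inr ⟨i, hi⟩) := Fin.ext (by
      rw [σ.vert_val]
      rfl)
    have hst := σ.step_inner hs ⟨i, hi⟩ hx ζ ζ' hζ hζ' _ _
      (σ.apply_eq_castOp_inner ψ Φ hψ hx)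
    have hc : h.compBelow s ψ (i + 1) hi =
      h.compBelow s ψ i (Nat.le_of_succ_le hi) ∘ₗ h.step s ⟨i, hi⟩ (ψ ⟨i, hi⟩) := rfl
    have hc' : σ.G.compBelow s Φ (v + (i + 1)) hiN = σ.G.compBelow s Φ (v + i)
      (Nat.le_of_succ_le hiN) ∘ₗ σ.G.step s ⟨v + i, hiN⟩ (Φ ⟨v + i, hiN⟩) := rfl
    have ih' := congrArg (· ∘ₗ blockMap (g.Through v) (h.step s ⟨i, hi⟩ (ψ ⟨i, hi⟩)))
      (ih (Nat.le_of_succ_le hi) (Nat.le_of_succ_le hiN) ζ' hζ')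
    simp only [LinearMap.comp_assoc, ← blockMap_comp] at ih'
    rw [hc, ih', hc', LinearMap.comp_assoc]
    congr 1

include hφ hψ hξ₀ in
/-- Above the vertex `v`, which carries the composite along `h`, the composites along `g` and along
the inserted graph agree; the levels are shifted by `L - 1`. -/
theorem compBelow_high (hv : φ v = h.compFun s ψ) (j : ℕ) (hj : v + 1 ≤ j) (hjK : j ≤ K) :
    ∀ (j' : ℕ) (_ : j' + 1 = j + L) (hjN : j' ≤ σ.N)
      (ξ : g.Cut j ≃ σ.G.Cut j') (_ : ∀ y, (ξ y).1 = σ.outerEdge y.1),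
    koszulPerm s (g.cutRank 0) (σ.G.cutRank 0) ξ₀ ∘ₗ g.compBelow s φ j hjK =
      σ.G.compBelow s Φ j' hjN ∘ₗ koszulPerm s (g.cutRank j) (σ.G.cutRank j') ξ := by
  induction j, hj using Nat.le_induction with
  | base =>
    intro j' hj' hjN ξ hξ
    obtain rfl : j' = v + L := by omega
    obtain ⟨ζ, hζ⟩ := σ.exists_innerCutEquiv (i := L) (j' := v + L) le_rfl rfl
    have mid := σ.compBelow_mid φ ψ Φ hs hφ hψ ξ₀ hξ₀ L le_rfl hjN ζ hζ
    have h1 : blockMap (g.Through v)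
        (koszulPerm s (fun i : Fin (g.inn v) => (i : ℕ)) (h.cutRank L) h.topEquiv) =
        koszulPerm s (blockRank (g.inn v) (g.throughRank v)) (innerRank v h L)
          (Equiv.sumCongr h.topEquiv (Equiv.refl _)) := by
      rw [koszulPerm_sumCongr hs _ _ (blockRank_lt _ _) (innerRank_lt L),
        koszulPerm_refl hs (by simp [innerRank, blockRank])]
      rfl
    have h2 : ((g.inEquiv v).symm.trans (Equiv.sumCongr h.topEquiv (Equiv.refl _))).trans ζ =
        ξ := by
      refine Equiv.ext fun y => ?_
      obtain ⟨y, rfl⟩ := (g.inEquiv v).surjective y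
      refine Subtype.ext (Eq.trans ?_ (hξ _).symm)
      simp only [Equiv.trans_apply, Equiv.symm_apply_apply]
      rcases y with y | y
      · exact (hζ.1 _).trans (σ.outerEdge_eq_innerEdge (Equiv.apply_symm_apply _ _)).symm
      · exact hζ.2 y
    have mid' := congrArg (· ∘ₗ (blockMap (g.Through v)
        (koszulPerm s (fun i : Fin (g.inn v) => (i : ℕ)) (h.cutRank L) h.topEquiv) ∘ₗ
      koszulPerm s (g.cutRank (v + 1)) (blockRank (g.inn v) (g.throughRank v))
        (g.inEquiv v).symm)) mid
    simp only [LinearMap.comp_assoc] at mid'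
    rw [← LinearMap.comp_assoc _ (blockMap (g.Through v) _) (blockMap (g.Through v) _),
      ← blockMap_comp, LinearMap.comp_assoc, ← compFun_eq, h1,
      koszulPerm_comp hs (g.cutRank_injective _)
        (blockRank_injective _ (g.throughRank_injective v)) (innerRank_injective _),
      koszulPerm_comp hs (g.cutRank_injective _) (innerRank_injective _)
        (σ.G.cutRank_injective _), h2, ← hv] at mid'
    exact mid'
  | succ j hj ih =>
    intro j' hj' hjN ξ hξ
    have hL := h.nonempty
    obtain ⟨i, rfl⟩ : ∃ i, j' = i + 1 := ⟨j' - 1, by omega⟩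
    obtain ⟨ξ', hξ'⟩ := σ.exists_cutEquiv (j := j) (j' := i) (.inr ⟨hj, by omega⟩) (by omega)
    have hne : (⟨j, hjK⟩ : Fin K) ∈ ({v}ᶜ : Set (Fin K)) := fun e => by
      have := congrArg Fin.val e
      simp only at this
      omega
    have hx : (⟨i, hjN⟩ : Fin σ.N) = σ.vert (.inl ⟨⟨j, hjK⟩, hne⟩) := Fin.ext (by
      have := insertPos_inl v L ⟨⟨j, hjK⟩, hne⟩
      rw [σ.vert_val]
      simp only at this ⊢
      omega)
    rw [compBelow, compBelow, ← LinearMap.comp_assoc,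
      ih (by omega) i (by omega) (by omega) ξ' hξ', LinearMap.comp_assoc, LinearMap.comp_assoc]
    congr 1
    exact σ.step_outer hs ⟨⟨j, hjK⟩, hne⟩ hx ξ ξ' hξ hξ' _ _
      (σ.apply_eq_castOp_outer φ Φ hφ hx)

end Induction

/-- Composition along graphs is associative: composing along an inserted graph amounts to
composing first along the inner graph and then along the outer graph. -/
theorem compFun_G (hs : ∀ x, s (s x) = x)
    (hφ : ∀ u : ({v}ᶜ : Set (Fin K)), Φ (σ.vert (.inl u)) =
      castOp (σ.inn_eq (.inl u)) (σ.out_eq (.inl u)) (φ u))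
    (hψ : ∀ w, Φ (σ.vert (.inr w)) = castOp (σ.inn_eq (.inr w)) (σ.out_eq (.inr w)) (ψ w))
    (hv : φ v = h.compFun s ψ) : σ.G.compFun s Φ = g.compFun s φ := by
  have hN := σ.N_eq
  have hvK := v.2
  obtain ⟨ξ₀, hξ₀⟩ := σ.exists_cutEquiv (j := 0) (j' := 0) (.inl ⟨rfl, Nat.zero_le _⟩)
    (Nat.zero_le _)
  obtain ⟨ξ₁, hξ₁⟩ := σ.exists_cutEquiv (j := K) (j' := σ.N) (.inr ⟨hvK, by omega⟩) le_rfl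
  have key := σ.compBelow_high φ ψ Φ hs hφ hψ ξ₀ hξ₀ hv K hvK le_rfl σ.N (by omega) le_rfl ξ₁ hξ₁
  have h0 : ξ₀.trans σ.G.botEquiv.symm = g.botEquiv.symm := by
    refine Equiv.ext fun y => ?_
    obtain ⟨i, rfl⟩ := g.botEquiv.surjective y
    rw [Equiv.trans_apply, Equiv.symm_apply_apply, Equiv.symm_apply_eq]
    refine Subtype.ext ((hξ₀ _).trans ?_)
    change σ.outerEdge (g.wire.symm (.inl i)) = σ.G.wire.symm (.inl i)
    rw [Equiv.eq_symm_apply, σ.wire_outerEdge_leg (Equiv.apply_symm_apply _ _)]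
  have h1 : g.topEquiv.trans ξ₁ = σ.G.topEquiv :=
    Equiv.ext fun i => Subtype.ext ((hξ₁ _).trans (σ.outerEdge_leg i))
  rw [compFun_eq, compFun_eq, ← h0, ← h1, ← koszulPerm_comp hs (g.cutRank_injective _)
    (σ.G.cutRank_injective _) Fin.val_injective, ← koszulPerm_comp hs Fin.val_injective
    (g.cutRank_injective _) (σ.G.cutRank_injective _), ← LinearMap.comp_assoc _ _
    (σ.G.compBelow s Φ σ.N le_rfl), ← key]
  simp only [LinearMap.comp_assoc]

end Graph.Insertion

/-! ### Degrees and parities -/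

section Degrees

variable {k : Type uk} [Field k]

theorem sgn_add (a b : ℤ) : sgn k (a + b) = sgn k a * sgn k b := by
  by_cases ha : Even a <;> by_cases hb : Even b <;> simp [sgn, Int.even_add, ha, hb]

theorem sgn_mul_self (a : ℤ) : sgn k a * sgn k a = 1 := by
  unfold sgn
  split_ifs <;> simp

theorem sgn_zero : sgn k 0 = 1 := by simp [sgn]

theorem sgn_neg_one : sgn k (-1) = -1 := by simp [sgn]

theorem sgn_sum {ι : Type*} (t : Finset ι) (δ : ι → ℤ) :
    sgn k (∑ i ∈ t, δ i) = ∏ i ∈ t, sgn k (δ i) := by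
  classical
  induction t using Finset.induction_on with
  | empty => simp [sgn]
  | insert a t ha ih => rw [Finset.sum_insert ha, Finset.prod_insert ha, sgn_add, ih]

namespace DGModule

variable (V : DGModule.{uk, ua} k)

theorem inv_of_mem {p : ℤ} {x : V.carrier} (hx : x ∈ V.gr p) : V.inv x = sgn k p • x := by
  have h : (LinearEquiv.ofBijective (DirectSum.coeLinearMap V.gr) V.internal).symm x =
      DirectSum.lof k ℤ (fun p => V.gr p) p ⟨x, hx⟩ := by
    rw [LinearEquiv.symm_apply_eq]
    exact (DirectSum.coeLinearMap_lof V.gr p ⟨x, hx⟩).symm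
  simp only [inv, LinearMap.comp_apply, LinearEquiv.coe_coe, h, DirectSum.toModule_lof]
  rfl

theorem span_homogeneous : Submodule.span k {x | ∃ p, x ∈ V.gr p} = ⊤ := by
  rw [eq_top_iff, ← V.internal.submodule_iSup_eq_top]
  exact iSup_le fun p x hx => Submodule.subset_span ⟨p, hx⟩

/-- Linear maps agree as soon as they agree on homogeneous elements. -/
theorem ext_homogeneous {W : Type*} [AddCommGroup W] [Module k W] {f f' : V.carrier →ₗ[k] W}
    (h : ∀ p, ∀ x ∈ V.gr p, f x = f' x) : f = f' :=
  LinearMap.ext_on V.span_homogeneous fun x ⟨p, hx⟩ => h p x hx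

theorem inv_inv (x : V.carrier) : V.inv (V.inv x) = x := by
  have : V.inv ∘ₗ V.inv = LinearMap.id := V.ext_homogeneous fun p x hx => by
    rw [LinearMap.comp_apply, V.inv_of_mem hx, map_smul, V.inv_of_mem hx, smul_smul,
      sgn_mul_self, one_smul, LinearMap.id_apply]
  exact LinearMap.ext_iff.1 this x

theorem inv_d (x : V.carrier) : V.inv (V.d x) = -V.d (V.inv x) := by
  have : V.inv ∘ₗ V.d = -(V.d ∘ₗ V.inv) := V.ext_homogeneous fun p x hx => by
    rw [LinearMap.comp_apply, LinearMap.neg_apply, LinearMap.comp_apply, V.inv_of_mem hx,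
      V.inv_of_mem (V.d_mem p x hx), map_smul, sub_eq_add_neg, sgn_add, sgn_neg_one, mul_neg_one,
      neg_smul]
  exact LinearMap.ext_iff.1 this x

end DGModule

variable {A : DGModule.{uk, ua} k}

theorem diagMap_of_mem_tensorGr {n : ℕ} {q : ℤ} {t : TPow A n}
    (ht : t ∈ tensorGr (fun _ : Fin n => A) q) : diagMap A.inv (Fin n) t = sgn k q • t := by
  induction ht using Submodule.span_induction with
  | mem t ht =>
    obtain ⟨δ, x, hx, rfl, rfl⟩ := ht
    rw [PiTensorProduct.map_tprod, sgn_sum, ← MultilinearMap.map_smul_univ]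
    congr 1
    funext i
    exact A.inv_of_mem (hx i)
  | zero => simp
  | add x y _ _ hx hy => rw [map_add, hx, hy, smul_add]
  | smul c x _ hx => rw [map_smul, hx, smul_comm]

/-- Conjugating an operation of degree `p` by the parity involutions multiplies it
by `(-1) ^ p`. -/
theorem HasDegree.conjOp_eq {m n : ℕ} {p : ℤ} {φ : EndHom A A m n} (hφ : HasDegree p φ) :
    conjOp A.inv φ = sgn k p • φ := by
  refine piTensor_ext_of_span (fun _ => {x | ∃ p, x ∈ A.gr p}) (fun _ => A.span_homogeneous)
    fun x hx => ?_
  choose δ hδ using hx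
  have ht : PiTensorProduct.tprod k x ∈ tensorGr (fun _ : Fin n => A) (∑ i, δ i) :=
    Submodule.subset_span ⟨δ, x, hδ, rfl, rfl⟩
  rw [conjOp, LinearMap.comp_apply, LinearMap.comp_apply, diagMap_of_mem_tensorGr ht, map_smul,
    map_smul, diagMap_of_mem_tensorGr (hφ _ _ ht), smul_smul, sgn_add, ← mul_assoc,
    sgn_mul_self, one_mul, LinearMap.smul_apply]

theorem conjOp_of_mem_homS {M : DGSBimodule.{uk, uc} k} {p : ℤ} {α : Conv M A A}
    (hα : α ∈ homS M A A p) {m n : ℕ} (c : (M.obj m n).carrier) :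
    conjOp A.inv (α m n c) = sgn k p • α m n ((M.obj m n).inv c) := by
  let conjL : EndHom A A m n →ₗ[k] EndHom A A m n :=
    sandwich (diagMap A.inv (Fin m)) (diagMap A.inv (Fin n))
  have : conjL ∘ₗ α m n = sgn k p • (α m n ∘ₗ (M.obj m n).inv) :=
    (M.obj m n).ext_homogeneous fun q c hc => by
      rw [LinearMap.comp_apply, LinearMap.smul_apply, LinearMap.comp_apply,
        (M.obj m n).inv_of_mem hc, map_smul, smul_smul, mul_comm, ← sgn_add]
      exact (hα.1 m n q c hc).conjOp_eq
  exact LinearMap.ext_iff.1 this c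

theorem endD_eq_opBoundary {m n : ℕ} (φ : EndHom A A m n) :
    endD A A φ = opBoundary A.inv A.d φ := by
  have h : ∀ m : ℕ, tensorD (fun _ : Fin m => A) =
      orderedD A.inv A.d (fun i : Fin m => (i : ℕ)) := by
    intro m
    unfold tensorD orderedD
    refine Finset.sum_congr rfl fun i _ => ?_
    congr 1
    funext j
    simp only [Fin.lt_def]
    split_ifs <;> rfl
  rw [endD, opBoundary, h, h]
  rfl

end Degrees

/-! ### Finiteness of sums over graphs -/

section Finiteness

theorem Graph.sum_inn {K m n : ℕ} (g : Graph K m n) :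
    m + ∑ v, g.inn v = n + ∑ v, g.out v := by
  have := Fintype.card_congr g.wire
  simpa [Fintype.card_sum, Fintype.card_sigma] using this.symm

/-- There are finitely many graphs with bounded numbers of vertices and of edges. -/
theorem finite_graphs (m n N : ℕ) :
    {x : Σ K, Graph K m n | x.1 ≤ N ∧ ∑ v, x.2.out v ≤ N}.Finite := by
  let D : Type := Σ K : Fin (N + 1), Σ o : (Fin K → Fin (N + 1)), Σ i : (Fin K → Fin (n + N + 1)),
    (Fin n ⊕ Σ v, Fin (o v)) ≃ (Fin m ⊕ Σ v, Fin (i v))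
  have hout : ∀ x : {x : Σ K, Graph K m n | x.1 ≤ N ∧ ∑ v, x.2.out v ≤ N}, ∀ v,
      x.1.2.out v < N + 1 := fun x v => Nat.lt_succ_of_le
    ((Finset.single_le_sum (fun _ _ => Nat.zero_le _) (Finset.mem_univ v)).trans x.2.2)
  have hinn : ∀ x : {x : Σ K, Graph K m n | x.1 ≤ N ∧ ∑ v, x.2.out v ≤ N}, ∀ v,
      x.1.2.inn v < n + N + 1 := fun x v => by
    have h1 := Finset.single_le_sum (f := x.1.2.inn) (fun _ _ => Nat.zero_le _)
      (Finset.mem_univ v)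
    have h2 := x.1.2.sum_inn
    have h3 := x.2.2
    omega
  let F : {x : Σ K, Graph K m n | x.1 ≤ N ∧ ∑ v, x.2.out v ≤ N} → D := fun x =>
    ⟨⟨x.1.1, Nat.lt_succ_of_le x.2.1⟩, fun v => ⟨x.1.2.out v, hout x v⟩,
      fun v => ⟨x.1.2.inn v, hinn x v⟩, x.1.2.wire⟩
  have hF : Function.Injective F := by
    rintro ⟨⟨K, out, inn, wire, h1, h2, h3, h4⟩, hx⟩ ⟨⟨K', out', inn', wire', h1', h2', h3', h4'⟩,
      hx'⟩ h
    obtain ⟨hK, h⟩ := Sigma.mk.inj h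
    obtain rfl : K = K' := congrArg Fin.val hK
    obtain ⟨ho, h⟩ := Sigma.mk.inj (eq_of_heq h)
    obtain rfl : out = out' := funext fun v => congrArg Fin.val (congrFun ho v)
    obtain ⟨hi, h⟩ := Sigma.mk.inj (eq_of_heq h)
    obtain rfl : inn = inn' := funext fun v => congrArg Fin.val (congrFun hi v)
    obtain rfl : wire = wire' := eq_of_heq h
    rfl
  have : Finite D := inferInstance
  exact Set.finite_coe_iff.1 (Finite.of_injective F hF)

variable {k : Type uk} [Field k] (C : ConilpotentDGCoproperad.{uk, uc} k)

/-- The decomposition of an element involves finitely many graphs. -/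
theorem finite_dec_ne_zero {m n : ℕ} (c : (C.obj m n).carrier) :
    {x : Σ K, Graph K m n | C.dec x.2 c ≠ 0}.Finite := by
  obtain ⟨N, hN⟩ := C.dec_finite c
  refine (finite_graphs m n N).subset fun x hx => ?_
  by_contra h
  refine hx (hN x.1 x.2 ?_)
  simp only [Set.mem_ofPred_eq, not_and_or, not_le] at h
  exact h

/-- A family of terms indexed by graphs, which factor through the decomposition map, is locally
finite. -/
theorem finite_support_of_dec {ι : Type*} {m n : ℕ} (φ : ι → Σ K, Graph K m n)
    (hφ : Function.Injective φ) {W : Type*} [Zero W] (c : (C.obj m n).carrier) (F : ι → W)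
    (hF : ∀ i, C.dec (φ i).2 c = 0 → F i = 0) : (Function.support F).Finite := by
  refine ((finite_dec_ne_zero C c).preimage hφ.injOn).subset fun i hi => ?_
  exact fun h => hi (hF i h)

theorem locSum_apply {ι V W : Type*} [AddCommGroup V] [Module k V] [AddCommGroup W] [Module k W]
    {F : ι → V →ₗ[k] W} (h : ∀ x, (Function.support (fun i => F i x)).Finite) (x : V) :
    locSum F x = ∑ᶠ i, F i x := by
  unfold locSum
  rw [dif_pos h]
  rfl

theorem injective_sigmaMk {m n K : ℕ} :
    Function.Injective (fun g : Graph K m n => (⟨K, g⟩ : Σ K, Graph K m n)) :=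
  fun _ _ h => eq_of_heq (Sigma.mk.inj h).2

end Finiteness

/-! ### Composition along a corolla -/

section Corolla

variable {k : Type uk} [Field k] [CharZero k] {X : Type ua} [AddCommGroup X] [Module k X]
  {s : X →ₗ[k] X}

/-- Without further factors, `blockMap` is the operation itself. -/
theorem koszulPerm_blockMap_isEmpty (hs : ∀ x, s (s x) = x) {a b : ℕ} {T : Type} [Fintype T]
    [IsEmpty T] (t : T → ℕ) (φ : (⨂[k] _ : Fin a, X) →ₗ[k] (⨂[k] _ : Fin b, X)) :
    koszulPerm s (blockRank b t) (fun i : Fin b => (i : ℕ)) (Equiv.sumEmpty (Fin b) T) ∘ₗ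
      blockMap T φ ∘ₗ
      koszulPerm s (fun i : Fin a => (i : ℕ)) (blockRank a t) (Equiv.sumEmpty (Fin a) T).symm =
    φ := by
  rw [koszulPerm_order hs (Equiv.sumEmpty (Fin a) T).symm (by intro i j hij; exact hij),
    koszulPerm_order hs (Equiv.sumEmpty (Fin b) T) (by
      rintro (i | i) (j | j) hij
      · exact hij
      · exact isEmptyElim j
      · exact isEmptyElim i
      · exact isEmptyElim i)]
  refine PiTensorProduct.ext (MultilinearMap.ext fun x => ?_)
  simp only [LinearMap.compMultilinearMap_apply, LinearMap.comp_apply, LinearEquiv.coe_coe,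
    PiTensorProduct.reindex_tprod, blockMap, PiTensorProduct.tmulEquiv_symm_apply,
    TensorProduct.map_tmul, LinearMap.id_apply, Equiv.symm_symm]
  have key : ∀ (w : ⨂[k] _ : Fin b, X) (y : T → X),
      PiTensorProduct.reindex k (fun _ => X) (Equiv.sumEmpty (Fin b) T)
        (PiTensorProduct.tmulEquiv k X (w ⊗ₜ PiTensorProduct.tprod k y)) = w := by
    intro w y
    induction w using PiTensorProduct.induction_on with
    | smul_tprod c z =>
      simp only [← TensorProduct.smul_tmul', map_smul, PiTensorProduct.tmulEquiv_apply,
        PiTensorProduct.reindex_tprod]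
      congr 1
    | add y z hy hz => simp only [TensorProduct.add_tmul, map_add, hy, hz]
  exact key _ _

/-- The composition along a corolla is trivial. -/
theorem compFun_corolla (hs : ∀ x, s (s x) = x) {m n : ℕ}
    (φ : ∀ v, (⨂[k] _ : Fin ((Graph.corolla m n).inn v), X) →ₗ[k]
      (⨂[k] _ : Fin ((Graph.corolla m n).out v), X)) :
    (Graph.corolla m n).compFun s φ = φ 0 := by
  let g := Graph.corolla m n
  change g.compFun s φ = φ 0
  have : IsEmpty (g.Through 0) := ⟨fun x => by
    obtain ⟨e, h1, h2⟩ := x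
    rw [Graph.startsAbove_iff _ (by omega)] at h1
    rcases e with i | ⟨v, i⟩
    · exact absurd (h2 0 i rfl) (lt_irrefl _)
    · have : v = 0 := Subsingleton.elim _ _
      subst this
      simp [Graph.srcLevel] at h1⟩
  have h1 : g.compBelow s φ 1 le_rfl = g.step s 0 (φ 0) := LinearMap.id_comp _
  have hin : g.topEquiv.trans (g.inEquiv 0).symm = (Equiv.sumEmpty _ _).symm := by
    refine Equiv.ext fun i => ?_
    rw [Equiv.trans_apply, Equiv.symm_apply_eq]
    rfl
  have hout : (g.outEquiv 0).trans g.botEquiv.symm = Equiv.sumEmpty _ _ := by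
    refine Equiv.ext fun i => ?_
    rcases i with i | i
    · rw [Equiv.trans_apply, Equiv.symm_apply_eq]
      rfl
    · exact isEmptyElim i
  rw [g.compFun_eq, h1, g.step_eq_opStep, opStep]
  have e1 := koszulPerm_comp hs (Fin.val_injective (n := n)) (g.cutRank_injective 1)
    (blockRank_injective (g.inn 0) (g.throughRank_injective 0)) g.topEquiv (g.inEquiv 0).symm
  have e2 := koszulPerm_comp hs (blockRank_injective (g.out 0) (g.throughRank_injective 0))
    (g.cutRank_injective 0) (Fin.val_injective (n := m)) (g.outEquiv 0) g.botEquiv.symm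
  have e3 : koszulPerm s (g.cutRank 0) (fun i : Fin m => (i : ℕ)) g.botEquiv.symm ∘ₗ
      koszulPerm s (blockRank (g.out 0) (g.throughRank 0)) (g.cutRank 0) (g.outEquiv 0) ∘ₗ
      blockMap (g.Through 0) (φ 0) ∘ₗ
      koszulPerm s (g.cutRank 1) (blockRank (g.inn 0) (g.throughRank 0)) (g.inEquiv 0).symm ∘ₗ
      koszulPerm s (fun i : Fin n => (i : ℕ)) (g.cutRank 1) g.topEquiv = φ 0 := by
    rw [e1, ← LinearMap.comp_assoc, e2, hin, hout]
    exact koszulPerm_blockMap_isEmpty hs (g.throughRank 0) (φ 0)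
  exact e3

end Corolla

/-! ### Evaluation of labelled graphs -/

section Evaluation

variable {k : Type uk} [Field k]

/-- The composition along a graph, as a multilinear map in the operations at the vertices. -/
noncomputable def Graph.compMulti {X : Type ua} [AddCommGroup X] [Module k X] (s : X →ₗ[k] X)
    {K m n : ℕ}
    (g : Graph K m n) : MultilinearMap k
      (fun v => (⨂[k] _ : Fin (g.inn v), X) →ₗ[k] (⨂[k] _ : Fin (g.out v), X))
      ((⨂[k] _ : Fin n, X) →ₗ[k] (⨂[k] _ : Fin m, X)) :=
  (g.comp s).compMultilinearMap (PiTensorProduct.tprod k)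

theorem Graph.comp_tprod {X : Type ua} [AddCommGroup X] [Module k X] (s : X →ₗ[k] X) {K m n : ℕ}
    (g : Graph K m n)
    (φ : ∀ v, (⨂[k] _ : Fin (g.inn v), X) →ₗ[k] (⨂[k] _ : Fin (g.out v), X)) :
    g.comp s (PiTensorProduct.tprod k φ) = g.compFun s φ :=
  PiTensorProduct.lift.tprod _

theorem Graph.compMulti_apply {X : Type ua} [AddCommGroup X] [Module k X] (s : X →ₗ[k] X)
    {K m n : ℕ} (g : Graph K m n)
    (φ : ∀ v, (⨂[k] _ : Fin (g.inn v), X) →ₗ[k] (⨂[k] _ : Fin (g.out v), X)) :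
    g.compMulti s φ = g.compFun s φ :=
  g.comp_tprod s φ

theorem spow_of_even {X : Type ua} [AddCommGroup X] [Module k X] (s : X →ₗ[k] X) {e : ℤ}
    (he : Even e) : spow s e = LinearMap.id := if_pos he

variable (C : ConilpotentDGCoproperad.{uk, uc} k) (A : DGModule.{uk, ua} k)
  (α : Conv C.toDGSBimodule A A) {K m n : ℕ}

theorem cobarEval_cobarIncl (g : Graph K m n) (x : C.Dec g) :
    cobarEval C A α m n (cobarIncl C g x) =
      g.comp A.inv (PiTensorProduct.map (fun v => α (g.out v) (g.inn v)) x) := by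
  unfold cobarEval cobarIncl
  rw [DirectSum.toModule_lof, evalGraph]
  simp only [ite_self, Finset.sum_const_zero, add_zero, spow_of_even _ Even.zero,
    LinearMap.comp_id]
  rfl

theorem cobarEval_cobarIncl_tprod (g : Graph K m n) (c : ∀ v, (C.lab g v).carrier) :
    cobarEval C A α m n (cobarIncl C g (PiTensorProduct.tprod k c)) =
      g.compFun A.inv (fun v => α _ _ (c v)) := by
  rw [cobarEval_cobarIncl, PiTensorProduct.map_tprod, g.comp_tprod]

theorem apply_act_finCongr {a a' b b' : ℕ} (hb : b = b') (ha : a = a')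
    (c : (C.obj b a).carrier) :
    α b' a' (C.act (finCongr hb) (finCongr ha) c) = castOp ha hb (α b a c) := by
  subst ha hb
  exact congrArg _ (C.act_refl c)

/-- Evaluating a graph after an insertion at `v` amounts to evaluating the inserted graph
at `v`. -/
theorem cobarEval_insertAt [CharZero k] {g : Graph K m n} {v : Fin K} {L : ℕ}
    {h : Graph L (g.out v) (g.inn v)} (σ : g.Insertion v h)
    (δ : (C.lab g v).carrier →ₗ[k] C.Dec h) (c : ∀ u, (C.lab g u).carrier) :
    cobarEval C A α m n (cobarIncl C σ.G (C.insertAt σ δ (PiTensorProduct.tprod k c))) =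
      g.compMulti A.inv (Function.update (fun u => α _ _ (c u)) v
        (h.comp A.inv (PiTensorProduct.map (fun w => α (h.out w) (h.inn w)) (δ (c v))))) := by
  let post : C.Dec σ.G →ₗ[k] EndHom A A m n := cobarEval C A α m n ∘ₗ cobarIncl C σ.G
  let J : (⨂[k] y, (C.obj
      (Sum.elim (fun u : ({v}ᶜ : Set (Fin K)) => g.out u) h.out y)
      (Sum.elim (fun u : ({v}ᶜ : Set (Fin K)) => g.inn u) h.inn y)).carrier) →ₗ[k] C.Dec σ.G :=
    PiTensorProduct.map (fun x => C.act
      (finCongr ((σ.out_eq (σ.vert.symm x)).trans (by rw [Equiv.apply_symm_apply])))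
      (finCongr ((σ.inn_eq (σ.vert.symm x)).trans (by rw [Equiv.apply_symm_apply])))) ∘ₗ
    (PiTensorProduct.reindex k (fun y => (C.obj
      (Sum.elim (fun u : ({v}ᶜ : Set (Fin K)) => g.out u) h.out y)
      (Sum.elim (fun u : ({v}ᶜ : Set (Fin K)) => g.inn u) h.inn y)).carrier)
      σ.vert).toLinearMap
  have hJ : ∀ b, J (PiTensorProduct.tprod k b) = PiTensorProduct.tprod k (fun x => C.act
      (finCongr ((σ.out_eq (σ.vert.symm x)).trans (by rw [Equiv.apply_symm_apply])))
      (finCongr ((σ.inn_eq (σ.vert.symm x)).trans (by rw [Equiv.apply_symm_apply])))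
      (b (σ.vert.symm x))) := fun b => by
    rw [LinearMap.comp_apply, LinearEquiv.coe_coe, PiTensorProduct.reindex_tprod,
      PiTensorProduct.map_tprod]
  let ins' : (⨂[k] u : ({v}ᶜ : Set (Fin K)), (C.lab g u).carrier) ⊗[k] C.Dec h →ₗ[k]
      C.Dec σ.G :=
    J ∘ₗ (PiTensorProduct.tmulEquivDep k (fun y => (C.obj
      (Sum.elim (fun u : ({v}ᶜ : Set (Fin K)) => g.out u) h.out y)
      (Sum.elim (fun u : ({v}ᶜ : Set (Fin K)) => g.inn u) h.inn y)).carrier)).toLinearMap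
  let ins : C.Dec h →ₗ[k] C.Dec σ.G := ins' ∘ₗ TensorProduct.mk k _ (C.Dec h)
    (PiTensorProduct.tprod k fun u : ({v}ᶜ : Set (Fin K)) => c u)
  have h1 : C.insertAt σ δ (PiTensorProduct.tprod k c) = ins (δ (c v)) := by
    have := PiTensorProduct.equivPiTensorComplSingletonTensor_tprod k
      (fun u => (C.lab g u).carrier) v c
    exact congrArg (fun t => ins' (TensorProduct.map LinearMap.id δ t)) this
  have h2 : post ∘ₗ ins = (g.compMulti A.inv).toLinearMap (fun u => α _ _ (c u)) v ∘ₗ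
      h.comp A.inv ∘ₗ PiTensorProduct.map (fun w => α (h.out w) (h.inn w)) := by
    refine PiTensorProduct.ext (MultilinearMap.ext fun d => ?_)
    simp only [LinearMap.compMultilinearMap_apply, LinearMap.comp_apply,
      MultilinearMap.toLinearMap_apply, PiTensorProduct.map_tprod, Graph.comp_tprod,
      Graph.compMulti_apply]
    let b : ∀ y, (C.obj
      (Sum.elim (fun u : ({v}ᶜ : Set (Fin K)) => g.out u) h.out y)
      (Sum.elim (fun u : ({v}ᶜ : Set (Fin K)) => g.inn u) h.inn y)).carrier :=
      fun y => Sum.rec (fun u => c u) d y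
    have e1 : PiTensorProduct.tmulEquivDep k (fun y => (C.obj
      (Sum.elim (fun u : ({v}ᶜ : Set (Fin K)) => g.out u) h.out y)
      (Sum.elim (fun u : ({v}ᶜ : Set (Fin K)) => g.inn u) h.inn y)).carrier)
        ((PiTensorProduct.tprod k fun u : ({v}ᶜ : Set (Fin K)) => c u) ⊗ₜ
          PiTensorProduct.tprod k d) = PiTensorProduct.tprod k b :=
      PiTensorProduct.tmulEquivDep_apply _ _ _ _
    have hb : ∀ (y) (x) (hx : σ.vert.symm x = y) (ho) (hi),
        α (σ.G.out x) (σ.G.inn x) (C.act (finCongr ho) (finCongr hi) (b (σ.vert.symm x))) =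
          castOp ((σ.inn_eq y).trans (by rw [← hx, Equiv.apply_symm_apply]))
            ((σ.out_eq y).trans (by rw [← hx, Equiv.apply_symm_apply])) (α _ _ (b y)) := by
      rintro y x rfl ho hi
      exact apply_act_finCongr C A α _ _ _
    have e2 := (congrArg J e1).trans (hJ b)
    refine (congrArg post e2).trans ((cobarEval_cobarIncl_tprod C A α σ.G _).trans ?_)
    refine σ.compFun_G _ (fun w => α _ _ (d w)) _ A.inv_inv (fun u => ?_) (fun w => ?_) ?_
    · rw [Function.update_of_ne u.2]
      exact hb _ _ (Equiv.symm_apply_apply _ _) _ _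
    · exact hb _ _ (Equiv.symm_apply_apply _ _) _ _
    · rw [Function.update_self]
  rw [h1]
  exact LinearMap.ext_iff.1 h2 (δ (c v))

end Evaluation

/-! ### Gebra structures as Maurer–Cartan elements -/

section GebraMC

variable {k : Type uk} [Field k] (C : ConilpotentDGCoproperad.{uk, uc} k)
  (A : DGModule.{uk, ua} k) (α : Conv C.toDGSBimodule A A) {K m n : ℕ}

theorem spow_neg_one {X : Type ua} [AddCommGroup X] [Module k X] (s : X →ₗ[k] X) :
    spow s (-1) = s := if_neg (by decide)

/-- The square `α ⋆ α`, for `α` of degree `-1`. -/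
theorem star_self_apply (c : (C.obj m n).carrier) :
    star C A (-1) (-1) α α m n c = ∑ᶠ h : Graph 2 m n, h.weight k •
      h.comp A.inv (PiTensorProduct.map (fun w => α (h.out w) (h.inn w))
        (PiTensorProduct.map (fun w => if w = 0 then (C.lab h w).inv else LinearMap.id)
          (C.dec h c))) := by
  rw [star, locSum_apply]
  · refine finsum_congr fun h => ?_
    have key : (PiTensorProduct.map fun v =>
        (if v = 0 then α (h.out v) (h.inn v) else α (h.out v) (h.inn v)) ∘ₗ
          spow (C.lab h v).inv ((∑ w, if v < w then if w = 0 then -1 else -1 else 0) + 0)) =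
        PiTensorProduct.map (fun w => α (h.out w) (h.inn w)) ∘ₗ
          PiTensorProduct.map
            (fun w => if w = 0 then (C.lab h w).inv else LinearMap.id) := by
      rw [← PiTensorProduct.map_comp]
      congr 1
      funext v
      fin_cases v
      · simp [spow_neg_one]
      · simp [spow_of_even]
    rw [evalGraph, key]
    rfl
  · intro x
    refine finite_support_of_dec C _ injective_sigmaMk x _ fun h hh => ?_
    simp only [LinearMap.smul_apply, LinearMap.comp_apply]
    rw [show C.dec h x = 0 from hh, map_zero, smul_zero]

/-- The labels of the vertices before `v`, with the sign of an operator of degree `-1` that moves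
past their desuspensions. -/
noncomputable def prefixLabels (g : Graph K m n) (v : Fin K) (c : ∀ u, (C.lab g u).carrier)
    (u : Fin K) :
    (C.lab g u).carrier :=
  if u < v then -(C.lab g u).inv (c u) else c u

theorem prefixLabels_self (g : Graph K m n) (v : Fin K) (c : ∀ u, (C.lab g u).carrier) :
    prefixLabels C g v c v = c v := if_neg (lt_irrefl v)

theorem prefixSign_tprod (g : Graph K m n) (v : Fin K) (c : ∀ u, (C.lab g u).carrier) :
    prefixSign C g v (PiTensorProduct.tprod k c) =
      PiTensorProduct.tprod k (prefixLabels C g v c) := by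
  rw [prefixSign, PiTensorProduct.map_tprod]
  congr 1
  funext u
  unfold prefixLabels
  split_ifs <;> rfl

theorem insertAt_tprod_eq_zero {g : Graph K m n} {v : Fin K} {L : ℕ}
    {h : Graph L (g.out v) (g.inn v)} (σ : g.Insertion v h)
    (δ : (C.lab g v).carrier →ₗ[k] C.Dec h) (c : ∀ u, (C.lab g u).carrier) (hc : δ (c v) = 0) :
    C.insertAt σ δ (PiTensorProduct.tprod k c) = 0 := by
  have h1 := PiTensorProduct.equivPiTensorComplSingletonTensor_tprod k
    (fun u => (C.lab g u).carrier) v c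
  have h2 : TensorProduct.map (LinearMap.id (R := k)
      (M := ⨂[k] u : ({v}ᶜ : Set (Fin K)), (C.lab g u).carrier)) δ
      (PiTensorProduct.equivPiTensorComplSingletonTensor k (fun u => (C.lab g u).carrier) v
        (PiTensorProduct.tprod k c)) = 0 :=
    (congrArg _ h1).trans ((TensorProduct.map_tmul _ _ _ _).trans (by
      rw [hc, TensorProduct.tmul_zero]))
  rw [DGSBimodule.insertAt, ← LinearMap.comp_assoc, ← LinearMap.comp_assoc]
  have h3 : ∀ {V W Z : Type _} [AddCommGroup V] [Module k V] [AddCommGroup W] [Module k W]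
      [AddCommGroup Z] [Module k Z] (J : W →ₗ[k] Z) (F : V →ₗ[k] W) (x : V), F x = 0 →
      (J ∘ₗ F) x = 0 := fun J F x hx => by rw [LinearMap.comp_apply, hx, map_zero]
  exact h3 _ _ _ h2

/-- The image of the differential of the cobar construction in `End_A`. -/
theorem cobarEval_cobarD_tprod [CharZero k] (g : Graph K m n) (c : ∀ u, (C.lab g u).carrier) :
    cobarEval C A α m n (cobarD C g (PiTensorProduct.tprod k c)) =
      ∑ v, g.compMulti A.inv (Function.update (fun u => α _ _ (prefixLabels C g v c u)) v
        (-(α _ _ ((C.lab g v).d (c v)) + star C A (-1) (-1) α α _ _ (c v)))) := by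
  rw [cobarD, LinearMap.sum_apply, map_sum]
  refine Finset.sum_congr rfl fun v _ => ?_
  let F : (Σ h : Graph 2 (g.out v) (g.inn v), g.Insertion v h) → C.Dec g →ₗ[k] CobarPre C m n :=
    fun x => x.1.weight k • (cobarIncl C x.2.G ∘ₗ
          C.insertAt x.2 (PiTensorProduct.map
            (fun w => if w = 0 then (C.lab x.1 w).inv else LinearMap.id) ∘ₗ C.dec x.1) ∘ₗ
          prefixSign C g v)
  have hF : ∀ x, (Function.support (fun i => F i x)).Finite := by
    intro x
    induction x using PiTensorProduct.induction_on with
    | smul_tprod a c =>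
      have hinj : Function.Injective
          (fun i : (Σ h : Graph 2 (g.out v) (g.inn v), g.Insertion v h) =>
            (⟨2, i.1⟩ : Σ L, Graph L (g.out v) (g.inn v))) := by
        rintro ⟨h, σ⟩ ⟨h', σ'⟩ e
        obtain rfl : h = h' := injective_sigmaMk e
        rw [Subsingleton.elim σ σ']
      refine finite_support_of_dec C _ hinj (c v) _ fun i hi => ?_
      simp only [F, map_smul, LinearMap.smul_apply, LinearMap.comp_apply, prefixSign_tprod]
      rw [insertAt_tprod_eq_zero, map_zero, smul_zero, smul_zero]
      rw [prefixLabels_self, LinearMap.comp_apply]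
      exact (congrArg _ hi).trans (map_zero _)
    | add x y hx hy =>
      refine (hx.union hy).subset fun i hi => ?_
      by_contra h
      simp only [Set.mem_union, not_or, Function.notMem_support] at h
      exact hi (by simp only [map_add, h.1, h.2, add_zero])
  let L : EndHom A A (g.out v) (g.inn v) →ₗ[k] EndHom A A m n :=
    (g.compMulti A.inv).toLinearMap (fun u => α _ _ (prefixLabels C g v c u)) v
  let T : Graph 2 (g.out v) (g.inn v) → EndHom A A (g.out v) (g.inn v) := fun h =>
    h.weight k • h.comp A.inv (PiTensorProduct.map (fun w => α (h.out w) (h.inn w))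
        (PiTensorProduct.map (fun w => if w = 0 then (C.lab h w).inv else LinearMap.id)
          (C.dec h (c v))))
  have hT : (Function.support T).Finite := by
    refine finite_support_of_dec C _ injective_sigmaMk (c v) _ fun h hh => ?_
    simp only [T]
    rw [show C.dec h (c v) = 0 from hh, map_zero, map_zero, map_zero, smul_zero]
  have h2 : cobarEval C A α m n (locSum F (PiTensorProduct.tprod k c)) =
      L (star C A (-1) (-1) α α _ _ (c v)) := by
    rw [locSum_apply hF, star_self_apply, map_finsum _ (hF _), map_finsum _ hT,
      ← finsum_comp_equiv (Equiv.sigmaUnique (Graph 2 (g.out v) (g.inn v)) (g.Insertion v))]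
    refine finsum_congr fun x => ?_
    simp only [F, T, LinearMap.smul_apply, LinearMap.comp_apply, map_smul, prefixSign_tprod,
      cobarEval_insertAt, prefixLabels_self]
    rfl
  have h1 : cobarEval C A α m n (cobarIncl C g (PiTensorProduct.map
      (fun u => if u = v then (C.lab g u).d else LinearMap.id)
        (prefixSign C g v (PiTensorProduct.tprod k c)))) = L (α _ _ ((C.lab g v).d (c v))) := by
    rw [prefixSign_tprod, PiTensorProduct.map_tprod, cobarEval_cobarIncl_tprod]
    refine (congrArg (g.compFun A.inv) (funext fun u => ?_)).trans (g.compMulti_apply _ _).symm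
    by_cases hu : u = v
    · subst hu
      rw [Function.update_self, if_pos rfl, prefixLabels_self]
    · rw [Function.update_of_ne hu, if_neg hu, LinearMap.id_apply]
  change cobarEval C A α m n (-(cobarIncl C g (PiTensorProduct.map
      (fun u => if u = v then (C.lab g u).d else LinearMap.id)
        (prefixSign C g v (PiTensorProduct.tprod k c)))) - locSum F (PiTensorProduct.tprod k c)) =
      L (-(α _ _ ((C.lab g v).d (c v)) + star C A (-1) (-1) α α _ _ (c v)))
  rw [map_sub, map_neg, h1, h2, map_neg, map_add, neg_add, sub_eq_add_neg]

theorem endD_add (φ ψ : EndHom A A m n) : endD A A (φ + ψ) = endD A A φ + endD A A ψ := by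
  simp only [endD, LinearMap.comp_add, LinearMap.add_comp]
  abel

theorem endD_smul (a : k) (φ : EndHom A A m n) : endD A A (a • φ) = a • endD A A φ := by
  simp only [endD, LinearMap.comp_smul, LinearMap.smul_comp, smul_sub]

/-- The differential of a composite in `End_A` of values of `α`. -/
theorem endD_compFun [CharZero k] (hα : α ∈ homS C.toDGSBimodule A A (-1)) (g : Graph K m n)
    (c : ∀ u, (C.lab g u).carrier) :
    endD A A (g.compFun A.inv (fun v => α _ _ (c v))) =
      ∑ v, g.compMulti A.inv (Function.update (fun u => α _ _ (prefixLabels C g v c u)) v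
        (endD A A (α _ _ (c v)))) := by
  rw [endD_eq_opBoundary, g.opBoundary_compFun A.inv_inv A.inv_d]
  refine Finset.sum_congr rfl fun v _ =>
    (congrArg (g.compFun A.inv) (funext fun u => ?_)).trans (g.compMulti_apply _ _).symm
  rcases lt_trichotomy u v with hu | rfl | hu
  · rw [if_pos hu, Function.update_of_ne hu.ne, prefixLabels, if_pos hu, conjOp_of_mem_homS hα,
      sgn_neg_one, map_neg]
    exact neg_one_smul k (α (g.out u) (g.inn u) ((C.lab g u).inv (c u)))
  · rw [if_neg (lt_irrefl u), if_pos rfl, Function.update_self, endD_eq_opBoundary]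
  · rw [if_neg hu.not_gt, if_neg hu.ne', Function.update_of_ne hu.ne', prefixLabels,
      if_neg hu.not_gt]

theorem convD_neg_one_apply (c : (C.obj m n).carrier) :
    convD C.toDGSBimodule A A (-1) α m n c =
      endD A A (α m n c) + α m n ((C.obj m n).d c) := by
  simp only [convD, LinearMap.sub_apply, LinearMap.coe_mk, AddHom.coe_mk, sgn_neg_one,
    LinearMap.smul_apply, LinearMap.comp_apply, neg_smul, one_smul, sub_neg_eq_add]

/-- Gebra structures over the cobar construction are the solutions of the Maurer–Cartan equation
`∂α + α ⋆ α = 0`: it is the compatibility with the differentials on generators, and both sides of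
this compatibility are derivations. -/
theorem isGebra_iff [CharZero k] : IsGebra C A α ↔ α ∈ homS C.toDGSBimodule A A (-1) ∧
    convD C.toDGSBimodule A A (-1) α + star C A (-1) (-1) α α = 0 := by
  refine and_congr_right fun hα => ?_
  have hE : ∀ {K m n : ℕ} (g : Graph K m n) (c : ∀ u, (C.lab g u).carrier),
      endD A A (cobarEval C A α m n (cobarIncl C g (PiTensorProduct.tprod k c))) =
        ∑ v, g.compMulti A.inv (Function.update (fun u => α _ _ (prefixLabels C g v c u)) v
          (endD A A (α _ _ (c v)))) := fun g c =>
    (congrArg (endD A A) (cobarEval_cobarIncl_tprod C A α g c)).trans (endD_compFun C A α hα g c)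
  refine ⟨fun h => ?_, fun h => ?_⟩
  · refine funext fun m => funext fun n => LinearMap.ext fun c => ?_
    have := (hE _ _).symm.trans ((h 1 m n (Graph.corolla m n)
      (PiTensorProduct.tprod k fun _ => c)).trans (cobarEval_cobarD_tprod C A α _ _))
    rw [Fin.sum_univ_one, Fin.sum_univ_one, Graph.compMulti_apply, Graph.compMulti_apply,
      compFun_corolla A.inv_inv, compFun_corolla A.inv_inv, Function.update_self,
      Function.update_self] at this
    change convD C.toDGSBimodule A A (-1) α m n c + star C A (-1) (-1) α α m n c = 0
    rw [convD_neg_one_apply, add_assoc]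
    exact eq_neg_iff_add_eq_zero.1 this
  · intro K m n g x
    have hL : ∀ m n (c : (C.obj m n).carrier), endD A A (α m n c) =
        -(α m n ((C.obj m n).d c) + star C A (-1) (-1) α α m n c) := fun m n c => by
      rw [eq_neg_iff_add_eq_zero, ← add_assoc, ← convD_neg_one_apply]
      exact LinearMap.ext_iff.1 (congrFun (congrFun h m) n) c
    induction x using PiTensorProduct.induction_on with
    | smul_tprod a c =>
      rw [map_smul, map_smul, map_smul, map_smul, endD_smul]
      refine congrArg _ ((hE g c).trans ?_)
      rw [cobarEval_cobarD_tprod]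
      exact Finset.sum_congr rfl fun v _ => by rw [hL]
    | add x y hx hy => rw [map_add, map_add, map_add, map_add, endD_add, hx, hy]

end GebraMC

/-! ### The operations on equal arguments of degree zero -/

section EqualArguments

variable {k : Type uk} [Field k]

theorem koszulSign_zero {ι κ : Type*} [Fintype ι] (r : ι → ℕ) (r' : κ → ℕ) (e : ι ≃ κ) :
    koszulSign k r r' e (fun _ => 0) = 1 := by
  simp [koszulSign, sgn_zero]

variable (C : ConilpotentDGCoproperad.{uk, uc} k) (A : DGModule.{uk, ua} k)
  (B : DGModule.{uk, ub} k)

open Classical in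
/-- The summand of `β ◁ f` supported by the two-level graph `G`. -/
noncomputable def upTerm (β : Conv C.toDGSBimodule B B) (f : ConvU C.toDGSBimodule A B) {m n : ℕ}
    (G : UpGraph m n) : (C.obj m n).carrier →ₗ[k] EndHom A B m n :=
  (G.g.weight k * (G.p.factorial : k)⁻¹) •
      (projAB A B m n ∘ₗ
        sandwich LinearMap.id (row A B (fun x =>
          if ∃ j, G.g.wire (.inl x) = .inr ⟨0, j⟩ then some (f.1, 0) else none)) ∘ₗ
        evalGraph C.toDGSBimodule (mixInv A B) G.g
          (fun v => if v = 0 then embBB A B _ _ ∘ₗ β _ _ else embAB A B _ _ ∘ₗ f.2 _ _)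
          (fun _ => 0) 0 ∘ₗ
        C.dec G.g)

theorem lhd_eq (β : Conv C.toDGSBimodule B B) (f : ConvU C.toDGSBimodule A B) :
    lhd C A B β f = (0, fun _ _ => locSum (upTerm C A B β f)) := rfl

open Classical in
/-- The summand of `f ▷ α` supported by the two-level graph `G`. -/
noncomputable def downTerm (e : ℤ) (f : ConvU C.toDGSBimodule A B) (α : Conv C.toDGSBimodule A A)
    {m n : ℕ} (G : DownGraph m n) : (C.obj m n).carrier →ₗ[k] EndHom A B m n :=
  (G.g.weight k * (G.p.factorial : k)⁻¹) •
      (projAB A B m n ∘ₗ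
        sandwich (row A B (fun y =>
          if ∃ i, G.g.wire (.inr ⟨Fin.last G.p, i⟩) = .inl y then some (f.1, 0) else none))
          LinearMap.id ∘ₗ
        evalGraph C.toDGSBimodule (mixInv A B) G.g
          (fun v => if v = Fin.last G.p then embAA A B _ _ ∘ₗ α _ _
            else embAB A B _ _ ∘ₗ f.2 _ _)
          (fun v => if v = Fin.last G.p then e else 0) 0 ∘ₗ
        C.dec G.g)

theorem rhd_eq (e : ℤ) (f : ConvU C.toDGSBimodule A B) (α : Conv C.toDGSBimodule A A) :
    rhd C A B e f α = (0, fun _ _ => locSum (downTerm C A B e f α)) := rfl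

/-- The number of places on the saturated top level. -/
def UpGraph.places {m n : ℕ} (G : UpGraph m n) : ℕ := G.p + Fintype.card G.Direct

/-- The number of places on the saturated bottom level. -/
def DownGraph.places {m n : ℕ} (G : DownGraph m n) : ℕ := Fintype.card G.Direct + G.p

/-- There are `r!` ways to distribute `r` factors among `r` places. -/
theorem card_equiv_places {r : ℕ} {κ : Type} [Fintype κ] [DecidableEq κ] :
    ((Fintype.card (Fin r ≃ κ) : ℕ) : k) =
      if Fintype.card κ = r then (r.factorial : k) else 0 := by
  split_ifs with h
  · rw [Fintype.card_equiv (Fintype.equivOfCardEq (by simpa using h.symm)), Fintype.card_fin]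
  · have : IsEmpty (Fin r ≃ κ) := ⟨fun e => h (by simpa using (Fintype.card_congr e).symm)⟩
    rw [Fintype.card_eq_zero, Nat.cast_zero]

theorem opU_const (e : ℤ) (β : Conv C.toDGSBimodule B B) (f : ConvU C.toDGSBimodule A B) (r : ℕ) :
    opU C A B e β (fun _ : Fin r => 0) (fun _ => f) = fun m n =>
      locSum (fun G : UpGraph m n =>
        (if G.places = r then (r.factorial : k) else 0) • upTerm C A B β f G) := by
  classical
  funext m n
  unfold opU
  refine congrArg locSum (funext fun G => ?_)
  have hl : (Fin.cases (embBB A B _ _ ∘ₗ β _ _) (fun t => embAB A B _ _ ∘ₗ f.2 _ _) :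
      ∀ v : Fin (G.p + 1), (C.lab G.g v).carrier →ₗ[k]
        ((⨂[k] _ : Fin (G.g.inn v), A.carrier × B.carrier) →ₗ[k]
        (⨂[k] _ : Fin (G.g.out v), A.carrier × B.carrier))) =
      fun v => if v = 0 then embBB A B (G.g.out v) (G.g.inn v) ∘ₗ β _ _
        else embAB A B _ _ ∘ₗ f.2 _ _ := by
    funext v
    refine Fin.cases ?_ (fun t => ?_) v
    · rw [if_pos rfl]
      rfl
    · rw [if_neg (Fin.succ_ne_zero t)]
      rfl
  have hd : evalGraph C.toDGSBimodule (mixInv A B) G.g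
      (fun v => if v = 0 then embBB A B (G.g.out v) (G.g.inn v) ∘ₗ β _ _
        else embAB A B _ _ ∘ₗ f.2 _ _) (Fin.cases e (fun _ => 0)) 0 =
      evalGraph C.toDGSBimodule (mixInv A B) G.g
      (fun v => if v = 0 then embBB A B (G.g.out v) (G.g.inn v) ∘ₗ β _ _
        else embAB A B _ _ ∘ₗ f.2 _ _) (fun _ => 0) 0 := by
    -- the vertex `0` comes after no other vertex, so that the degree of `β` does not matter
    unfold evalGraph
    congr 2
    funext v
    congr 3
    refine Finset.sum_congr rfl fun w _ => ?_
    refine Fin.cases ?_ (fun t => ?_) w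
    · rw [if_neg (Fin.not_lt_zero v), if_neg (Fin.not_lt_zero v)]
    · rfl
  simp only [koszulSign_zero, one_smul, Finset.sum_const_zero, dite_eq_ite, hl, hd,
    Finset.sum_const, Finset.card_univ]
  rw [upTerm, ← Nat.cast_smul_eq_nsmul k, smul_smul, smul_smul, mul_comm, card_equiv_places,
    Fintype.card_sum, Fintype.card_fin]
  rfl

theorem opD_const (e : ℤ) (f : ConvU C.toDGSBimodule A B) (α : Conv C.toDGSBimodule A A) (r : ℕ) :
    opD C A B (fun _ : Fin r => 0) (fun _ => f) e α = fun m n =>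
      locSum (fun G : DownGraph m n =>
        (if G.places = r then (r.factorial : k) else 0) • downTerm C A B e f α G) := by
  classical
  funext m n
  unfold opD
  refine congrArg locSum (funext fun G => ?_)
  have hl : (Fin.lastCases (embAA A B _ _ ∘ₗ α _ _) (fun t => embAB A B _ _ ∘ₗ f.2 _ _) :
      ∀ v : Fin (G.p + 1), (C.lab G.g v).carrier →ₗ[k]
        ((⨂[k] _ : Fin (G.g.inn v), A.carrier × B.carrier) →ₗ[k]
        (⨂[k] _ : Fin (G.g.out v), A.carrier × B.carrier))) =
      fun v => if v = Fin.last G.p then embAA A B (G.g.out v) (G.g.inn v) ∘ₗ α _ _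
        else embAB A B _ _ ∘ₗ f.2 _ _ := by
    funext v
    refine Fin.lastCases ?_ (fun t => ?_) v
    · rw [if_pos rfl, Fin.lastCases_last]
    · rw [if_neg (Fin.castSucc_lt_last t).ne, Fin.lastCases_castSucc]
  have hd : (Fin.lastCases e (fun _ => 0) : Fin (G.p + 1) → ℤ) =
      fun v => if v = Fin.last G.p then e else 0 := by
    funext v
    refine Fin.lastCases ?_ (fun t => ?_) v
    · rw [if_pos rfl, Fin.lastCases_last]
    · rw [if_neg (Fin.castSucc_lt_last t).ne, Fin.lastCases_castSucc]
  simp only [koszulSign_zero, one_smul, dite_eq_ite, hl, hd, Finset.sum_const, Finset.card_univ]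
  rw [downTerm, ← Nat.cast_smul_eq_nsmul k, smul_smul, smul_smul, mul_comm, card_equiv_places,
    Fintype.card_sum, Fintype.card_fin]
  rfl

end EqualArguments

/-! ### Convergence for the density filtration -/

section Convergence

theorem Graph.size_le {K m n : ℕ} (g : Graph K m n) : g.size ≤ n + ∑ v, g.out v := by
  classical
  unfold Graph.size
  refine Finset.sup_le fun S _ => (Finset.card_filter_le _ _).trans ?_
  simp [Fintype.card_sum, Fintype.card_sigma]

/-- The direct input legs cross the level just above the bottom vertex. -/
theorem UpGraph.card_direct_le {m n : ℕ} (G : UpGraph m n) :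
    Fintype.card G.Direct ≤ G.g.size := by
  classical
  unfold Graph.size
  refine le_trans ?_ (Finset.le_sup (b := Finset.univ.erase 0) ?_)
  · rw [← Finset.card_univ]
    refine Finset.card_le_card_of_injOn (fun x => Sum.inl x.1) (fun x _ => ?_) (fun x _ y _ h => ?_)
    · obtain ⟨x, j, hx⟩ := x
      simp only [Finset.coe_filter, Finset.mem_univ, true_and, Set.mem_ofPred_eq]
      refine ⟨fun v i h => (by cases h), fun w i h => ?_⟩
      rw [hx] at h
      obtain rfl : (0 : Fin (G.p + 1)) = w := congrArg Sigma.fst (Sum.inr.inj h)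
      exact Finset.notMem_erase _ _
    · exact Subtype.ext (Sum.inl.inj h)
  · simp only [Finset.mem_filter, Finset.mem_univ, true_and]
    intro v w i j h hw
    exact absurd (G.two_level v w i j h) (Finset.ne_of_mem_erase hw)

/-- The direct output legs cross the level just below the top vertex. -/
theorem DownGraph.card_direct_le {m n : ℕ} (G : DownGraph m n) :
    Fintype.card G.Direct ≤ G.g.size := by
  classical
  unfold Graph.size
  refine le_trans ?_ (Finset.le_sup (b := {Fin.last G.p}) ?_)
  · rw [← Finset.card_univ]
    have key : ∀ y : G.Direct, ∃ i, G.g.wire (.inr ⟨Fin.last G.p, i⟩) = .inl y.1 := fun y => y.2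
    choose i hi using key
    refine Finset.card_le_card_of_injOn (fun y => Sum.inr ⟨Fin.last G.p, i y⟩) (fun y _ => ?_)
      (fun x _ y _ h => ?_)
    · simp only [Finset.coe_filter, Finset.mem_univ, true_and, Set.mem_ofPred_eq]
      refine ⟨fun v j h => ?_, fun w j h => ?_⟩
      · obtain rfl : Fin.last G.p = v := congrArg Sigma.fst (Sum.inr.inj h)
        exact Finset.mem_singleton_self _
      · rw [hi] at h
        cases h
    · exact Subtype.ext (Sum.inl.inj ((hi x).symm.trans ((congrArg G.g.wire h).trans (hi y))))
  · simp only [Finset.mem_filter, Finset.mem_univ, true_and]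
    intro v w i j h _
    rw [Finset.mem_singleton]
    exact G.two_level v w i j h

/-- The saturated top level is not empty. -/
theorem UpGraph.places_pos {m n : ℕ} (G : UpGraph m n) : 0 < G.places := by
  by_contra h
  have hp : G.p = 0 := by unfold UpGraph.places at h; omega
  have hD : Fintype.card G.Direct = 0 := by unfold UpGraph.places at h; omega
  rcases he : G.g.wire.symm (.inr ⟨0, ⟨0, G.inn_pos⟩⟩) with x | ⟨v, i⟩
  · have : IsEmpty G.Direct := Fintype.card_eq_zero_iff.1 hD
    exact this.elim ⟨x, ⟨0, G.inn_pos⟩, by rw [← he, Equiv.apply_symm_apply]⟩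
  · have h0 := G.g.progressive v 0 i ⟨0, G.inn_pos⟩ (by rw [← he, Equiv.apply_symm_apply])
    have hv := v.2
    rw [Fin.lt_def] at h0
    omega

/-- The saturated bottom level is not empty. -/
theorem DownGraph.places_pos {m n : ℕ} (G : DownGraph m n) : 0 < G.places := by
  by_contra h
  have hp : G.p = 0 := by unfold DownGraph.places at h; omega
  have hD : Fintype.card G.Direct = 0 := by unfold DownGraph.places at h; omega
  rcases he : G.g.wire (.inr ⟨Fin.last G.p, ⟨0, G.out_pos⟩⟩) with y | ⟨w, j⟩
  · have : IsEmpty G.Direct := Fintype.card_eq_zero_iff.1 hD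
    exact this.elim ⟨y, ⟨0, G.out_pos⟩, he⟩
  · have h0 := G.g.progressive _ _ _ _ he
    rw [Fin.lt_def, Fin.val_last] at h0
    omega

theorem UpGraph.injective_toSigma (m n : ℕ) :
    Function.Injective (fun G : UpGraph m n => (⟨G.p + 1, G.g⟩ : Σ K, Graph K m n)) := by
  rintro ⟨p, g, h1, h2⟩ ⟨p', g', h1', h2'⟩ h
  obtain ⟨hp, hg⟩ := Sigma.mk.inj h
  obtain rfl : p = p' := Nat.succ_injective hp
  obtain rfl : g = g' := eq_of_heq hg
  rfl

theorem DownGraph.injective_toSigma (m n : ℕ) :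
    Function.Injective (fun G : DownGraph m n => (⟨G.p + 1, G.g⟩ : Σ K, Graph K m n)) := by
  rintro ⟨p, g, h1, h2⟩ ⟨p', g', h1', h2'⟩ h
  obtain ⟨hp, hg⟩ := Sigma.mk.inj h
  obtain rfl : p = p' := Nat.succ_injective hp
  obtain rfl : g = g' := eq_of_heq hg
  rfl

variable {k : Type uk} [Field k] (C : ConilpotentDGCoproperad.{uk, uc} k)

theorem mem_density_iff {r m n : ℕ} {c : (C.obj m n).carrier} :
    c ∈ C.density r m n ↔ ∀ (K : ℕ) (g : Graph K m n), r < K + g.size → C.dec g c = 0 := by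
  simp [ConilpotentDGCoproperad.density, Submodule.mem_iInf]

theorem mem_coradical_iff {r m n : ℕ} {c : (C.obj m n).carrier} :
    c ∈ C.coradical r m n ↔ ∀ (K : ℕ) (g : Graph K m n), r < K → C.dec g c = 0 := by
  simp [ConilpotentDGCoproperad.coradical, Submodule.mem_iInf]

theorem exists_mem_coradical {m n : ℕ} (c : (C.obj m n).carrier) :
    ∃ r, c ∈ C.coradical r m n := by
  obtain ⟨N, hN⟩ := C.dec_finite c
  exact ⟨N, (mem_coradical_iff C).2 fun K g h => hN K g (.inl h)⟩

theorem exists_mem_density {m n : ℕ} (c : (C.obj m n).carrier) :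
    ∃ r, c ∈ C.density r m n := by
  obtain ⟨N, hN⟩ := C.dec_finite c
  refine ⟨N + n + N, (mem_density_iff C).2 fun K g h => hN K g ?_⟩
  have := g.size_le
  omega

/-- A locally finite sum is the sum, for `r` from `1` to `N`, of its parts indexed by the `r`-th
level of a positive function `ν`, on the elements where the terms with `ν > N` vanish. -/
theorem sum_locSum_levels [CharZero k] {ι : Type*} {V W : Type*} [AddCommGroup V] [Module k V]
    [AddCommGroup W] [Module k W] {F : ι → V →ₗ[k] W}
    (hF : ∀ x, (Function.support (fun i => F i x)).Finite) (ν : ι → ℕ) (hν : ∀ i, 0 < ν i) {x : V}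
    {N : ℕ} (hN : ∀ i, N < ν i → F i x = 0) :
    ∑ r ∈ Finset.Icc 1 N, (r.factorial : k)⁻¹ •
      locSum (fun i => (if ν i = r then (r.factorial : k) else 0) • F i) x = locSum F x := by
  classical
  have hs : ∀ r y, (Function.support
      (fun i => ((if ν i = r then (r.factorial : k) else 0) • F i) y)).Finite := fun r y =>
    (hF y).subset fun i hi h => hi (by
      simp only [LinearMap.smul_apply]
      rw [show F i y = 0 from h, smul_zero])
  have h1 : ∀ r, (r.factorial : k)⁻¹ •
      locSum (fun i => (if ν i = r then (r.factorial : k) else 0) • F i) x =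
        ∑ i ∈ (hF x).toFinset, if ν i = r then F i x else 0 := fun r => by
    rw [locSum_apply (hs r), finsum_eq_sum_of_support_subset (s := (hF x).toFinset),
      Finset.smul_sum]
    · refine Finset.sum_congr rfl fun i _ => ?_
      rw [LinearMap.smul_apply, smul_smul]
      split_ifs
      · rw [inv_mul_cancel₀ (Nat.cast_ne_zero.2 (Nat.factorial_ne_zero r)), one_smul]
      · rw [mul_zero, zero_smul]
    · intro i hi
      rw [Set.Finite.coe_toFinset]
      refine fun h => hi ?_
      simp only [LinearMap.smul_apply]
      rw [show F i x = 0 from h, smul_zero]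
  rw [Finset.sum_congr rfl fun r _ => h1 r, Finset.sum_comm, locSum_apply hF,
    finsum_eq_sum _ (hF x)]
  refine Finset.sum_congr rfl fun i hi => ?_
  rw [Finset.sum_ite_eq, if_pos]
  rw [Finset.mem_Icc]
  refine ⟨hν i, not_lt.1 fun h => ?_⟩
  rw [Set.Finite.mem_toFinset] at hi
  exact hi (hN i h)

variable (A : DGModule.{uk, ua} k) (B : DGModule.{uk, ub} k)

theorem upTerm_eq_zero (β : Conv C.toDGSBimodule B B) (f : ConvU C.toDGSBimodule A B) {m n : ℕ}
    (G : UpGraph m n) {c : (C.obj m n).carrier} (hc : C.dec G.g c = 0) :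
    upTerm C A B β f G c = 0 := by
  simp only [upTerm, LinearMap.smul_apply, LinearMap.comp_apply, hc, map_zero, smul_zero]

theorem downTerm_eq_zero (e : ℤ) (f : ConvU C.toDGSBimodule A B) (α : Conv C.toDGSBimodule A A)
    {m n : ℕ} (G : DownGraph m n) {c : (C.obj m n).carrier} (hc : C.dec G.g c = 0) :
    downTerm C A B e f α G c = 0 := by
  simp only [downTerm, LinearMap.smul_apply, LinearMap.comp_apply, hc, map_zero, smul_zero]

/-- The series of the operations `U_{r+1}(sβ, f, …, f) / r!` converges to `β ◁ f`. -/
theorem sum_opU [CharZero k] (e : ℤ) (β : Conv C.toDGSBimodule B B)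
    (f : ConvU C.toDGSBimodule A B) {N m n : ℕ} {c : (C.obj m n).carrier}
    (hc : c ∈ C.density N m n) :
    ∑ r ∈ Finset.Icc 1 N, (r.factorial : k)⁻¹ •
      opU C A B e β (fun _ : Fin r => 0) (fun _ => f) m n c = (lhd C A B β f).2 m n c := by
  simp only [opU_const, lhd_eq]
  refine sum_locSum_levels (fun x => finite_support_of_dec C _ (UpGraph.injective_toSigma m n) x _
    fun G hG => upTerm_eq_zero C A B β f G hG) _ (fun G => G.places_pos) fun G hG =>
      upTerm_eq_zero C A B β f G ((mem_density_iff C).1 hc _ _ ?_)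
  have := G.card_direct_le
  unfold UpGraph.places at hG
  omega

/-- The series of the operations `D_{r+1}(f, …, f, sα) / r!` converges to `f ▷ α`. -/
theorem sum_opD [CharZero k] (e : ℤ) (f : ConvU C.toDGSBimodule A B)
    (α : Conv C.toDGSBimodule A A) {N m n : ℕ} {c : (C.obj m n).carrier}
    (hc : c ∈ C.density N m n) :
    ∑ r ∈ Finset.Icc 1 N, (r.factorial : k)⁻¹ •
      opD C A B (fun _ : Fin r => 0) (fun _ => f) e α m n c = (rhd C A B e f α).2 m n c := by
  simp only [opD_const, rhd_eq]
  refine sum_locSum_levels (fun x => finite_support_of_dec C _ (DownGraph.injective_toSigma m n) x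
    _ fun G hG => downTerm_eq_zero C A B e f α G hG) _ (fun G => G.places_pos) fun G hG =>
      downTerm_eq_zero C A B e f α G ((mem_density_iff C).1 hc _ _ ?_)
  have := G.card_direct_le
  unfold DownGraph.places at hG
  omega

theorem density_mono {r r' m n : ℕ} (h : r ≤ r') : C.density r m n ≤ C.density r' m n :=
  fun _ hc => (mem_density_iff C).2 fun K g hg => (mem_density_iff C).1 hc K g (h.trans_lt hg)

/-- The canonical filtrations are separated. -/
theorem eq_zero_of_mem_filConv {α : Conv C.toDGSBimodule A A} (h : ∀ r, α ∈ filConv C A r) :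
    α = 0 := by
  refine funext fun m => funext fun n => LinearMap.ext fun c => ?_
  obtain ⟨r, hr⟩ := exists_mem_coradical C c
  exact h (r + 1) m n c hr

theorem eq_zero_of_mem_filConvU {f : ConvU C.toDGSBimodule A B}
    (h : ∀ r, f ∈ filConvU C A B r) : f = 0 := by
  refine Prod.ext ((h 2).1 le_rfl) (funext fun m => funext fun n => LinearMap.ext fun c => ?_)
  obtain ⟨r, hr⟩ := exists_mem_density C c
  exact (h (r + 1)).2 m n c hr

/-- If the partial sums `S` of a series converge to `E` for a separated filtration, then they
converge to `0` if and only if `E = 0`. -/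
theorem tendsto_zero_iff {V : Type*} [AddCommGroup V] [Module k V] {fil : ℕ → Submodule k V}
    (hsep : ∀ x, (∀ r, x ∈ fil r) → x = 0) {S : ℕ → V} {E : V}
    (hS : ∀ r, ∃ N₀, ∀ N ≥ N₀, S N - E ∈ fil r) :
    (∀ r, ∃ N₀, ∀ N ≥ N₀, S N ∈ fil r) ↔ E = 0 := by
  constructor
  · intro h
    refine hsep E fun r => ?_
    obtain ⟨N₁, h₁⟩ := h r
    obtain ⟨N₂, h₂⟩ := hS r
    have := Submodule.sub_mem _ (h₁ (max N₁ N₂) (le_max_left _ _))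
      (h₂ (max N₁ N₂) (le_max_right _ _))
    rwa [sub_sub_cancel] at this
  · rintro rfl r
    obtain ⟨N₀, h₀⟩ := hS r
    exact ⟨N₀, fun N hN => by simpa using h₀ N hN⟩

theorem neg_one_smul_sub_one_smul {V : Type*} [AddCommGroup V] [Module k V] (x : V) :
    (-1 : k) • x - (1 : k) • x = (-2 : k) • x := by
  rw [← sub_smul]
  norm_num

theorem neg_sub_neg_eq_zero_iff {V₁ V₂ V₃ : Type*} [AddCommGroup V₁] [AddCommGroup V₂]
    [AddCommGroup V₃] (a : V₁) (b b' : V₂) (c : V₃) :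
    (-a, b - b', -c) = (0 : V₁ × V₂ × V₃) ↔ a = 0 ∧ c = 0 ∧ b' = b := by
  rw [Prod.mk_eq_zero, Prod.mk_eq_zero, neg_eq_zero, neg_eq_zero, sub_eq_zero, eq_comm (a := b),
    and_comm (a := b' = b)]

theorem prod_sub_mem {V₁ V₂ V₃ : Type*} [AddCommGroup V₁] [Module k V₁] [AddCommGroup V₂]
    [Module k V₂] [AddCommGroup V₃] [Module k V₃] {F₁ : Submodule k V₁} {F₂ : Submodule k V₂}
    {F₃ : Submodule k V₃} (a : V₁) {b b' : V₂} (c : V₃) (h : b - b' ∈ F₂) :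
    ((a, b, c) - (a, b', c) : V₁ × V₂ × V₃) ∈ F₁.prod (F₂.prod F₃) := by
  simpa [Submodule.mem_prod] using h

theorem inv_factorial_mul [CharZero k] (r : ℕ) :
    ((r + 1).factorial : k)⁻¹ * ((r + 1 : ℕ) : k) = (r.factorial : k)⁻¹ := by
  rw [Nat.factorial_succ, Nat.cast_mul, mul_inv, mul_comm, ← mul_assoc,
    mul_inv_cancel₀ (Nat.cast_ne_zero.2 (Nat.succ_ne_zero r)), one_mul]

theorem sum_inv_factorial_sub {V : Type*} [AddCommGroup V] [Module k V] {D op : ℕ → V} {X : V}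
    (h1 : op 1 = D 1 - X) (h2 : ∀ r, op (r + 2) = D (r + 2)) (M : ℕ) :
    ∑ n ∈ Finset.Icc 1 (M + 1), (n.factorial : k)⁻¹ • op n =
      ∑ j ∈ Finset.Icc 1 (M + 1), (j.factorial : k)⁻¹ • D j - X := by
  induction M with
  | zero => simp [h1]
  | succ M ih =>
    rw [Finset.sum_Icc_succ_top (b := M + 1) (by omega), ih,
      Finset.sum_Icc_succ_top (b := M + 1) (by omega), h2, add_sub_right_comm]

theorem sum_inv_factorial_prod [CharZero k] {V₁ V₂ V₃ : Type*} [AddCommGroup V₁] [Module k V₁]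
    [AddCommGroup V₂] [Module k V₂] [AddCommGroup V₃] [Module k V₃] {D : ℕ → V₂}
    {op : ℕ → V₁ × V₂ × V₃} {X₁ S₁ : V₁} {X₂ : V₂} {X₃ S₃ : V₃} (h1 : op 1 = (-X₁, -X₂, -X₃))
    (h2 : ∀ r, op (r + 2) = (if r = 0 then (-2 : k) • S₁ else 0,
      ((r + 2 : ℕ) : k) • D (r + 1), if r = 0 then (-2 : k) • S₃ else 0)) (M : ℕ) :
    ∑ n ∈ Finset.Icc 1 (M + 2), (n.factorial : k)⁻¹ • op n =
      (-(X₁ + S₁), ∑ j ∈ Finset.Icc 1 (M + 1), (j.factorial : k)⁻¹ • D j - X₂, -(X₃ + S₃)) := by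
  have h3 : ∀ r, ((r + 2).factorial : k)⁻¹ • ((r + 2 : ℕ) : k) • D (r + 1) =
      ((r + 1).factorial : k)⁻¹ • D (r + 1) := fun r => by
    rw [smul_smul, inv_factorial_mul (r + 1)]
  induction M with
  | zero =>
    have h4 : ((2 : ℕ).factorial : k)⁻¹ * (-2) = -1 := by norm_num [Nat.factorial]
    rw [zero_add, zero_add, Finset.sum_Icc_succ_top (b := 1) (by omega), Finset.Icc_self,
      Finset.sum_singleton, Finset.sum_singleton, h1, h2 0, if_pos rfl, if_pos rfl, Prod.smul_mk,
      Prod.smul_mk, Prod.smul_mk, Prod.smul_mk, h3, Prod.mk_add_mk, Prod.mk_add_mk, smul_smul,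
      smul_smul, h4]
    simp only [Nat.cast_one, inv_one, one_smul, neg_smul, neg_add, zero_add,
      Nat.factorial, mul_one]
    rw [neg_add_eq_sub X₂ (D 1)]
  | succ M ih =>
    rw [Finset.sum_Icc_succ_top (b := M + 2) (by omega), ih,
      Finset.sum_Icc_succ_top (b := M + 1) (by omega), h2 (M + 1), if_neg (Nat.succ_ne_zero M),
      if_neg (Nat.succ_ne_zero M), Prod.smul_mk, Prod.smul_mk, h3, Prod.mk_add_mk, Prod.mk_add_mk,
      smul_zero, smul_zero, add_zero, add_zero, add_sub_right_comm]

end Convergence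

/-! ### Maurer–Cartan elements -/

section MaurerCartan

variable {k : Type uk} [Field k] [CharZero k] (C : ConilpotentDGCoproperad.{uk, uc} k)
  (A : DGModule.{uk, ua} k) (B : DGModule.{uk, ub} k)

/-- The difference of the operations `D_{r+1}(f, …, f, sα)` and `U_{r+1}(sβ, f, …, f)`. -/
noncomputable def opDiff (α : Conv C.toDGSBimodule A A) (f : ConvU C.toDGSBimodule A B)
    (β : Conv C.toDGSBimodule B B) (r : ℕ) : ConvU C.toDGSBimodule A B :=
  (0, opD C A B (fun _ : Fin r => 0) (fun _ => f) (-1) α -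
    opU C A B (-1) β (fun _ : Fin r => 0) (fun _ => f))

theorem sum_opDiff (α : Conv C.toDGSBimodule A A) (f : ConvU C.toDGSBimodule A B)
    (β : Conv C.toDGSBimodule B B) {r N : ℕ} (hN : r ≤ N) :
    ∑ j ∈ Finset.Icc 1 N, (j.factorial : k)⁻¹ • opDiff C A B α f β j -
      (rhd C A B (-1) f α - lhd C A B β f) ∈ filConvU C A B r := by
  constructor
  · intro _
    simp [opDiff, Prod.fst_sum, rhd_eq, lhd_eq]
  · intro m n c hc
    have hc' := density_mono C ((Nat.sub_le r 1).trans hN) hc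
    simp only [Prod.snd_sub, Prod.snd_sum, Prod.smul_snd, opDiff, Pi.sub_apply, Finset.sum_apply,
      Pi.smul_apply, LinearMap.sub_apply, LinearMap.sum_apply, LinearMap.smul_apply, smul_sub,
      Finset.sum_sub_distrib, sum_opU C A B (-1) β f hc', sum_opD C A B (-1) f α hc', sub_self]

theorem mem_MC_morLInfty_iff (α : Conv C.toDGSBimodule A A) (f : ConvU C.toDGSBimodule A B)
    (β : Conv C.toDGSBimodule B B) :
    f ∈ (morLInfty C A B α β).MC ↔ IsInftyMorphism C A B α β f := by
  have hS := sum_inv_factorial_sub (k := k) (V := ConvU C.toDGSBimodule A B)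
    (D := opDiff C A B α f β) (op := fun n => (morLInfty C A B α β).op n (fun _ => 0) (fun _ => f))
    (X := convUD C.toDGSBimodule A B 0 f) rfl fun _ => rfl
  have h := tendsto_zero_iff (V := ConvU C.toDGSBimodule A B) (fil := filConvU C A B)
    (fun x => eq_zero_of_mem_filConvU C A B)
    (S := fun N => ∑ n ∈ Finset.Icc 1 N, (n.factorial : k)⁻¹ •
      ((morLInfty C A B α β).op n (fun _ => 0) (fun _ => f) : ConvU C.toDGSBimodule A B))
    (E := rhd C A B (-1) f α - lhd C A B β f - convUD C.toDGSBimodule A B 0 f)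
    fun r => ⟨r + 1, fun N hN => by
      obtain ⟨M, rfl⟩ : ∃ M, N = M + 1 := ⟨N - 1, by omega⟩
      have := sum_opDiff C A B α f β (r := r) (N := M + 1) (by omega)
      rw [← sub_sub_sub_cancel_right _ _ (convUD C.toDGSBimodule A B 0 f), ← hS M] at this
      exact this⟩
  exact and_congr_right fun _ => h.trans
    ⟨fun h0 => (sub_eq_zero.1 h0).symm, fun h0 => sub_eq_zero.2 h0.symm⟩

omit [CharZero k] in
theorem bracket_zero_self (α : Conv C.toDGSBimodule A A) :
    bracket C A 0 0 α α = (-2 : k) • star C A (-1) (-1) α α := by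
  rw [bracket, mul_zero, sgn_zero, zero_sub, sgn_neg_one]
  exact neg_one_smul_sub_one_smul (k := k) (star C A (-1) (-1) α α)

/-- The limit of the Maurer–Cartan series of `𝔨`. -/
noncomputable def curvature (α : Conv C.toDGSBimodule A A) (f : ConvU C.toDGSBimodule A B)
    (β : Conv C.toDGSBimodule B B) :
    Conv C.toDGSBimodule A A × ConvU C.toDGSBimodule A B × Conv C.toDGSBimodule B B :=
  (-(convD C.toDGSBimodule A A (-1) α + star C A (-1) (-1) α α),
    rhd C A B (-1) f α - lhd C A B β f - convUD C.toDGSBimodule A B 0 f,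
    -(convD C.toDGSBimodule B B (-1) β + star C B (-1) (-1) β β))

omit [CharZero k] in
theorem convLInfty_op_one (α : Conv C.toDGSBimodule A A) (f : ConvU C.toDGSBimodule A B)
    (β : Conv C.toDGSBimodule B B) :
    (convLInfty C A B).op 1 (fun _ => 0) (fun _ => (α, f, β)) =
      (-convD C.toDGSBimodule A A (-1) α, -convUD C.toDGSBimodule A B 0 f,
        -convD C.toDGSBimodule B B (-1) β) := rfl

omit [CharZero k] in
theorem convLInfty_op_add_two (α : Conv C.toDGSBimodule A A) (f : ConvU C.toDGSBimodule A B)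
    (β : Conv C.toDGSBimodule B B) (r : ℕ) :
    (convLInfty C A B).op (r + 2) (fun _ => 0) (fun _ => (α, f, β)) =
      ((if r = 0 then (-2 : k) • star C A (-1) (-1) α α else 0,
        ((r + 2 : ℕ) : k) • opDiff C A B α f β (r + 1),
        if r = 0 then (-2 : k) • star C B (-1) (-1) β β else 0) :
        Conv C.toDGSBimodule A A × ConvU C.toDGSBimodule A B × Conv C.toDGSBimodule B B) := by
  rw [← bracket_zero_self, ← bracket_zero_self, opDiff]
  refine Prod.ext rfl (Prod.ext (Prod.ext ?_ ?_) rfl)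
  · exact (smul_zero _).symm
  · simp only [convLInfty, zero_mul, sgn_zero, one_smul, Finset.sum_const, Finset.card_univ,
      Fintype.card_fin, Prod.smul_snd, Nat.cast_smul_eq_nsmul, zero_sub]

omit [CharZero k] in
theorem curvature_eq_zero_iff (α : Conv C.toDGSBimodule A A) (f : ConvU C.toDGSBimodule A B)
    (β : Conv C.toDGSBimodule B B) :
    curvature C A B α f β = 0 ↔ convD C.toDGSBimodule A A (-1) α + star C A (-1) (-1) α α = 0 ∧
      convD C.toDGSBimodule B B (-1) β + star C B (-1) (-1) β β = 0 ∧
      convUD C.toDGSBimodule A B 0 f = rhd C A B (-1) f α - lhd C A B β f :=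
  neg_sub_neg_eq_zero_iff (V₁ := Conv C.toDGSBimodule A A) (V₂ := ConvU C.toDGSBimodule A B)
    (V₃ := Conv C.toDGSBimodule B B) _ _ _ _

/-- The carrier of `𝔨`. -/
abbrev ConvTriple : Type _ :=
  Conv C.toDGSBimodule A A × ConvU C.toDGSBimodule A B × Conv C.toDGSBimodule B B

/-- The filtration of `𝔨`. -/
abbrev filTriple (r : ℕ) : Submodule k (ConvTriple C A B) :=
  (filConv C A r).prod ((filConvU C A B r).prod (filConv C B r))

omit [CharZero k] in
theorem eq_zero_of_mem_filTriple (x : ConvTriple C A B) (hx : ∀ r, x ∈ filTriple C A B r) :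
    x = 0 :=
  Prod.ext (eq_zero_of_mem_filConv C A fun r => (hx r).1)
    (Prod.ext (eq_zero_of_mem_filConvU C A B fun r => (hx r).2.1)
      (eq_zero_of_mem_filConv C B fun r => (hx r).2.2))

/-- The partial sum of the Maurer–Cartan series of `𝔨`. -/
noncomputable def partialSum (α : Conv C.toDGSBimodule A A) (f : ConvU C.toDGSBimodule A B)
    (β : Conv C.toDGSBimodule B B) (N : ℕ) : ConvTriple C A B :=
  ∑ n ∈ Finset.Icc 1 N, (n.factorial : k)⁻¹ •
    ((convLInfty C A B).op n (fun _ => 0) (fun _ => (α, f, β)) : ConvTriple C A B)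

theorem partialSum_eq (α : Conv C.toDGSBimodule A A) (f : ConvU C.toDGSBimodule A B)
    (β : Conv C.toDGSBimodule B B) (M : ℕ) :
    partialSum C A B α f β (M + 2) =
      (-(convD C.toDGSBimodule A A (-1) α + star C A (-1) (-1) α α),
        ∑ j ∈ Finset.Icc 1 (M + 1), (j.factorial : k)⁻¹ • opDiff C A B α f β j -
          convUD C.toDGSBimodule A B 0 f,
        -(convD C.toDGSBimodule B B (-1) β + star C B (-1) (-1) β β)) :=
  sum_inv_factorial_prod (k := k) (D := opDiff C A B α f β)
    (op := fun n => (convLInfty C A B).op n (fun _ => 0) (fun _ => (α, f, β)))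
    (convLInfty_op_one C A B α f β) (convLInfty_op_add_two C A B α f β) M

theorem partialSum_sub_curvature_mem (α : Conv C.toDGSBimodule A A)
    (f : ConvU C.toDGSBimodule A B) (β : Conv C.toDGSBimodule B B) {r N : ℕ} (hN : r + 2 ≤ N) :
    partialSum C A B α f β N - curvature C A B α f β ∈ filTriple C A B r := by
  obtain ⟨M, rfl⟩ : ∃ M, N = M + 2 := ⟨N - 2, by omega⟩
  have h1 := sum_opDiff C A B α f β (r := r) (N := M + 1) (by omega)
  rw [← sub_sub_sub_cancel_right _ _ (convUD C.toDGSBimodule A B 0 f)] at h1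
  have h2 := prod_sub_mem (V₁ := Conv C.toDGSBimodule A A)
    (V₂ := ConvU C.toDGSBimodule A B) (V₃ := Conv C.toDGSBimodule B B)
    (F₁ := filConv C A r) (F₃ := filConv C B r)
    (-(convD C.toDGSBimodule A A (-1) α + star C A (-1) (-1) α α))
    (-(convD C.toDGSBimodule B B (-1) β + star C B (-1) (-1) β β)) h1
  rw [partialSum_eq]
  exact h2

theorem mem_MC_convLInfty_iff (α : Conv C.toDGSBimodule A A) (f : ConvU C.toDGSBimodule A B)
    (β : Conv C.toDGSBimodule B B) :
    (α, f, β) ∈ (convLInfty C A B).MC ↔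
      IsGebra C A α ∧ IsGebra C B β ∧ IsInftyMorphism C A B α β f := by
  have h := (tendsto_zero_iff (S := partialSum C A B α f β) (E := curvature C A B α f β)
    (eq_zero_of_mem_filTriple C A B) fun r =>
      ⟨r + 2, fun _ => partialSum_sub_curvature_mem C A B α f β⟩).trans
      (curvature_eq_zero_iff C A B α f β)
  rw [isGebra_iff, isGebra_iff]
  constructor
  · rintro ⟨⟨hα, hf, hβ⟩, hMC⟩
    obtain ⟨h1, h2, h3⟩ := h.1 hMC
    exact ⟨⟨hα, h1⟩, ⟨hβ, h2⟩, hf, h3⟩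
  · rintro ⟨⟨hα, h1⟩, ⟨hβ, h2⟩, hf, h3⟩
    exact ⟨⟨hα, hf, hβ⟩, h.2 ⟨h1, h2, h3⟩⟩

end MaurerCartan

end Gebra

theorem mainTheorem4 {k : Type*} [Field k] [CharZero k] (C : Gebra.ConilpotentDGCoproperad k)
    (A : Gebra.DGModule k) (B : Gebra.DGModule k) :
    (∀ (α : Gebra.Conv C.toDGSBimodule A A) (f : Gebra.ConvU C.toDGSBimodule A B)
        (β : Gebra.Conv C.toDGSBimodule B B),
      (α, f, β) ∈ (Gebra.convLInfty C A B).MC ↔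
        Gebra.IsGebra C A α ∧ Gebra.IsGebra C B β ∧ Gebra.IsInftyMorphism C A B α β f) ∧
    (∀ (α : Gebra.Conv C.toDGSBimodule A A) (β : Gebra.Conv C.toDGSBimodule B B),
      Gebra.IsGebra C A α → Gebra.IsGebra C B β →
        (Gebra.morLInfty C A B α β).MC = {f | Gebra.IsInftyMorphism C A B α β f}) :=
  ⟨fun α f β => Gebra.mem_MC_convLInfty_iff C A B α f β, fun α β _ _ =>
    Set.ext fun f => Gebra.mem_MC_morLInfty_iff C A B α f β⟩
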